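/- Let $k$ be a field and let $H$ be a coquasi-Hopf algebra over $k$ with bijective antipode. That is, $H$ is a coassociative counital coalgebra with coalgebra maps $m:H\otimes H\to H$, $u:k\to H$ and a convolution invertible $\omega\in(H\otimes H\otimes H)^*$ such that $$h_1(g_1k_1)\,\omega(h_2,g_2,k_2)=\omega(h_1,g_1,k_1)\,(h_2g_2)k_2,\qquad 1h=h1=h,\qquad \omega(h,1,g)=\varepsilon(h)\varepsilon(g),$$ $$\omega(h_1,g_1,k_1l_1)\,\omega(h_2g_2,k_2,l_2)=\omega(g_1,k_1,l_1)\,\omega(h_1,g_2k_2,l_2)\,\omega(h_2,g_3,k_3),$$ together with a bijective coalgebra antihomomorphism $S:H\to H$ and $\alpha,\beta\in H^*$ such that $S(h_1)\alpha(h_2)h_3=\alpha(h)1$, $h_1\beta(h_2)S(h_3)=\beta(h)1$ and $$\omega(h_1\beta(h_2),S(h_3),\alpha(h_4)h_5)=\varepsilon(h)=\omega^{-1}(S(h_1),\alpha(h_2)h_3\beta(h_4),S(h_5)).$$ The category $\mathcal M^H$ of right $H$-comodules is monoidal for $\otimes=\otimes_k$ with the codiagonal coaction and the associativity constraint $(u\otimes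 v)\otimes w\mapsto u_0\otimes(v_0\otimes w_0)\,\omega(u_1,v_1,w_1)$. Let $A$ be a right $H$-comodule algebra, i.e. an algebra in $\mathcal M^H$, and let $B=A^{coH}=\{a\in A: a_0\otimes a_1=a\otimes 1\}$, which is an associative $k$-algebra. Assume that $A$ is faithfully flat as a left $B$-module and that $A$ is Galois over $B$: the map $$A\otimes_BA\to A\otimes H,\qquad a\otimes b\mapsto a_0b_0\otimes b_4\,\omega^{-1}(a_1,b_1\beta(b_2),S(b_3))$$ is bijective. Let $L=(A\otimes A^{op})^{coH}$, the coinvariants of $A\otimes A$ for the codiagonal coaction $a\otimes b\mapsto a_0\otimes b_0\otimes a_1b_1$. It is an associative algebra with unit $1\otimes1$ and multiplication $$(a\otimes b)(c\otimes d)=a_0c_0\otimes d_0b_0\,\omega^{-1}(a_1,c_1,d_1b_1)\,\omega(c_2,d_2,b_2),$$ and $s:B\to L$, $s(b)=b\otimes1$, and $t:B^{op}\to L$, $t(b)=1\otimes b$, are algebra maps with commuting images. Let $U:{}_L\mathcal M\to{}_B\mathcal M_B$ be the forgetful functor, where $bn=s(b)n$ and $nb=t(b)n$. Let ${}_A\mathcal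 M_A^H$ be the category of $A$-bimodules in $\mathcal M^H$. It is monoidal with the tensor product $\bigcirc_A$ over $A$ formed in $\mathcal M^H$ (the coequalizer of the two maps $(M\otimes A)\otimes N\rightrightarrows M\otimes N$) and with unit object $A$. Let $G:{}_A\mathcal M_A^H\to{}_L\mathcal M$, $G(M)=M^{coH}$, with the $L$-action $(a\otimes b)m=a(mb)$. Then $G$ is an equivalence of categories, and the category ${}_L\mathcal M$ of left $L$-modules is monoidal by transport of structure along $G$. More precisely, there are a monoidal structure on ${}_L\mathcal M$, a (strong) monoidal structure on the functor $G$ and a (strong) monoidal structure on the forgetful functor $U:{}_L\mathcal M\to{}_B\mathcal M_B$ such that: 1. The composite monoidal functor $U\circ G=(-)^{coH}:{}_A\mathcal M_A^H\to{}_B\mathcal M_B$ has the canonical constraints $M^{coH}\otimes_BN^{coH}\to(M\bigcirc_AN)^{coH}$, $m\otimes n\mapsto m\bigcirc n$ (the class of $m\otimes n$), and $B\to A^{coH}$, $b\mapsto b$. 2. $L$ is a $\times_B$-bialgebra in the sense of Takeuchi (a left bialgebroid over $B$) with source $s$ and target $t$, that is, there are a comultiplication $\Delta:L\to L\otimes_BL$,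 where $L\otimes_BL=L\otimes L/(t(b)x\otimes y-x\otimes s(b)y)$, and a counit given by an algebra map $\epsilon:L\to\mathrm{End}_k(B)$ such that: - $\Delta$ is coassociative, $\Delta(s(b))=s(b)\otimes1$, $\Delta(t(b))=1\otimes t(b)$, $x_1t(b)\otimes x_2=x_1\otimes x_2s(b)$ and $\Delta(xy)=\Delta(x)\Delta(y)$; - $\epsilon(s(b))(c)=bc$, $\epsilon(t(b))(c)=cb$, and $s(\epsilon(x_1)(1))x_2=x=t(\epsilon(x_2)(1))x_1$. This structure induces the monoidal structure of ${}_L\mathcal M$ over ${}_B\mathcal M_B$: under the constraint isomorphisms $U(N)\otimes_BU(N')\cong U(N\otimes N')$ and $B\cong U(\mathbf 1)$ of $U$, the $L$-action on $N\otimes N'$ is the diagonal action $x(n\otimes n')=x_1n\otimes x_2n'$, and the $L$-action on the unit object is $x\cdot b=\epsilon(x)(b)$. -/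

import Mathlib

open CategoryTheory MonoidalCategory TensorProduct

universe u

noncomputable section

/-- Convolution `c ↦ f(c₁) φ(c₂)` of a linear map `f` with a functional `φ` on a coalgebra. -/
def convR {k C V : Type*} [Field k] [AddCommMonoid C] [Module k C] [Coalgebra k C]
    [AddCommMonoid V] [Module k V] (f : C →ₗ[k] V) (φ : C →ₗ[k] k) : C →ₗ[k] V :=
  (TensorProduct.rid k V).toLinearMap ∘ₗ TensorProduct.map f φ ∘ₗ Coalgebra.comul

/-- Convolution `c ↦ φ(c₁) f(c₂)` of a functional `φ` with a linear map `f` on a coalgebra. -/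
def convL {k C V : Type*} [Field k] [AddCommMonoid C] [Module k C] [Coalgebra k C]
    [AddCommMonoid V] [Module k V] (φ : C →ₗ[k] k) (f : C →ₗ[k] V) : C →ₗ[k] V :=
  (TensorProduct.lid k V).toLinearMap ∘ₗ TensorProduct.map φ f ∘ₗ Coalgebra.comul

/-- The functional `c ⊗ d ↦ φ(c) ψ(d)`. -/
def tmulFun {k C D : Type*} [Field k] [AddCommMonoid C] [Module k C] [AddCommMonoid D] [Module k D]
    (φ : C →ₗ[k] k) (ψ : D →ₗ[k] k) : C ⊗[k] D →ₗ[k] k :=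
  (TensorProduct.lid k k).toLinearMap ∘ₗ TensorProduct.map φ ψ

/-- A coquasi-bialgebra: a coalgebra `H` with coalgebra maps `mul`, `unit` and a convolution
invertible functional `ω` on `H ⊗ H ⊗ H` (all tensor products are associated to the left). -/
class CoquasiBialgebra (k H : Type u) [Field k] [AddCommGroup H] [Module k H]
    [Coalgebra k H] where
  mul : H ⊗[k] H →ₗc[k] H
  unit : k →ₗc[k] H
  ω : H ⊗[k] H ⊗[k] H →ₗ[k] k
  ωInv : H ⊗[k] H ⊗[k] H →ₗ[k] k
  ω_mul_ωInv : convL ω ωInv = Coalgebra.counit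
  ωInv_mul_ω : convL ωInv ω = Coalgebra.counit
  /-- `h₁(g₁k₁) ω(h₂,g₂,k₂) = ω(h₁,g₁,k₁) (h₂g₂)k₂` -/
  mul_assoc' :
    convR (mul.toLinearMap ∘ₗ mul.toLinearMap.lTensor H ∘ₗ
        (TensorProduct.assoc k H H H).toLinearMap) ω =
      convL ω (mul.toLinearMap ∘ₗ mul.toLinearMap.rTensor H)
  one_mul' : ∀ h : H, mul (unit 1 ⊗ₜ h) = h
  mul_one' : ∀ h : H, mul (h ⊗ₜ unit 1) = h
  /-- `ω(h₁,g₁,k₁l₁) ω(h₂g₂,k₂,l₂) = ω(g₁,k₁,l₁) ω(h₁,g₂k₂,l₂) ω(h₂,g₃,k₃)` -/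
  cocycle :
    convL (ω ∘ₗ mul.toLinearMap.lTensor (H ⊗[k] H) ∘ₗ
          (TensorProduct.assoc k (H ⊗[k] H) H H).toLinearMap)
        (ω ∘ₗ (mul.toLinearMap.rTensor H).rTensor H) =
      convL (tmulFun Coalgebra.counit ω ∘ₗ
            (TensorProduct.assoc k H (H ⊗[k] H) H).toLinearMap ∘ₗ
            (TensorProduct.assoc k H H H).toLinearMap.rTensor H)
        (convL (ω ∘ₗ (mul.toLinearMap.lTensor H ∘ₗ
              (TensorProduct.assoc k H H H).toLinearMap).rTensor H)
          (tmulFun ω Coalgebra.counit))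
  ω_one : ∀ h g : H, ω (h ⊗ₜ unit 1 ⊗ₜ g) = Coalgebra.counit (R := k) h * Coalgebra.counit (R := k) g

/-- A coquasi-Hopf algebra. -/
class CoquasiHopfAlgebra (k H : Type u) [Field k] [AddCommGroup H] [Module k H]
    [Coalgebra k H] extends CoquasiBialgebra k H where
  S : H →ₗ[k] H
  /-- `Δ(S(h)) = S(h₂) ⊗ S(h₁)` -/
  comul_S : Coalgebra.comul ∘ₗ S =
    TensorProduct.map S S ∘ₗ (TensorProduct.comm k H H).toLinearMap ∘ₗ Coalgebra.comul
  counit_S : Coalgebra.counit ∘ₗ S = (Coalgebra.counit : H →ₗ[k] k)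
  α : H →ₗ[k] k
  β : H →ₗ[k] k
  /-- `S(h₁) α(h₂) h₃ = α(h) 1` -/
  S_α : mul.toLinearMap ∘ₗ TensorProduct.map S (convL α LinearMap.id) ∘ₗ Coalgebra.comul =
    α.smulRight (unit 1)
  /-- `h₁ β(h₂) S(h₃) = β(h) 1` -/
  β_S : mul.toLinearMap ∘ₗ TensorProduct.map (convR LinearMap.id β) S ∘ₗ Coalgebra.comul =
    β.smulRight (unit 1)
  /-- `ω(h₁ β(h₂), S(h₃), α(h₄) h₅) = ε(h)` -/
  ω_S : ω ∘ₗ TensorProduct.map (TensorProduct.map (convR LinearMap.id β) S ∘ₗ Coalgebra.comul)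
      (convL α LinearMap.id) ∘ₗ Coalgebra.comul = Coalgebra.counit
  /-- `ω⁻¹(S(h₁), α(h₂) h₃ β(h₄), S(h₅)) = ε(h)` -/
  ωInv_S : ωInv ∘ₗ TensorProduct.map
      (TensorProduct.map S (convR (convL α LinearMap.id) β) ∘ₗ Coalgebra.comul) S ∘ₗ
      Coalgebra.comul = Coalgebra.counit

/-- A right coaction of a coalgebra `C` on a vector space `V`. -/
structure Coaction (k C V : Type*) [Field k] [AddCommMonoid C] [Module k C] [Coalgebra k C]
    [AddCommMonoid V] [Module k V] where
  ρ : V →ₗ[k] V ⊗[k] C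
  coassoc : ∀ v, TensorProduct.assoc k V C C (ρ.rTensor C (ρ v)) =
    (Coalgebra.comul (R := k) (A := C)).lTensor V (ρ v)
  counit : ∀ v, TensorProduct.rid k V
    ((Coalgebra.counit (R := k) (A := C)).lTensor V (ρ v)) = v

namespace Coaction

variable {k C D E V W X : Type*} [Field k] [AddCommMonoid C] [Module k C] [Coalgebra k C]
  [AddCommMonoid D] [Module k D] [Coalgebra k D] [AddCommMonoid E] [Module k E] [Coalgebra k E]
  [AddCommMonoid V] [Module k V] [AddCommMonoid W] [Module k W] [AddCommMonoid X] [Module k X]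
  (v : Coaction k C V) (w : Coaction k D W) (x : Coaction k E X)

/-- The action `m ↦ m₀ φ(m₁)` of a functional on a comodule. -/
def act (φ : C →ₗ[k] k) : V →ₗ[k] V :=
  (TensorProduct.rid k V).toLinearMap ∘ₗ φ.lTensor V ∘ₗ v.ρ

lemma act_counit : v.act Coalgebra.counit = LinearMap.id :=
  LinearMap.ext fun m => v.counit m

lemma lTensor_ρ_act (φ : C →ₗ[k] k) (f : C →ₗ[k] X) (m : V) :
    f.lTensor V (v.ρ (v.act φ m)) = (convR f φ).lTensor V (v.ρ m) := by
  have h1 : ∀ y : V ⊗[k] C, f.lTensor V (v.ρ (TensorProduct.rid k V (φ.lTensor V y))) =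
      (((TensorProduct.rid k X).toLinearMap ∘ₗ TensorProduct.map f φ).lTensor V)
        (TensorProduct.assoc k V C C (v.ρ.rTensor C y)) := by
    intro y
    induction y with
    | zero => simp
    | add a b ha hb => simp only [map_add, ha, hb]
    | tmul m c =>
      simp only [LinearMap.lTensor_tmul, TensorProduct.rid_tmul, map_smul, LinearMap.rTensor_tmul]
      generalize v.ρ m = y
      induction y with
      | zero => simp
      | add a b ha hb => simp only [map_add, smul_add, ha, hb, add_tmul]
      | tmul v c => simp
  refine (h1 (v.ρ m)).trans ?_
  rw [v.coassoc, ← LinearMap.comp_apply, ← LinearMap.lTensor_comp]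
  rfl

lemma map_act_ρ (φ : C →ₗ[k] k) (f : C →ₗ[k] X) (m : V) :
    TensorProduct.map (v.act φ) f (v.ρ m) = (convL φ f).lTensor V (v.ρ m) := by
  have h1 : ∀ y : V ⊗[k] C, TensorProduct.map (v.act φ) f y =
      (((TensorProduct.lid k X).toLinearMap ∘ₗ TensorProduct.map φ f).lTensor V)
        (TensorProduct.assoc k V C C (v.ρ.rTensor C y)) := by
    intro y
    induction y with
    | zero => simp
    | add a b ha hb => simp only [map_add, ha, hb]
    | tmul m c =>
      simp only [TensorProduct.map_tmul, LinearMap.rTensor_tmul, act, LinearMap.comp_apply]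
      generalize v.ρ m = y
      induction y with
      | zero => simp
      | add a b ha hb => simp only [map_add, ha, hb, add_tmul]
      | tmul v c => simp [TensorProduct.smul_tmul]
  refine (h1 (v.ρ m)).trans ?_
  rw [v.coassoc, ← LinearMap.comp_apply, ← LinearMap.lTensor_comp]
  rfl

lemma act_act (φ ψ : C →ₗ[k] k) (m : V) :
    v.act φ (v.act ψ m) = v.act (convL φ ψ) m := by
  have h := v.lTensor_ρ_act ψ φ m
  have e : convR φ ψ = convL φ ψ := by
    unfold convR convL
    congr 1
    ext; simp
  rw [e] at h
  exact congrArg (TensorProduct.rid k V) h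

/-- A linear map `f` between comodules lies over a linear map `g` of coalgebras if
`f(m)₀ ⊗ f(m)₁ = f(m₀) ⊗ g(m₁)`. -/
def Over (v : Coaction k C V) (w : Coaction k D W) (f : V →ₗ[k] W) (g : C →ₗ[k] D) : Prop :=
  ∀ m, w.ρ (f m) = TensorProduct.map f g (v.ρ m)

variable {v w x}

lemma Over.act {f : V →ₗ[k] W} {g : C →ₗ[k] D}
    (h : Over v w f g) (φ : D →ₗ[k] k) (m : V) : w.act φ (f m) = f (v.act (φ ∘ₗ g) m) := by
  simp only [Coaction.act, LinearMap.comp_apply, h m]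
  generalize v.ρ m = y
  induction y with
  | zero => simp
  | add a b ha hb => simp only [map_add, ha, hb]
  | tmul v c => simp

lemma Over.comp {f : V →ₗ[k] W} {g : C →ₗ[k] D}
    {f' : W →ₗ[k] X} {g' : D →ₗ[k] E} (h : Over v w f g) (h' : Over w x f' g') :
    Over v x (f' ∘ₗ f) (g' ∘ₗ g) := fun m => by
  rw [LinearMap.comp_apply, h', h, TensorProduct.map_comp, LinearMap.comp_apply]

variable (v w x)

lemma over_id : Over v v LinearMap.id LinearMap.id := fun m => by simp

/-- Corestriction of a comodule along a coalgebra map. -/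
def cores (v : Coaction k C V) (f : C →ₗc[k] D) : Coaction k D V where
  ρ := f.toLinearMap.lTensor V ∘ₗ v.ρ
  coassoc m := by
    have h1 : ∀ x : V ⊗[k] C, TensorProduct.assoc k V D D
        ((f.toLinearMap.lTensor V ∘ₗ v.ρ).rTensor D (f.toLinearMap.lTensor V x)) =
        (TensorProduct.map f.toLinearMap f.toLinearMap).lTensor V
        (TensorProduct.assoc k V C C (v.ρ.rTensor C x)) := by
      intro x
      induction x with
      | zero => simp
      | add a b ha hb => simp only [map_add, ha, hb]
      | tmul m c =>
        simp only [LinearMap.lTensor_tmul, LinearMap.rTensor_tmul, LinearMap.comp_apply]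
        generalize v.ρ m = y
        induction y with
        | zero => simp
        | add a b ha hb => simp only [map_add, ha, hb, add_tmul]
        | tmul v c => simp
    rw [LinearMap.comp_apply, h1, v.coassoc, ← LinearMap.comp_apply,
      ← LinearMap.lTensor_comp, f.map_comp_comul, LinearMap.lTensor_comp, LinearMap.comp_apply]
  counit m := by
    rw [LinearMap.comp_apply, ← LinearMap.comp_apply (LinearMap.lTensor _ _),
      ← LinearMap.lTensor_comp, f.counit_comp]
    exact v.counit m

lemma over_cores (f : C →ₗc[k] D) :
    Over v (v.cores f) LinearMap.id f.toLinearMap := fun _ => rfl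

/-- External tensor product of comodules: a comodule over the tensor product coalgebra, with
coaction `v ⊗ w ↦ (v₀ ⊗ w₀) ⊗ (v₁ ⊗ w₁)`. -/
def ext (v : Coaction k C V) (w : Coaction k D W) : Coaction k (C ⊗[k] D) (V ⊗[k] W) where
  ρ := (TensorProduct.tensorTensorTensorComm k V C W D).toLinearMap ∘ₗ TensorProduct.map v.ρ w.ρ
  coassoc x := by
    let T := (TensorProduct.tensorTensorTensorComm k V C W D).toLinearMap ∘ₗ
      TensorProduct.map v.ρ w.ρ
    let R : (V ⊗[k] (C ⊗[k] C)) ⊗[k] (W ⊗[k] (D ⊗[k] D)) →ₗ[k]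
        (V ⊗[k] W) ⊗[k] ((C ⊗[k] D) ⊗[k] (C ⊗[k] D)) :=
      (TensorProduct.tensorTensorTensorComm k C C D D).toLinearMap.lTensor _ ∘ₗ
        (TensorProduct.tensorTensorTensorComm k V (C ⊗[k] C) W (D ⊗[k] D)).toLinearMap
    have h1 : ∀ (x : V ⊗[k] C) (y : W ⊗[k] D),
        TensorProduct.assoc k (V ⊗[k] W) (C ⊗[k] D) (C ⊗[k] D)
          (T.rTensor _ (TensorProduct.tensorTensorTensorComm k V C W D (x ⊗ₜ y))) =
        R (TensorProduct.assoc k V C C (v.ρ.rTensor C x) ⊗ₜ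
          TensorProduct.assoc k W D D (w.ρ.rTensor D y)) := by
      intro x y
      induction x with
      | zero => simp
      | add a b ha hb => simp only [map_add, ha, hb, add_tmul]
      | tmul m c =>
        induction y with
        | zero => simp
        | add a b ha hb => simp only [map_add, ha, hb, tmul_add]
        | tmul n d =>
          simp only [LinearMap.rTensor_tmul, TensorProduct.tensorTensorTensorComm_tmul, T,
            LinearMap.comp_apply, TensorProduct.map_tmul]
          generalize v.ρ m = x
          generalize w.ρ n = y
          induction x with
          | zero => simp
          | add a b ha hb => simp only [map_add, ha, hb, add_tmul]
          | tmul v' c' =>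
            induction y with
            | zero => simp
            | add a b ha hb => simp only [map_add, ha, hb, tmul_add, add_tmul]
            | tmul w' d' => simp [R]
    have h2 : ∀ (x : V ⊗[k] C) (y : W ⊗[k] D),
        R ((Coalgebra.comul (R := k) (A := C)).lTensor V x ⊗ₜ
          (Coalgebra.comul (R := k) (A := D)).lTensor W y) =
        (Coalgebra.comul (R := k) (A := C ⊗[k] D)).lTensor (V ⊗[k] W)
          (TensorProduct.tensorTensorTensorComm k V C W D (x ⊗ₜ y)) := by
      intro x y
      induction x with
      | zero => simp
      | add a b ha hb => simp only [map_add, ha, hb, add_tmul]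
      | tmul m c =>
        induction y with
        | zero => simp
        | add a b ha hb => simp only [map_add, ha, hb, tmul_add]
        | tmul n d =>
          simp [R, TensorProduct.comul_tmul]
          rfl
    induction x with
    | zero => simp
    | add a b ha hb => simp only [map_add, ha, hb]
    | tmul m n =>
      simp only [LinearMap.comp_apply, TensorProduct.map_tmul]
      erw [h1]
      rw [v.coassoc, w.coassoc, h2]
      rfl
  counit x := by
    have h2 : ∀ (x : V ⊗[k] C) (y : W ⊗[k] D),
        TensorProduct.rid k _ ((Coalgebra.counit (R := k) (A := C ⊗[k] D)).lTensor (V ⊗[k] W)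
          (TensorProduct.tensorTensorTensorComm k V C W D (x ⊗ₜ y))) =
        TensorProduct.rid k _ ((Coalgebra.counit (R := k) (A := C)).lTensor V x) ⊗ₜ
        TensorProduct.rid k _ ((Coalgebra.counit (R := k) (A := D)).lTensor W y) := by
      intro x y
      induction x with
      | zero => simp
      | add a b ha hb => simp only [map_add, ha, hb, add_tmul]
      | tmul m c =>
        induction y with
        | zero => simp
        | add a b ha hb => simp only [map_add, ha, hb, tmul_add]
        | tmul n d =>
          simp only [TensorProduct.tensorTensorTensorComm_tmul, LinearMap.lTensor_tmul,
            TensorProduct.rid_tmul, TensorProduct.counit_tmul, TensorProduct.smul_tmul_smul,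
            smul_eq_mul]
          rw [mul_comm]
    induction x with
    | zero => simp
    | add a b ha hb => simp only [map_add, ha, hb]
    | tmul m n =>
      simp only [LinearMap.comp_apply, TensorProduct.map_tmul]
      erw [h2]
      rw [v.counit, w.counit]

end Coaction
end

noncomputable section
namespace Coaction

section General

variable {k C D E C' D' V W X V' W' : Type*} [Field k]
  [AddCommMonoid C] [Module k C] [Coalgebra k C]
  [AddCommMonoid D] [Module k D] [Coalgebra k D] [AddCommMonoid E] [Module k E] [Coalgebra k E]
  [AddCommMonoid C'] [Module k C'] [Coalgebra k C']
  [AddCommMonoid D'] [Module k D'] [Coalgebra k D']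
  [AddCommMonoid V] [Module k V] [AddCommMonoid W] [Module k W] [AddCommMonoid X] [Module k X]
  [AddCommMonoid V'] [Module k V'] [AddCommMonoid W'] [Module k W']

lemma act_ext_left (v : Coaction k C V) (w : Coaction k D W) (φ : C →ₗ[k] k) (x : V ⊗[k] W) :
    (ext v w).act (tmulFun φ Coalgebra.counit) x = (v.act φ).rTensor W x := by
  have h : ∀ (x : V ⊗[k] C) (y : W ⊗[k] D),
      TensorProduct.rid k _ ((tmulFun φ (Coalgebra.counit (R := k) (A := D))).lTensor (V ⊗[k] W)
        (TensorProduct.tensorTensorTensorComm k V C W D (x ⊗ₜ y))) =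
      TensorProduct.rid k _ (φ.lTensor V x) ⊗ₜ
        TensorProduct.rid k _ ((Coalgebra.counit (R := k) (A := D)).lTensor W y) := by
    intro x y
    induction x with
    | zero => simp
    | add a b ha hb => simp only [map_add, ha, hb, add_tmul]
    | tmul v c =>
      induction y with
      | zero => simp
      | add a b ha hb => simp only [map_add, ha, hb, tmul_add]
      | tmul w d =>
        simp only [TensorProduct.tensorTensorTensorComm_tmul, LinearMap.lTensor_tmul,
          TensorProduct.rid_tmul, TensorProduct.smul_tmul_smul]
        simp [tmulFun]
  induction x with
  | zero => simp
  | add a b ha hb => simp only [map_add, ha, hb]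
  | tmul m n =>
    have := h (v.ρ m) (w.ρ n)
    rw [w.counit] at this
    exact this

lemma act_ext_right (v : Coaction k C V) (w : Coaction k D W) (φ : D →ₗ[k] k) (x : V ⊗[k] W) :
    (ext v w).act (tmulFun Coalgebra.counit φ) x = (w.act φ).lTensor V x := by
  have h : ∀ (x : V ⊗[k] C) (y : W ⊗[k] D),
      TensorProduct.rid k _ ((tmulFun (Coalgebra.counit (R := k) (A := C)) φ).lTensor (V ⊗[k] W)
        (TensorProduct.tensorTensorTensorComm k V C W D (x ⊗ₜ y))) =
      TensorProduct.rid k _ ((Coalgebra.counit (R := k) (A := C)).lTensor V x) ⊗ₜ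
        TensorProduct.rid k _ (φ.lTensor W y) := by
    intro x y
    induction x with
    | zero => simp
    | add a b ha hb => simp only [map_add, ha, hb, add_tmul]
    | tmul v c =>
      induction y with
      | zero => simp
      | add a b ha hb => simp only [map_add, ha, hb, tmul_add]
      | tmul w d =>
        simp only [TensorProduct.tensorTensorTensorComm_tmul, LinearMap.lTensor_tmul,
          TensorProduct.rid_tmul, TensorProduct.smul_tmul_smul]
        simp [tmulFun]
  induction x with
  | zero => simp
  | add a b ha hb => simp only [map_add, ha, hb]
  | tmul m n =>
    have := h (v.ρ m) (w.ρ n)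
    rw [v.counit] at this
    exact this

lemma Over.extMap {v : Coaction k C V} {w : Coaction k D W} {v' : Coaction k C' V'}
    {w' : Coaction k D' W'}
    {f : V →ₗ[k] V'} {g : C →ₗ[k] C'} {f' : W →ₗ[k] W'} {g' : D →ₗ[k] D'}
    (h : Over v v' f g) (h' : Over w w' f' g') :
    Over (ext v w) (ext v' w') (TensorProduct.map f f') (TensorProduct.map g g') := by
  intro x
  have key : ∀ (x : V ⊗[k] C) (y : W ⊗[k] D),
      TensorProduct.tensorTensorTensorComm k V' C' W' D'
        (TensorProduct.map f g x ⊗ₜ TensorProduct.map f' g' y) =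
      TensorProduct.map (TensorProduct.map f f') (TensorProduct.map g g')
        (TensorProduct.tensorTensorTensorComm k V C W D (x ⊗ₜ y)) := by
    intro x y
    induction x with
    | zero => simp
    | add a b ha hb => simp only [map_add, ha, hb, add_tmul]
    | tmul v c =>
      induction y with
      | zero => simp
      | add a b ha hb => simp only [map_add, ha, hb, tmul_add]
      | tmul w d => simp
  induction x with
  | zero => simp
  | add a b ha hb => simp only [map_add, ha, hb]
  | tmul m n =>
    have := key (v.ρ m) (w.ρ n)
    rw [← h, ← h'] at this
    exact this

lemma over_assoc (v : Coaction k C V) (w : Coaction k D W) (x : Coaction k E X) :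
    Over (ext (ext v w) x) (ext v (ext w x)) (TensorProduct.assoc k V W X).toLinearMap
      (TensorProduct.assoc k C D E).toLinearMap := by
  intro y
  have key : ∀ (x : V ⊗[k] C) (y : W ⊗[k] D) (z : X ⊗[k] E),
      TensorProduct.tensorTensorTensorComm k V C (W ⊗[k] X) (D ⊗[k] E)
        (x ⊗ₜ TensorProduct.tensorTensorTensorComm k W D X E (y ⊗ₜ z)) =
      TensorProduct.map (TensorProduct.assoc k V W X).toLinearMap
        (TensorProduct.assoc k C D E).toLinearMap
        (TensorProduct.tensorTensorTensorComm k (V ⊗[k] W) (C ⊗[k] D) X E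
          (TensorProduct.tensorTensorTensorComm k V C W D (x ⊗ₜ y) ⊗ₜ z)) := by
    intro x y z
    induction x with
    | zero => simp
    | add a b ha hb => simp only [map_add, ha, hb, add_tmul]
    | tmul v c =>
      induction y with
      | zero => simp
      | add a b ha hb => simp only [map_add, ha, hb, tmul_add, add_tmul]
      | tmul w d =>
        induction z with
        | zero => simp
        | add a b ha hb => simp only [map_add, ha, hb, tmul_add]
        | tmul w d => simp
  induction y with
  | zero => simp
  | add a b ha hb => simp only [map_add, ha, hb]
  | tmul vw p =>
    induction vw with
    | zero => simp
    | add a b ha hb => simp only [map_add, ha, hb, add_tmul]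
    | tmul m n => exact key (v.ρ m) (w.ρ n) (x.ρ p)

end General

section Monoidal

variable {k H : Type u} [Field k] [AddCommGroup H] [Module k H] [Coalgebra k H]
  [CoquasiBialgebra k H]

open CoquasiBialgebra

variable {U V W X U' V' W' : Type*}
  [AddCommMonoid U] [Module k U] [AddCommMonoid U'] [Module k U']
  [AddCommMonoid V] [Module k V] [AddCommMonoid W] [Module k W] [AddCommMonoid X] [Module k X]
  [AddCommMonoid V'] [Module k V'] [AddCommMonoid W'] [Module k W']

/-- The codiagonal coaction `v ⊗ w ↦ (v₀ ⊗ w₀) ⊗ v₁w₁`. -/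
def tensor (v : Coaction k H V) (w : Coaction k H W) : Coaction k H (V ⊗[k] W) :=
  (ext v w).cores mul

/-- The trivial coaction `1 ↦ 1 ⊗ 1` on the ground field. -/
def triv (k H : Type u) [Field k] [AddCommGroup H] [Module k H] [Coalgebra k H]
    [CoquasiBialgebra k H] : Coaction k H k where
  ρ := (TensorProduct.mk k k H).flip (unit (k := k) 1)
  coassoc v := by
    have h := CoalgHomClass.map_comp_comul_apply (unit (k := k) (H := H)) 1
    simp only [CommSemiring.comul_apply, TensorProduct.map_tmul] at h
    simp [← h]
  counit v := by
    have h := CoalgHomClass.counit_comp_apply (unit (k := k) (H := H)) 1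
    simp only [CommSemiring.counit_apply] at h
    simp [h]

/-- The reassociator `(u ⊗ v) ⊗ w ↦ u₀ ⊗ (v₀ ⊗ w₀) ω(u₁, v₁, w₁)`. -/
def assocFun (u : Coaction k H U) (v : Coaction k H V) (w : Coaction k H W) :
    (U ⊗[k] V) ⊗[k] W →ₗ[k] U ⊗[k] (V ⊗[k] W) :=
  (TensorProduct.assoc k U V W).toLinearMap ∘ₗ (ext (ext u v) w).act ω

/-- The inverse reassociator `u ⊗ (v ⊗ w) ↦ (u₀ ⊗ v₀) ⊗ w₀ ω⁻¹(u₁, v₁, w₁)`. -/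
def assocInvFun (u : Coaction k H U) (v : Coaction k H V) (w : Coaction k H W) :
    U ⊗[k] (V ⊗[k] W) →ₗ[k] (U ⊗[k] V) ⊗[k] W :=
  (ext (ext u v) w).act ωInv ∘ₗ (TensorProduct.assoc k U V W).symm.toLinearMap

lemma over_tensor (v : Coaction k H V) (w : Coaction k H W) :
    Over (ext v w) (tensor v w) LinearMap.id (mul (k := k) (H := H)).toLinearMap :=
  over_cores _ _

variable (u : Coaction k H U) (v : Coaction k H V) (w : Coaction k H W) (x : Coaction k H X)
  {u' : Coaction k H U'} {v' : Coaction k H V'} {w' : Coaction k H W'}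

lemma over_assocFun :
    Over (tensor (tensor u v) w) (tensor u (tensor v w)) (assocFun u v w) LinearMap.id := by
  intro y
  let m := (mul (k := k) (H := H)).toLinearMap
  have e1 : Over (ext (ext u v) w) (tensor (tensor u v) w) LinearMap.id
      (m ∘ₗ m.rTensor H) := by
    have := ((over_tensor u v).extMap (over_id w)).comp (over_tensor (tensor u v) w)
    rwa [TensorProduct.map_id] at this
  have e2 : Over (ext u (ext v w)) (tensor u (tensor v w)) LinearMap.id
      (m ∘ₗ m.lTensor H) := by
    have := ((over_id u).extMap (over_tensor v w)).comp (over_tensor u (tensor v w))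
    rwa [TensorProduct.map_id] at this
  have e3 := (over_assoc u v w).comp e2
  have e3' := e3 ((ext (ext u v) w).act ω y)
  simp only [LinearMap.id_comp] at e3'
  refine e3'.trans ?_
  have e1' := e1 y
  simp only [LinearMap.id_apply] at e1'
  rw [e1', LinearMap.comp_assoc]
  have L := lTensor_ρ_act (ext (ext u v) w) ω (m ∘ₗ m.lTensor H ∘ₗ
    (TensorProduct.assoc k H H H).toLinearMap) y
  rw [mul_assoc'] at L
  have L2 := map_act_ρ (ext (ext u v) w) ω (m ∘ₗ m.rTensor H) y
  rw [← L2] at L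
  have := congrArg ((TensorProduct.assoc k U V W).toLinearMap.rTensor H) L
  simp only [LinearMap.lTensor, LinearMap.rTensor, TensorProduct.map_map, LinearMap.id_comp,
    LinearMap.comp_id] at this ⊢
  exact this

lemma assocInv_assoc (y) : assocInvFun u v w (assocFun u v w y) = y := by
  simp only [assocInvFun, assocFun, LinearMap.comp_apply, LinearEquiv.coe_coe,
    LinearEquiv.symm_apply_apply]
  rw [act_act, ωInv_mul_ω, act_counit]; rfl

lemma assoc_assocInv (y) : assocFun u v w (assocInvFun u v w y) = y := by
  simp only [assocInvFun, assocFun, LinearMap.comp_apply]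
  rw [act_act, ω_mul_ωInv, act_counit]; simp

lemma over_lid : Over (tensor (triv k H) v) v (TensorProduct.lid k V).toLinearMap LinearMap.id := by
  intro x
  have key : ∀ (c : k) (y : V ⊗[k] H), c • y = TensorProduct.map (TensorProduct.lid k V).toLinearMap
      LinearMap.id ((mul (k := k) (H := H)).toLinearMap.lTensor _
        (TensorProduct.tensorTensorTensorComm k k H V H ((c ⊗ₜ unit (k := k) 1) ⊗ₜ y))) := by
    intro c y
    induction y with
    | zero => simp
    | add a b ha hb => simp only [map_add, ← ha, ← hb, tmul_add, smul_add]
    | tmul v h => simp [one_mul', TensorProduct.smul_tmul']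
  induction x with
  | zero => simp
  | add a b ha hb => simp only [map_add, ha, hb]
  | tmul c m =>
    have := key c (v.ρ m)
    simp only [LinearEquiv.coe_coe, TensorProduct.lid_tmul, map_smul]
    exact this

lemma over_rid : Over (tensor v (triv k H)) v (TensorProduct.rid k V).toLinearMap LinearMap.id := by
  intro x
  have key : ∀ (c : k) (y : V ⊗[k] H), c • y = TensorProduct.map (TensorProduct.rid k V).toLinearMap
      LinearMap.id ((mul (k := k) (H := H)).toLinearMap.lTensor _
        (TensorProduct.tensorTensorTensorComm k V H k H (y ⊗ₜ (c ⊗ₜ unit (k := k) 1)))) := by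
    intro c y
    induction y with
    | zero => simp
    | add a b ha hb => simp only [map_add, ← ha, ← hb, add_tmul, smul_add]
    | tmul v h => simp [mul_one', TensorProduct.smul_tmul']
  induction x with
  | zero => simp
  | add a b ha hb => simp only [map_add, ha, hb]
  | tmul m c =>
    have := key c (v.ρ m)
    simp only [LinearEquiv.coe_coe, TensorProduct.rid_tmul, map_smul]
    exact this

variable {u v w}

lemma Over.tensorMap {f : V →ₗ[k] V'} {g : W →ₗ[k] W'} (hf : Over v v' f LinearMap.id)
    (hg : Over w w' g LinearMap.id) :
    Over (tensor v w) (tensor v' w') (TensorProduct.map f g) LinearMap.id := by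
  intro x
  have h := ((hf.extMap hg).comp (over_tensor v' w')) x
  simp only [LinearMap.id_comp, TensorProduct.map_id, LinearMap.comp_id] at h
  refine h.trans ?_
  have h2 := over_tensor v w x
  simp only [LinearMap.id_apply] at h2
  rw [h2, TensorProduct.map_map, LinearMap.comp_id, LinearMap.id_comp]

lemma assocFun_natural {f : U →ₗ[k] U'} {g : V →ₗ[k] V'} {h : W →ₗ[k] W'}
    (hf : Over u u' f LinearMap.id) (hg : Over v v' g LinearMap.id) (hh : Over w w' h LinearMap.id)
    (y : (U ⊗[k] V) ⊗[k] W) :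
    assocFun u' v' w' (TensorProduct.map (TensorProduct.map f g) h y) =
    TensorProduct.map f (TensorProduct.map g h) (assocFun u v w y) := by
  have hh := ((hf.extMap hg).extMap hh).act ω y
  simp only [TensorProduct.map_id, LinearMap.comp_id] at hh
  simp only [assocFun, LinearMap.comp_apply]
  rw [hh]
  generalize ((u.ext v).ext w).act ω y = z
  exact (LinearMap.congr_fun (TensorProduct.map_map_comp_assoc_eq f g h) z).symm

variable (u v w)

lemma pentagon (y : ((U ⊗[k] V) ⊗[k] W) ⊗[k] X) :
    (assocFun v w x).lTensor U (assocFun u (tensor v w) x ((assocFun u v w).rTensor X y)) =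
      assocFun u v (tensor w x) (assocFun (tensor u v) w x y) := by
  let m := (mul (k := k) (H := H)).toLinearMap
  let T := ext (ext (ext u v) w) x
  -- the right-hand side
  have r1 : ∀ y, (ext (ext (tensor u v) w) x).act ω y =
      T.act (ω ∘ₗ (m.rTensor H).rTensor H) y := by
    intro y
    have := (((over_tensor u v).extMap (over_id w)).extMap (over_id x)).act ω y
    simp only [TensorProduct.map_id, LinearMap.id_apply] at this
    exact this
  have r2 : ∀ y, (ext (ext u v) (tensor w x)).act ω
        (TensorProduct.assoc k (U ⊗[k] V) W X y) = TensorProduct.assoc k (U ⊗[k] V) W X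
      (T.act (ω ∘ₗ m.lTensor (H ⊗[k] H) ∘ₗ
          (TensorProduct.assoc k (H ⊗[k] H) H H).toLinearMap) y) := by
    intro y
    have := ((over_assoc (ext u v) w x).comp
      ((over_id (ext u v)).extMap (over_tensor w x))).act ω y
    simp only [TensorProduct.map_id, LinearMap.id_comp, LinearEquiv.coe_coe] at this
    exact this
  have r3 : assocFun u v (tensor w x) (assocFun (tensor u v) w x y) =
      TensorProduct.assoc k U V (W ⊗[k] X) (TensorProduct.assoc k (U ⊗[k] V) W X
        (T.act (ω ∘ₗ m.lTensor (H ⊗[k] H) ∘ₗ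
          (TensorProduct.assoc k (H ⊗[k] H) H H).toLinearMap)
          (T.act (ω ∘ₗ (m.rTensor H).rTensor H) y))) := by
    rw [← r2, ← r1]; rfl
  rw [r3, act_act, cocycle, ← act_act, ← act_act]
  -- the left-hand side
  have l1 : T.act (tmulFun ω Coalgebra.counit) y = ((ext (ext u v) w).act ω).rTensor X y :=
    act_ext_left (ext (ext u v) w) x ω y
  have l2 : ∀ y, (ext (ext u (tensor v w)) x).act ω
      ((TensorProduct.assoc k U V W).toLinearMap.rTensor X y) =
      (TensorProduct.assoc k U V W).toLinearMap.rTensor X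
      (T.act (ω ∘ₗ (m.lTensor H ∘ₗ
              (TensorProduct.assoc k H H H).toLinearMap).rTensor H) y) := by
    intro y
    have := (((over_assoc u v w).comp ((over_id u).extMap (over_tensor v w))).extMap
      (over_id x)).act ω y
    simp only [TensorProduct.map_id, LinearMap.id_comp, LinearEquiv.coe_coe] at this
    exact this
  have l3 : ∀ y, ((ext (ext v w) x).act ω).lTensor U (TensorProduct.assoc k U (V ⊗[k] W) X
      ((TensorProduct.assoc k U V W).toLinearMap.rTensor X y)) =
      TensorProduct.assoc k U (V ⊗[k] W) X
      ((TensorProduct.assoc k U V W).toLinearMap.rTensor X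
        (T.act (tmulFun Coalgebra.counit ω ∘ₗ
            (TensorProduct.assoc k H (H ⊗[k] H) H).toLinearMap ∘ₗ
            (TensorProduct.assoc k H H H).toLinearMap.rTensor H) y)) := by
    intro y
    have := (((over_assoc u v w).extMap (over_id x)).comp
      (over_assoc u (ext v w) x)).act (tmulFun Coalgebra.counit ω) y
    rw [act_ext_right] at this
    exact this
  have l4 : ∀ y : (U ⊗[k] (V ⊗[k] W)) ⊗[k] X,
      (assocFun v w x).lTensor U (TensorProduct.assoc k U (V ⊗[k] W) X y) =
      (TensorProduct.assoc k V W X).toLinearMap.lTensor U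
        (((ext (ext v w) x).act ω).lTensor U (TensorProduct.assoc k U (V ⊗[k] W) X y)) := by
    intro y
    rw [← LinearMap.comp_apply, ← LinearMap.lTensor_comp]; rfl
  have e1 : (assocFun u v w).rTensor X y = (TensorProduct.assoc k U V W).toLinearMap.rTensor X
      (((ext (ext u v) w).act ω).rTensor X y) := by
    rw [← LinearMap.comp_apply, ← LinearMap.rTensor_comp]; rfl
  rw [e1, ← l1]
  change (assocFun v w x).lTensor U (TensorProduct.assoc k U (V ⊗[k] W) X
    ((ext (ext u (tensor v w)) x).act ω _)) = _
  rw [l2, l4, l3]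
  generalize T.act _ (T.act _ (T.act _ y)) = y
  have : ∀ y : ((U ⊗[k] V) ⊗[k] W) ⊗[k] X,
      (TensorProduct.assoc k V W X).toLinearMap.lTensor U (TensorProduct.assoc k U (V ⊗[k] W) X
        ((TensorProduct.assoc k U V W).toLinearMap.rTensor X y)) =
      TensorProduct.assoc k U V (W ⊗[k] X) (TensorProduct.assoc k (U ⊗[k] V) W X y) := by
    intro y
    refine LinearMap.congr_fun (f := (TensorProduct.assoc k V W X).toLinearMap.lTensor U ∘ₗ
      (TensorProduct.assoc k U (V ⊗[k] W) X).toLinearMap ∘ₗ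
      (TensorProduct.assoc k U V W).toLinearMap.rTensor X)
      (g := (TensorProduct.assoc k U V (W ⊗[k] X)).toLinearMap ∘ₗ
      (TensorProduct.assoc k (U ⊗[k] V) W X).toLinearMap) ?_ y
    ext; simp
  exact this y

lemma triangle (y : (V ⊗[k] k) ⊗[k] W) :
    (TensorProduct.lid k W).toLinearMap.lTensor V (assocFun v (triv k H) w y) =
      (TensorProduct.rid k V).toLinearMap.rTensor W y := by
  have key : ∀ (c : k) (y : V ⊗[k] H) (z : W ⊗[k] H),
      TensorProduct.rid k _ ((ω (k := k) (H := H)).lTensor ((V ⊗[k] k) ⊗[k] W)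
        (TensorProduct.tensorTensorTensorComm k (V ⊗[k] k) (H ⊗[k] H) W H
          (TensorProduct.tensorTensorTensorComm k V H k H (y ⊗ₜ (c ⊗ₜ unit (k := k) 1)) ⊗ₜ z))) =
      (TensorProduct.rid k _ ((Coalgebra.counit (R := k) (A := H)).lTensor V y) ⊗ₜ c) ⊗ₜ
        TensorProduct.rid k _ ((Coalgebra.counit (R := k) (A := H)).lTensor W z) := by
    intro c y z
    induction y with
    | zero => simp
    | add a b ha hb => simp only [map_add, ha, hb, add_tmul]
    | tmul v h =>
      induction z with
      | zero => simp
      | add a b ha hb => simp only [map_add, ha, hb, tmul_add]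
      | tmul w g =>
        simp only [TensorProduct.tensorTensorTensorComm_tmul, LinearMap.lTensor_tmul,
          TensorProduct.rid_tmul, ω_one, mul_smul, TensorProduct.tmul_smul,
          TensorProduct.smul_tmul']
        rw [smul_comm]
  induction y with
  | zero => simp
  | add a b ha hb => simp only [map_add, ha, hb]
  | tmul vc n =>
    induction vc with
    | zero => simp
    | add a b ha hb => simp only [map_add, ha, hb, add_tmul]
    | tmul m c =>
      have := key c (v.ρ m) (w.ρ n)
      rw [v.counit, w.counit] at this
      have e : assocFun v (triv k H) w (m ⊗ₜ c ⊗ₜ n) = m ⊗ₜ (c ⊗ₜ n) :=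
        congrArg (TensorProduct.assoc k V k W) this
      rw [e]
      simp [TensorProduct.smul_tmul]

end Monoidal
end Coaction

/-- Right comodules over a coalgebra. -/
structure Comod (k C : Type u) [Field k] [AddCommGroup C] [Module k C] [Coalgebra k C] where
  of ::
  carrier : Type u
  [isAddCommGroup : AddCommGroup carrier]
  [isModule : Module k carrier]
  coact : Coaction k C carrier

attribute [instance] Comod.isAddCommGroup Comod.isModule

namespace Comod

variable {k H : Type u} [Field k] [AddCommGroup H] [Module k H] [Coalgebra k H]

instance : CoeSort (Comod k H) (Type u) := ⟨Comod.carrier⟩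

/-- Colinear maps. -/
@[ext]
structure Hom (V W : Comod k H) where
  lin : V →ₗ[k] W
  colinear : ∀ v, W.coact.ρ (lin v) = lin.rTensor H (V.coact.ρ v)

instance : Category (Comod k H) where
  Hom := Hom
  id V := ⟨LinearMap.id, fun v => by simp⟩
  comp f g := ⟨g.lin ∘ₗ f.lin, fun v => by
    simp [g.colinear, f.colinear, LinearMap.rTensor_comp]⟩

@[ext] lemma hom_ext {V W : Comod k H} {f g : V ⟶ W} (h : ∀ v, f.lin v = g.lin v) : f = g :=
  Hom.ext (LinearMap.ext h)

lemma hom_ext' {V W : Comod k H} {f g : V ⟶ W} (h : f.lin = g.lin) : f = g :=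
  Hom.ext h

@[simp] lemma id_lin (V : Comod k H) : Hom.lin (𝟙 V) = LinearMap.id := rfl
@[simp] lemma comp_lin {V W X : Comod k H} (f : V ⟶ W) (g : W ⟶ X) :
    Hom.lin (f ≫ g) = g.lin ∘ₗ f.lin := rfl

lemma over_hom {V W : Comod k H} (f : V ⟶ W) :
    Coaction.Over V.coact W.coact f.lin LinearMap.id := f.colinear

/-- A bijective colinear map is an isomorphism of comodules. -/
def isoMk {V W : Comod k H} (f : V →ₗ[k] W) (g : W →ₗ[k] V)
    (hf : Coaction.Over V.coact W.coact f LinearMap.id)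
    (h : ∀ v, g (f v) = v) (h' : ∀ w, f (g w) = w) : V ≅ W where
  hom := ⟨f, hf⟩
  inv := ⟨g, fun w => by
    have e := hf (g w)
    rw [h'] at e
    have e2 : g ∘ₗ f = LinearMap.id := LinearMap.ext h
    rw [e, LinearMap.rTensor, TensorProduct.map_map, e2]
    simp⟩
  hom_inv_id := hom_ext h
  inv_hom_id := hom_ext h'

variable [CoquasiBialgebra k H]

instance : MonoidalCategoryStruct (Comod k H) where
  tensorObj V W := .of (V ⊗[k] W) (V.coact.tensor W.coact)
  whiskerLeft V _ _ f := ⟨f.lin.lTensor V, Coaction.Over.tensorMap (over_hom (𝟙 V)) (over_hom f)⟩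
  whiskerRight f V := ⟨f.lin.rTensor V, Coaction.Over.tensorMap (over_hom f) (over_hom (𝟙 V))⟩
  tensorHom f g := ⟨TensorProduct.map f.lin g.lin, Coaction.Over.tensorMap (over_hom f) (over_hom g)⟩
  tensorUnit := .of k (Coaction.triv k H)
  associator U V W := isoMk (V := .of _ _) (W := .of _ _)
    (Coaction.assocFun U.coact V.coact W.coact)
    (Coaction.assocInvFun U.coact V.coact W.coact) (Coaction.over_assocFun _ _ _)
    (Coaction.assocInv_assoc _ _ _) (Coaction.assoc_assocInv _ _ _)
  leftUnitor V := isoMk (V := .of _ _) (TensorProduct.lid k V).toLinearMap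
    (TensorProduct.lid k V).symm.toLinearMap (Coaction.over_lid _)
    (TensorProduct.lid k V).symm_apply_apply (TensorProduct.lid k V).apply_symm_apply
  rightUnitor V := isoMk (V := .of _ _) (TensorProduct.rid k V).toLinearMap
    (TensorProduct.rid k V).symm.toLinearMap (Coaction.over_rid _)
    (TensorProduct.rid k V).symm_apply_apply (TensorProduct.rid k V).apply_symm_apply

lemma tensorHom_lin {V W V' W' : Comod k H} (f : V ⟶ V') (g : W ⟶ W') :
    (f ⊗ₘ g).lin = TensorProduct.map f.lin g.lin := rfl
lemma whiskerLeft_lin (V : Comod k H) {W W' : Comod k H} (g : W ⟶ W') :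
    (V ◁ g).lin = g.lin.lTensor V := rfl
lemma whiskerRight_lin {V V' : Comod k H} (f : V ⟶ V') (W : Comod k H) :
    (f ▷ W).lin = f.lin.rTensor W := rfl
lemma leftUnitor_hom_lin (V : Comod k H) :
    (λ_ V).hom.lin = (TensorProduct.lid k V).toLinearMap := rfl
lemma rightUnitor_hom_lin (V : Comod k H) :
    (ρ_ V).hom.lin = (TensorProduct.rid k V).toLinearMap := rfl

/-- The monoidal category of right comodules over a coquasi-bialgebra. -/
instance : MonoidalCategory (Comod k H) where
  tensorHom_def f g := hom_ext' (LinearMap.lTensor_comp_rTensor _ _ _).symm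
  id_tensorHom_id V W := hom_ext' TensorProduct.map_id
  tensorHom_comp_tensorHom f g f' g' := hom_ext' (TensorProduct.map_comp _ _ _ _).symm
  whiskerLeft_id V W := hom_ext' (LinearMap.lTensor_id _ _)
  id_whiskerRight V W := hom_ext' (LinearMap.rTensor_id _ _)
  associator_naturality f g h := hom_ext
    (Coaction.assocFun_natural (over_hom f) (over_hom g) (over_hom h))
  leftUnitor_naturality f := hom_ext' <| TensorProduct.ext' fun a b => by
    change (TensorProduct.lid k _) (a ⊗ₜ f.lin b) = f.lin (TensorProduct.lid k _ (a ⊗ₜ b))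
    simp
  rightUnitor_naturality f := hom_ext' <| TensorProduct.ext' fun a b => by
    change (TensorProduct.rid k _) (f.lin a ⊗ₜ b) = f.lin (TensorProduct.rid k _ (a ⊗ₜ b))
    simp
  pentagon U V W X := hom_ext (Coaction.pentagon _ _ _ _)
  triangle V W := hom_ext (Coaction.triangle _ _)

end Comod
end

noncomputable section

namespace Comod
open CategoryTheory.Limits

section
variable {k H : Type u} [Field k] [AddCommGroup H] [Module k H] [Coalgebra k H]

/-- The forgetful functor from comodules to vector spaces. -/
@[simps]
def forget (k H : Type u) [Field k] [AddCommGroup H] [Module k H] [Coalgebra k H] :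
    Comod k H ⥤ ModuleCat.{u} k where
  obj V := ModuleCat.of k V
  map f := ModuleCat.ofHom f.lin

variable {J : Type} [SmallCategory J] (K : J ⥤ Comod k H)

/-- The legs of a cocone of underlying vector spaces, as linear maps. -/
def leg (c : Cocone (K ⋙ forget k H)) (j : J) : K.obj j →ₗ[k] c.pt := (c.ι.app j).hom

lemma leg_w (c : Cocone (K ⋙ forget k H)) {i j : J} (f : i ⟶ j) :
    leg K c j ∘ₗ (K.map f).lin = leg K c i := congrArg ModuleCat.Hom.hom (c.w f)

/-- The cocone given by the coactions on the objects of a diagram. -/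
def coactCocone (c : Cocone (K ⋙ forget k H)) : Cocone (K ⋙ forget k H) where
  pt := ModuleCat.of k (c.pt ⊗[k] H)
  ι :=
  { app := fun j => ModuleCat.ofHom ((leg K c j).rTensor H ∘ₗ (K.obj j).coact.ρ)
    naturality := fun i j f => by
      refine ModuleCat.hom_ext (LinearMap.ext fun (x : K.obj i) => ?_)
      change (leg K c j).rTensor H ((K.obj j).coact.ρ ((K.map f).lin x)) =
        (leg K c i).rTensor H ((K.obj i).coact.ρ x)
      rw [(K.map f).colinear x, ← leg_w K c f, LinearMap.rTensor_comp]; rfl }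

/-- The coaction on a colimit of comodules. -/
def colimρ (c : Cocone (K ⋙ forget k H)) (hc : IsColimit c) : c.pt →ₗ[k] c.pt ⊗[k] H :=
  (hc.desc (coactCocone K c)).hom

lemma colimρ_leg (c : Cocone (K ⋙ forget k H)) (hc : IsColimit c) (j : J) (x : K.obj j) :
    colimρ K c hc (leg K c j x) = (leg K c j).rTensor H ((K.obj j).coact.ρ x) :=
  LinearMap.congr_fun (congrArg ModuleCat.Hom.hom (hc.fac (coactCocone K c) j)) x

lemma colim_hom_ext {c : Cocone (K ⋙ forget k H)} (hc : IsColimit c) {X : Type u}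
    [AddCommGroup X] [Module k X] {f g : c.pt →ₗ[k] X}
    (h : ∀ j (x : K.obj j), f (leg K c j x) = g (leg K c j x)) (y : c.pt) :
    f y = g y := by
  have : ModuleCat.ofHom f = ModuleCat.ofHom g := hc.hom_ext fun j => by
    refine ModuleCat.hom_ext (LinearMap.ext fun (x : K.obj j) => h j x)
  exact LinearMap.congr_fun (congrArg ModuleCat.Hom.hom this) y

/-- The colimit of comodules with the underlying vector space the colimit of vector spaces. -/
def colimPt (c : Cocone (K ⋙ forget k H)) (hc : IsColimit c) : Comod k H where
  carrier := c.pt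
  coact :=
  { ρ := colimρ K c hc
    coassoc := by
      refine colim_hom_ext K hc (f := (TensorProduct.assoc k c.pt H H).toLinearMap ∘ₗ
        (colimρ K c hc).rTensor H ∘ₗ colimρ K c hc)
        (g := (Coalgebra.comul (R := k) (A := H)).lTensor c.pt ∘ₗ colimρ K c hc) fun j x => ?_
      simp only [LinearMap.comp_apply, colimρ_leg]
      have e := congrArg (TensorProduct.map (leg K c j) (LinearMap.id (R := k) (M := H ⊗[k] H)))
        ((K.obj j).coact.coassoc x)
      have e1 : ∀ y, (colimρ K c hc).rTensor H ((leg K c j).rTensor H y) =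
          ((leg K c j).rTensor H).rTensor H ((K.obj j).coact.ρ.rTensor H y) := by
        intro y
        rw [← LinearMap.comp_apply, ← LinearMap.rTensor_comp,
          ← LinearMap.comp_apply (LinearMap.rTensor H ((leg K c j).rTensor H)),
          ← LinearMap.rTensor_comp]
        congr 2
        exact LinearMap.ext fun x => colimρ_leg K c hc j x
      rw [e1]
      generalize (K.obj j).coact.ρ.rTensor H ((K.obj j).coact.ρ x) = z at e ⊢
      have e2 : (TensorProduct.assoc k c.pt H H).toLinearMap
          (((leg K c j).rTensor H).rTensor H z) = TensorProduct.map (leg K c j)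
          (LinearMap.id (R := k) (M := H ⊗[k] H)) (TensorProduct.assoc k _ H H z) := by
        have := TensorProduct.map_map_comp_assoc_eq (leg K c j)
          (LinearMap.id (R := k) (M := H)) (LinearMap.id (R := k) (M := H))
        rw [TensorProduct.map_id] at this
        exact (LinearMap.congr_fun this z).symm
      refine e2.trans (e.trans ?_)
      simp only [LinearMap.lTensor, LinearMap.rTensor, TensorProduct.map_map, LinearMap.id_comp,
        LinearMap.comp_id]
    counit := by
      refine colim_hom_ext K hc (f := (TensorProduct.rid k c.pt).toLinearMap ∘ₗ
        (Coalgebra.counit (R := k) (A := H)).lTensor c.pt ∘ₗ colimρ K c hc)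
        (g := LinearMap.id) fun j x => ?_
      simp only [LinearMap.comp_apply, colimρ_leg, LinearMap.id_apply]
      have e := congrArg (leg K c j) ((K.obj j).coact.counit x)
      refine Eq.trans ?_ e
      generalize (K.obj j).coact.ρ x = z
      induction z with
      | zero => simp
      | add a b ha hb => simp only [map_add, ha, hb]
      | tmul a b => simp }

def colimCocone (c : Cocone (K ⋙ forget k H)) (hc : IsColimit c) : Cocone K where
  pt := colimPt K c hc
  ι :=
  { app := fun j => ⟨(leg K c j), fun x => colimρ_leg K c hc j x⟩
    naturality := fun i j f => by
      refine hom_ext fun x => ?_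
      exact LinearMap.congr_fun (leg_w K c f) x }

/-- The legs of a cocone of comodules, as linear maps. -/
def cleg (c : Cocone K) (j : J) : K.obj j →ₗ[k] c.pt := Hom.lin (c.ι.app j)

lemma cleg_colinear (c : Cocone K) (j : J) (x : K.obj j) :
    c.pt.coact.ρ (cleg K c j x) = (cleg K c j).rTensor H ((K.obj j).coact.ρ x) :=
  Hom.colinear (c.ι.app j) x

/-- The forgetful functor reflects colimits. -/
def isColimitOfForget (c : Cocone K) (hc : IsColimit ((forget k H).mapCocone c)) :
    IsColimit c where
  desc s := ⟨(hc.desc ((forget k H).mapCocone s)).hom, by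
    let d : c.pt →ₗ[k] s.pt := (hc.desc ((forget k H).mapCocone s)).hom
    have hd : ∀ j, d ∘ₗ cleg K c j = cleg K s j := fun j =>
      congrArg ModuleCat.Hom.hom (hc.fac ((forget k H).mapCocone s) j)
    refine colim_hom_ext K hc (f := s.pt.coact.ρ ∘ₗ d) (g := d.rTensor H ∘ₗ c.pt.coact.ρ)
      fun j x => ?_
    change s.pt.coact.ρ ((d ∘ₗ cleg K c j) x) = d.rTensor H (c.pt.coact.ρ (cleg K c j x))
    rw [hd, cleg_colinear, cleg_colinear, ← hd, LinearMap.rTensor_comp, LinearMap.comp_apply]⟩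
  fac s j := by
    refine hom_ext fun x => ?_
    exact LinearMap.congr_fun (congrArg ModuleCat.Hom.hom (hc.fac ((forget k H).mapCocone s) j)) x
  uniq s m h := by
    refine hom_ext fun x => ?_
    have := hc.uniq ((forget k H).mapCocone s) ((forget k H).map m) fun j => by
      exact congrArg (forget k H).map (h j)
    exact LinearMap.congr_fun (congrArg ModuleCat.Hom.hom this) x

instance : HasColimitsOfSize.{0, 0} (Comod k H) where
  has_colimits_of_shape _ _ :=
    { has_colimit := fun K => ⟨⟨⟨colimCocone K _ (colimit.isColimit (K ⋙ forget k H)),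
        isColimitOfForget K _ (colimit.isColimit (K ⋙ forget k H))⟩⟩⟩ }

instance : PreservesColimitsOfSize.{0, 0} (forget k H) where
  preservesColimitsOfShape :=
    { preservesColimit := fun {K} => preservesColimit_of_preserves_colimit_cocone
        (isColimitOfForget K (colimCocone K _ (colimit.isColimit (K ⋙ forget k H)))
          (colimit.isColimit (K ⋙ forget k H)))
        (colimit.isColimit (K ⋙ forget k H)) }

instance : ReflectsColimitsOfSize.{0, 0} (forget k H) where
  reflectsColimitsOfShape :=
    { reflectsColimit := fun {K} => ⟨fun {c} hc => ⟨isColimitOfForget K c hc⟩⟩ }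

end

variable {k H : Type u} [Field k] [AddCommGroup H] [Module k H] [Coalgebra k H]
  [CoquasiBialgebra k H]

instance (V : Comod k H) : PreservesColimitsOfSize.{0, 0} (tensorLeft V) :=
  have : PreservesColimitsOfSize.{0, 0} (tensorLeft V ⋙ forget k H) :=
    inferInstanceAs (PreservesColimitsOfSize.{0, 0}
      (forget k H ⋙ tensorLeft ((forget k H).obj V)))
  preservesColimits_of_reflects_of_preserves (tensorLeft V) (forget k H)

instance (V : Comod k H) : PreservesColimitsOfSize.{0, 0} (tensorRight V) :=
  have : PreservesColimitsOfSize.{0, 0} (tensorRight V ⋙ forget k H) :=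
    inferInstanceAs (PreservesColimitsOfSize.{0, 0}
      (forget k H ⋙ tensorRight ((forget k H).obj V)))
  preservesColimits_of_reflects_of_preserves (tensorRight V) (forget k H)

end Comod

section
open CategoryTheory.Limits
variable {C : Type*} [Category C] [MonoidalCategory C] [HasCoequalizers C]
  [∀ X : C, PreservesColimitsOfSize.{0, 0} (tensorLeft X)]
  [∀ X : C, PreservesColimitsOfSize.{0, 0} (tensorRight X)]

/-- The monoidal category of bimodules over an algebra `A` in a monoidal category, with tensor
product the coequalizer defining the tensor product over `A`. -/
instance bimodMonoidal (A : Mon C) : MonoidalCategory (Bimod A A) :=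
  letI := Bimod.monBicategory (C := C)
  inferInstanceAs (MonoidalCategory (EndMonoidal A))

end

end

noncomputable section

section
open MonObj
variable {C : Type*} [Category C] [MonoidalCategory C]

/-- The free `A`-bimodule `A ⊗ A`, with `a · ((c ⊗ d) · b)` computed through the reassociators. -/
def freeBimod (A : Mon C) : Bimod A A where
  X := A.X ⊗ A.X
  actLeft := (α_ A.X A.X A.X).inv ≫ μ ▷ A.X
  one_actLeft := by
    rw [associator_inv_naturality_left_assoc, ← comp_whiskerRight, one_mul, leftUnitor_tensor_hom]
  left_assoc := by
    simp only [whiskerRight_tensor, Category.assoc, Iso.hom_inv_id_assoc, MonoidalCategory.whiskerLeft_comp,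
      associator_inv_naturality_middle_assoc, ← comp_whiskerRight]
    rw [mul_assoc]
    simp
  actRight := (α_ A.X A.X A.X).hom ≫ A.X ◁ μ
  actRight_one := by
    rw [associator_naturality_right_assoc, ← MonoidalCategory.whiskerLeft_comp, mul_one,
      rightUnitor_tensor_hom]
  right_assoc := by
    simp only [tensor_whiskerLeft, Category.assoc, Iso.inv_hom_id_assoc, comp_whiskerRight,
      associator_naturality_middle_assoc, ← MonoidalCategory.whiskerLeft_comp]
    rw [mul_assoc_flip]
    simp
  middle_assoc := by
    simp only [comp_whiskerRight, Category.assoc, MonoidalCategory.whiskerLeft_comp,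
      associator_naturality_left_assoc, whisker_exchange, associator_inv_naturality_right_assoc]
    simp only [← Category.assoc]
    congr 2
    rw [← cancel_epi ((α_ A.X A.X A.X).hom ▷ A.X)]
    simp

/-- The bimodule map `A ⊗ A ⟶ M`, `a ⊗ b ↦ a r(b)`, attached to a right linear map `r`. -/
def freeLift {A : Mon C} (M : Bimod A A) (r : A.X ⟶ M.X) (h : μ ≫ r = r ▷ A.X ≫ M.actRight) :
    freeBimod A ⟶ M where
  hom := A.X ◁ r ≫ M.actLeft
  left_act_hom := by
    change ((α_ A.X A.X A.X).inv ≫ μ ▷ A.X) ≫ A.X ◁ r ≫ M.actLeft =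
      A.X ◁ (A.X ◁ r ≫ M.actLeft) ≫ M.actLeft
    simp [← whisker_exchange_assoc, Bimod.left_assoc]
  right_act_hom := by
    change ((α_ A.X A.X A.X).hom ≫ A.X ◁ μ) ≫ A.X ◁ r ≫ M.actLeft =
      (A.X ◁ r ≫ M.actLeft) ▷ A.X ≫ M.actRight
    have e : (α_ A.X A.X A.X).hom ≫ A.X ◁ (r ▷ A.X ≫ M.actRight) ≫ M.actLeft =
        (A.X ◁ r) ▷ A.X ≫ M.actLeft ▷ A.X ≫ M.actRight := by
      rw [Bimod.middle_assoc]; simp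
    rw [Category.assoc, comp_whiskerRight, Category.assoc, ← e, ← h, MonoidalCategory.whiskerLeft_comp,
      Category.assoc]
end
end

noncomputable section

namespace Comod

variable {k H : Type u} [Field k] [AddCommGroup H] [Module k H] [Coalgebra k H]
  [CoquasiBialgebra k H]

/-- The coinvariants `{v | ρ(v) = v ⊗ 1}` of a comodule. -/
def coinv (V : Comod k H) : Submodule k V :=
  LinearMap.ker (V.coact.ρ -
    (TensorProduct.mk k V H).flip (CoquasiBialgebra.unit (k := k) (H := H) 1))

lemma mem_coinv {V : Comod k H} {v : V} :
    v ∈ coinv V ↔ V.coact.ρ v = v ⊗ₜ CoquasiBialgebra.unit (k := k) 1 := by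
  simp [coinv, sub_eq_zero]

lemma map_mem_coinv {V W : Comod k H} (f : V ⟶ W) {v : V} (hv : v ∈ coinv V) :
    f.lin v ∈ coinv W := by
  rw [mem_coinv] at hv ⊢
  rw [f.colinear, hv, LinearMap.rTensor_tmul]

/-- The morphism `1 ↦ v` from the unit object attached to a coinvariant `v`. -/
def point {V : Comod k H} (v : V) (hv : v ∈ coinv V) : 𝟙_ (Comod k H) ⟶ V where
  lin := LinearMap.toSpanSingleton k V v
  colinear c := by
    change V.coact.ρ (c • v) = (c • v) ⊗ₜ[k] (CoquasiBialgebra.unit (k := k) (H := H) 1)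
    rw [map_smul, mem_coinv.1 hv, TensorProduct.smul_tmul']

lemma one_mem_coinv : (1 : k) ∈ coinv (𝟙_ (Comod k H)) := mem_coinv.2 rfl

lemma tmul_mem_coinv {V W : Comod k H} {v : V} {w : W} (hv : v ∈ coinv V) (hw : w ∈ coinv W) :
    v ⊗ₜ[k] w ∈ coinv (V ⊗ W) := by
  have h := map_mem_coinv ((λ_ (𝟙_ (Comod k H))).inv ≫ (point v hv ⊗ₘ point w hw)) one_mem_coinv
  have e : ((λ_ (𝟙_ (Comod k H))).inv ≫ (point v hv ⊗ₘ point w hw)).lin (1 : k) =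
      ((1 : k) • v) ⊗ₜ[k] ((1 : k) • w) := rfl
  rw [e, one_smul, one_smul] at h
  exact h

/-- The reassociator of the category of comodules on elements. -/
def as (U V W : Comod k H) : (U ⊗[k] V) ⊗[k] W ≃ₗ[k] U ⊗[k] (V ⊗[k] W) :=
  LinearEquiv.ofLinearMap (α_ U V W).hom.lin (α_ U V W).inv.lin
    (congrArg Hom.lin (α_ U V W).inv_hom_id) (congrArg Hom.lin (α_ U V W).hom_inv_id)

lemma as_natural {U V W U' V' W' : Comod k H} (f : U ⟶ U') (g : V ⟶ V') (h : W ⟶ W')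
    (u : U) (v : V) (w : W) :
    as U' V' W' (f.lin u ⊗ₜ g.lin v ⊗ₜ h.lin w) =
      TensorProduct.map f.lin (TensorProduct.map g.lin h.lin) (as U V W (u ⊗ₜ v ⊗ₜ w)) :=
  LinearMap.congr_fun (congrArg Hom.lin (associator_naturality f g h)) (u ⊗ₜ v ⊗ₜ w)

lemma as_aux {U V W U' V' W' : Type u} [AddCommGroup U] [Module k U] [AddCommGroup V] [Module k V]
    [AddCommGroup W] [Module k W] [AddCommGroup U'] [Module k U'] [AddCommGroup V'] [Module k V']
    [AddCommGroup W'] [Module k W'] {f : U →ₗ[k] U'} {g : V →ₗ[k] V'} {h : W →ₗ[k] W'}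
    {T : (U' ⊗[k] V') ⊗[k] W' → U' ⊗[k] (V' ⊗[k] W')} {u : U} {v : V} {w : W}
    {u' : U'} {v' : V'} {w' : W'}
    (e : T (f u ⊗ₜ g v ⊗ₜ h w) =
      TensorProduct.map f (TensorProduct.map g h) (u ⊗ₜ (v ⊗ₜ w)))
    (hu : f u = u') (hv : g v = v') (hw : h w = w') :
    T (u' ⊗ₜ v' ⊗ₜ w') = u' ⊗ₜ (v' ⊗ₜ w') := by
  rw [TensorProduct.map_tmul, TensorProduct.map_tmul, hu, hv, hw] at e
  exact e

lemma as_left {U V W : Comod k H} {u : U} (hu : u ∈ coinv U) (v : V) (w : W) :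
    as U V W (u ⊗ₜ v ⊗ₜ w) = u ⊗ₜ (v ⊗ₜ w) := by
  have h1 := as_natural (point u hu) (𝟙 V) (𝟙 W) (1 : k) v w
  have h2 : as (𝟙_ _) V W ((1 : k) ⊗ₜ v ⊗ₜ w) = (1 : k) ⊗ₜ (v ⊗ₜ w) := by
    have h3 : (α_ (𝟙_ _) V W).hom ≫ (λ_ (V ⊗ W)).hom = (λ_ V).hom ▷ W := by simp
    have h4 : TensorProduct.lid k (V ⊗[k] W) (as (𝟙_ _) V W ((1 : k) ⊗ₜ v ⊗ₜ w)) =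
        (TensorProduct.lid k V ((1 : k) ⊗ₜ v)) ⊗ₜ w :=
      LinearMap.congr_fun (congrArg Hom.lin h3) ((1 : k) ⊗ₜ v ⊗ₜ w)
    apply (TensorProduct.lid k (V ⊗[k] W)).injective
    refine h4.trans ?_
    simp
  rw [h2] at h1
  exact as_aux h1 (one_smul k u) rfl rfl

lemma as_mid {U V W : Comod k H} {v : V} (u : U) (hv : v ∈ coinv V) (w : W) :
    as U V W (u ⊗ₜ v ⊗ₜ w) = u ⊗ₜ (v ⊗ₜ w) := by
  have h1 := as_natural (𝟙 U) (point v hv) (𝟙 W) u (1 : k) w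
  have h2 : as U (𝟙_ _) W (u ⊗ₜ (1 : k) ⊗ₜ w) = u ⊗ₜ ((1 : k) ⊗ₜ w) := by
    have h3 : (α_ U (𝟙_ _) W).hom ≫ U ◁ (λ_ W).hom = (ρ_ U).hom ▷ W := by simp
    have h4 : (TensorProduct.lid k W).toLinearMap.lTensor U (as U (𝟙_ _) W (u ⊗ₜ (1 : k) ⊗ₜ w)) =
        (TensorProduct.rid k U (u ⊗ₜ (1 : k))) ⊗ₜ w :=
      LinearMap.congr_fun (congrArg Hom.lin h3) (u ⊗ₜ (1 : k) ⊗ₜ w)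
    apply (LinearEquiv.lTensor U (TensorProduct.lid k W)).injective
    refine h4.trans ?_
    simp
  rw [h2] at h1
  exact as_aux h1 rfl (one_smul k v) rfl

lemma as_right {U V W : Comod k H} {w : W} (u : U) (v : V) (hw : w ∈ coinv W) :
    as U V W (u ⊗ₜ v ⊗ₜ w) = u ⊗ₜ (v ⊗ₜ w) := by
  have h1 := as_natural (𝟙 U) (𝟙 V) (point w hw) u v (1 : k)
  have h2 : as U V (𝟙_ _) (u ⊗ₜ v ⊗ₜ (1 : k)) = u ⊗ₜ (v ⊗ₜ (1 : k)) := by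
    have h3 : (α_ U V (𝟙_ _)).hom ≫ U ◁ (ρ_ V).hom = (ρ_ (U ⊗ V)).hom := by simp
    have h4 : (TensorProduct.rid k V).toLinearMap.lTensor U (as U V (𝟙_ _) (u ⊗ₜ v ⊗ₜ (1 : k))) =
        (TensorProduct.rid k (U ⊗[k] V) (u ⊗ₜ v ⊗ₜ (1 : k))) :=
      LinearMap.congr_fun (congrArg Hom.lin h3) (u ⊗ₜ v ⊗ₜ (1 : k))
    apply (LinearEquiv.lTensor U (TensorProduct.rid k V)).injective
    refine h4.trans ?_
    simp
  rw [h2] at h1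
  exact as_aux h1 rfl rfl (one_smul k w)

end Comod

open Comod MonObj

section
variable {k H : Type u} [Field k] [AddCommGroup H] [Module k H] [Coalgebra k H]
  [CoquasiBialgebra k H] (A : Mon (Comod k H))

/-- The multiplication of a comodule algebra. -/
def mulLin : A.X ⊗[k] A.X →ₗ[k] A.X := (μ[A.X]).lin

/-- The unit of a comodule algebra. -/
def unitElt : A.X := (η[A.X]).lin (1 : k)

variable {A} (M : Bimod A A)

/-- The left action on a bimodule. -/
def lact : A.X ⊗[k] M.X →ₗ[k] M.X := M.actLeft.lin

/-- The right action on a bimodule. -/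
def ract : M.X ⊗[k] A.X →ₗ[k] M.X := M.actRight.lin

lemma unitElt_mem : unitElt A ∈ coinv A.X := map_mem_coinv η[A.X] one_mem_coinv

lemma mulLin_mem {a b : A.X} (ha : a ∈ coinv A.X) (hb : b ∈ coinv A.X) :
    mulLin A (a ⊗ₜ b) ∈ coinv A.X := map_mem_coinv μ[A.X] (tmul_mem_coinv ha hb)

lemma mulLin_assoc (x : (A.X ⊗[k] A.X) ⊗[k] A.X) : mulLin A ((mulLin A).rTensor A.X x) =
    mulLin A ((mulLin A).lTensor A.X (as A.X A.X A.X x)) :=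
  LinearMap.congr_fun (congrArg Hom.lin (MonObj.mul_assoc A.X)) x

lemma unitElt_mul (a : A.X) : mulLin A (unitElt A ⊗ₜ a) = a :=
  (LinearMap.congr_fun (congrArg Hom.lin (MonObj.one_mul A.X)) ((1 : k) ⊗ₜ[k] a)).trans
    (one_smul k a)

lemma mul_unitElt (a : A.X) : mulLin A (a ⊗ₜ unitElt A) = a :=
  (LinearMap.congr_fun (congrArg Hom.lin (MonObj.mul_one A.X)) (a ⊗ₜ[k] (1 : k))).trans
    (one_smul k a)

lemma lact_assoc (x : (A.X ⊗[k] A.X) ⊗[k] M.X) : lact M ((mulLin A).rTensor M.X x) =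
    lact M ((lact M).lTensor A.X (as A.X A.X M.X x)) :=
  LinearMap.congr_fun (congrArg Hom.lin M.left_assoc) x

lemma ract_assoc (x : (M.X ⊗[k] A.X) ⊗[k] A.X) :
    ract M ((mulLin A).lTensor M.X (as M.X A.X A.X x)) =
    ract M ((ract M).rTensor A.X x) := by
  have h : (α_ M.X A.X A.X).hom ≫ M.X ◁ μ ≫ M.actRight = M.actRight ▷ A.X ≫ M.actRight := by
    rw [M.right_assoc, Iso.hom_inv_id_assoc]
  exact LinearMap.congr_fun (congrArg Hom.lin h) x

lemma middle_assoc (x : (A.X ⊗[k] M.X) ⊗[k] A.X) : ract M ((lact M).rTensor A.X x) =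
    lact M ((ract M).lTensor A.X (as A.X M.X A.X x)) :=
  LinearMap.congr_fun (congrArg Hom.lin M.middle_assoc) x

lemma unitElt_lact (m : M.X) : lact M (unitElt A ⊗ₜ m) = m :=
  (LinearMap.congr_fun (congrArg Hom.lin M.one_actLeft) ((1 : k) ⊗ₜ[k] m)).trans
    (one_smul k m)

lemma ract_unitElt (m : M.X) : ract M (m ⊗ₜ unitElt A) = m :=
  (LinearMap.congr_fun (congrArg Hom.lin M.actRight_one) (m ⊗ₜ[k] (1 : k))).trans
    (one_smul k m)

variable {M}

lemma lact_hom {N : Bimod A A} (f : M ⟶ N) (a : A.X) (m : M.X) :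
    lact N (a ⊗ₜ f.hom.lin m) = f.hom.lin (lact M (a ⊗ₜ m)) :=
  (LinearMap.congr_fun (congrArg Hom.lin f.left_act_hom) (a ⊗ₜ[k] m)).symm

lemma ract_hom {N : Bimod A A} (f : M ⟶ N) (a : A.X) (m : M.X) :
    ract N (f.hom.lin m ⊗ₜ a) = f.hom.lin (ract M (m ⊗ₜ a)) :=
  (LinearMap.congr_fun (congrArg Hom.lin f.right_act_hom) (m ⊗ₜ[k] a)).symm

variable (M)

/-- The map `a ⊗ b ↦ (m ↦ a (m b))`. -/
def actLR : A.X ⊗[k] A.X →ₗ[k] M.X →ₗ[k] M.X :=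
  TensorProduct.lift (LinearMap.mk₂ k
    (fun a b => lact M ∘ₗ TensorProduct.mk k A.X M.X a ∘ₗ ract M ∘ₗ
      (TensorProduct.mk k M.X A.X).flip b)
    (fun a a' b => by ext; simp) (fun c a b => by ext; simp)
    (fun a b b' => by ext; simp [tmul_add]) (fun c a b => by ext; simp))

lemma actLR_tmul (a b : A.X) (m : M.X) :
    actLR M (a ⊗ₜ b) m = lact M (a ⊗ₜ ract M (m ⊗ₜ b)) := rfl

variable {M}

lemma actLR_hom {N : Bimod A A} (f : M ⟶ N) (x : A.X ⊗[k] A.X) (m : M.X) :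
    actLR N x (f.hom.lin m) = f.hom.lin (actLR M x m) := by
  induction x with
  | zero => simp
  | add x y hx hy => simp only [map_add, LinearMap.add_apply, hx, hy]
  | tmul a b => rw [actLR_tmul, actLR_tmul, ract_hom, lact_hom]

/-- Right multiplication `a ↦ m a` for a coinvariant `m`. -/
def rmul (m : M.X) (hm : m ∈ coinv M.X) : A.X ⟶ M.X :=
  (λ_ A.X).inv ≫ point m hm ▷ A.X ≫ M.actRight

lemma rmul_lin (m : M.X) (hm : m ∈ coinv M.X) (a : A.X) :
    (rmul m hm).lin a = ract M (m ⊗ₜ a) := by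
  have : (rmul m hm).lin a = ract M (((1 : k) • m) ⊗ₜ a) := rfl
  rw [this, one_smul]

lemma mul_rmul (m : M.X) (hm : m ∈ coinv M.X) :
    μ ≫ rmul m hm = rmul m hm ▷ A.X ≫ M.actRight := by
  refine hom_ext' (TensorProduct.ext' fun a b => ?_)
  change (rmul m hm).lin (mulLin A (a ⊗ₜ b)) = ract M ((rmul m hm).lin a ⊗ₜ b)
  rw [rmul_lin, rmul_lin]
  have := ract_assoc M (m ⊗ₜ a ⊗ₜ b)
  rwa [as_left hm, LinearMap.lTensor_tmul, LinearMap.rTensor_tmul] at this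

/-- The bimodule map `a ⊗ b ↦ a (m b)` attached to a coinvariant `m`. -/
def orbit (m : M.X) (hm : m ∈ coinv M.X) : freeBimod A ⟶ M :=
  freeLift M (rmul m hm) (mul_rmul m hm)

lemma orbit_lin (m : M.X) (hm : m ∈ coinv M.X) (x : A.X ⊗[k] A.X) :
    (orbit m hm).hom.lin x = actLR M x m := by
  change lact M ((rmul m hm).lin.lTensor A.X x) = _
  induction x with
  | zero => simp
  | add x y hx hy => simp only [map_add, LinearMap.add_apply, hx, hy]
  | tmul a b => rw [LinearMap.lTensor_tmul, rmul_lin, actLR_tmul]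

lemma actLR_mem {x : A.X ⊗[k] A.X} (hx : x ∈ coinv (A.X ⊗ A.X)) {m : M.X} (hm : m ∈ coinv M.X) :
    actLR M x m ∈ coinv M.X := by
  rw [← orbit_lin m hm]; exact map_mem_coinv (orbit m hm).hom hx

lemma actLR_one (m : M.X) : actLR M (unitElt A ⊗ₜ unitElt A) m = m := by
  rw [actLR_tmul, ract_unitElt, unitElt_lact]

variable (A)

/-- The map `a ⊗ b ↦ ((c ⊗ d) ↦ a₀c₀ ⊗ d₀b₀ ω⁻¹(a₁, c₁, d₁b₁) ω(c₂, d₂, b₂))`, computed in two steps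
`c ⊗ d ↦ c₀ ⊗ d₀b₀ ω(c₁, d₁, b₁)` and `c ⊗ e ↦ a₀c₀ ⊗ e₀ ω⁻¹(a₁, c₁, e₁)`. -/
def freeLR : A.X ⊗[k] A.X →ₗ[k] A.X ⊗[k] A.X →ₗ[k] A.X ⊗[k] A.X :=
  TensorProduct.lift (LinearMap.mk₂ k
    (fun a b => (mulLin A).rTensor A.X ∘ₗ (as A.X A.X A.X).symm.toLinearMap ∘ₗ
      TensorProduct.mk k A.X (A.X ⊗[k] A.X) a ∘ₗ (mulLin A).lTensor A.X ∘ₗ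
      (as A.X A.X A.X).toLinearMap ∘ₗ (TensorProduct.mk k (A.X ⊗[k] A.X) A.X).flip b)
    (fun a a' b => by ext; simp) (fun c a b => by ext; simp)
    (fun a b b' => by ext; simp [tmul_add]) (fun c a b => by ext; simp))

lemma freeLR_tmul (a b : A.X) (y : A.X ⊗[k] A.X) : freeLR A (a ⊗ₜ b) y =
    (mulLin A).rTensor A.X ((as A.X A.X A.X).symm (a ⊗ₜ
      (mulLin A).lTensor A.X (as A.X A.X A.X (y ⊗ₜ b)))) := rfl

variable {A}

lemma freeLR_eq (x y : A.X ⊗[k] A.X) : freeLR A x y = actLR (freeBimod A) x y := by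
  induction x with
  | zero => rw [map_zero, map_zero]; rfl
  | add x x' hx hx' => rw [map_add, map_add, LinearMap.add_apply, hx, hx']; rfl
  | tmul a b => rfl

lemma actLR_freeLR (x y : A.X ⊗[k] A.X) {m : M.X} (hm : m ∈ coinv M.X) :
    actLR M (freeLR A x y) m = actLR M x (actLR M y m) := by
  rw [← orbit_lin m hm, ← orbit_lin m hm, freeLR_eq]
  exact (actLR_hom (orbit m hm) x y).symm

lemma freeLR_mem {x y : A.X ⊗[k] A.X} (hx : x ∈ coinv (A.X ⊗ A.X)) (hy : y ∈ coinv (A.X ⊗ A.X)) :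
    freeLR A x y ∈ coinv (A.X ⊗ A.X) := by
  rw [freeLR_eq]; exact actLR_mem (M := freeBimod A) hx hy

lemma freeLR_freeLR (x y : A.X ⊗[k] A.X) {z : A.X ⊗[k] A.X} (hz : z ∈ coinv (A.X ⊗ A.X)) :
    freeLR A (freeLR A x y) z = freeLR A x (freeLR A y z) := by
  have h := actLR_freeLR (M := freeBimod A) x y hz
  rw [← freeLR_eq] at h
  refine h.trans ?_
  rw [freeLR_eq, freeLR_eq]

lemma one_freeLR (x : A.X ⊗[k] A.X) : freeLR A (unitElt A ⊗ₜ unitElt A) x = x := by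
  rw [freeLR_eq]; exact actLR_one (M := freeBimod A) x

lemma freeLR_one (x : A.X ⊗[k] A.X) : freeLR A x (unitElt A ⊗ₜ unitElt A) = x := by
  induction x with
  | zero => simp
  | add x y hx hy => rw [map_add, LinearMap.add_apply, hx, hy]
  | tmul a b =>
    rw [freeLR_tmul, as_mid _ unitElt_mem, LinearMap.lTensor_tmul, unitElt_mul,
      ← as_mid a unitElt_mem b, LinearEquiv.symm_apply_apply, LinearMap.rTensor_tmul, mul_unitElt]

variable (A)

/-- The algebra `B = A^{co H}` of coinvariants. -/
def CoinvAlg : Type u := coinv A.X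

/-- The vector space `L = (A ⊗ A)^{co H}`. -/
def LAlg : Type u := coinv (A.X ⊗ A.X)

namespace CoinvAlg
instance : AddCommGroup (CoinvAlg A) := inferInstanceAs (AddCommGroup (coinv A.X))
instance : Module k (CoinvAlg A) := inferInstanceAs (Module k (coinv A.X))

/-- The inclusion of the coinvariants. -/
def val : CoinvAlg A →ₗ[k] A.X := (coinv A.X).subtype

variable {A}

lemma val_mem (b : CoinvAlg A) : val A b ∈ coinv A.X := b.2

lemma val_inj {b c : CoinvAlg A} (h : val A b = val A c) : b = c := Subtype.ext h

instance : Mul (CoinvAlg A) := ⟨fun b c => ⟨mulLin A (val A b ⊗ₜ val A c), mulLin_mem b.2 c.2⟩⟩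
instance : One (CoinvAlg A) := ⟨⟨unitElt A, unitElt_mem⟩⟩

lemma val_mul (b c : CoinvAlg A) : val A (b * c) = mulLin A (val A b ⊗ₜ val A c) := rfl
lemma val_one : val A 1 = unitElt A := rfl

instance : Ring (CoinvAlg A) where
  __ : AddCommGroup (CoinvAlg A) := inferInstance
  left_distrib a b c := val_inj (by simp only [val_mul, map_add, tmul_add])
  right_distrib a b c := val_inj (by simp only [val_mul, map_add, add_tmul])
  zero_mul a := val_inj (by simp only [val_mul, map_zero, zero_tmul])
  mul_zero a := val_inj (by simp only [val_mul, map_zero, tmul_zero])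
  mul_assoc a b c := val_inj (by
    have := mulLin_assoc (val A a ⊗ₜ val A b ⊗ₜ val A c)
    rwa [as_left a.val_mem, LinearMap.lTensor_tmul, LinearMap.rTensor_tmul] at this)
  one_mul a := val_inj (unitElt_mul _)
  mul_one a := val_inj (mul_unitElt _)

instance : Algebra k (CoinvAlg A) := Algebra.ofModule
  (fun r x y => val_inj (by simp only [val_mul, map_smul, ← smul_tmul', map_smul]))
  (fun r x y => val_inj (by simp only [val_mul, map_smul, tmul_smul, map_smul]))

end CoinvAlg

namespace LAlg
instance : AddCommGroup (LAlg A) := inferInstanceAs (AddCommGroup (coinv (A.X ⊗ A.X)))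
instance : Module k (LAlg A) := inferInstanceAs (Module k (coinv (A.X ⊗ A.X)))

/-- The inclusion of `L` in `A ⊗ A`. -/
def val : LAlg A →ₗ[k] A.X ⊗[k] A.X := (coinv (A.X ⊗ A.X)).subtype

variable {A}

lemma val_mem (b : LAlg A) : val A b ∈ coinv (A.X ⊗ A.X) := b.2

lemma val_inj {b c : LAlg A} (h : val A b = val A c) : b = c := Subtype.ext h

/-- The multiplication `(a ⊗ b)(c ⊗ d) = a₀c₀ ⊗ d₀b₀ ω⁻¹(a₁, c₁, d₁b₁) ω(c₂, d₂, b₂)`. -/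
instance : Mul (LAlg A) := ⟨fun x y => ⟨freeLR A (val A x) (val A y), freeLR_mem x.2 y.2⟩⟩
instance : One (LAlg A) := ⟨⟨unitElt A ⊗ₜ[k] unitElt A, tmul_mem_coinv unitElt_mem unitElt_mem⟩⟩

lemma val_mul (x y : LAlg A) : val A (x * y) = freeLR A (val A x) (val A y) := rfl
lemma val_one : val A 1 = unitElt A ⊗ₜ[k] unitElt A := rfl

instance : Ring (LAlg A) where
  __ : AddCommGroup (LAlg A) := inferInstance
  left_distrib a b c := val_inj (by simp only [val_mul, map_add])
  right_distrib a b c := val_inj (by simp only [val_mul, map_add, LinearMap.add_apply])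
  zero_mul a := val_inj (by simp only [val_mul, map_zero, LinearMap.zero_apply])
  mul_zero a := val_inj (by simp only [val_mul, map_zero])
  mul_assoc a b c := val_inj (freeLR_freeLR _ _ c.val_mem)
  one_mul a := val_inj (one_freeLR _)
  mul_one a := val_inj (freeLR_one _)

instance : Algebra k (LAlg A) := Algebra.ofModule
  (fun r x y => val_inj (by simp only [val_mul, map_smul, LinearMap.smul_apply]))
  (fun r x y => val_inj (by simp only [val_mul, map_smul]))

end LAlg
end
end

noncomputable section

section
variable (k : Type u) [Field k]

/-- An algebra as a monoid object in vector spaces. -/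
def monOf (B : Type u) [Ring B] [Algebra k B] : Mon (ModuleCat.{u} k) where
  X := ModuleCat.of k B
  mon := ModuleCat.MonModuleEquivalenceAlgebra.inverseObj (AlgCat.of k B)

variable {k} {B L : Type u} [Ring B] [Algebra k B] [Ring L] [Algebra k L]

/-- The bimodule over an algebra given by commuting left and right actions. -/
def bimodMk (N : ModuleCat.{u} k) (l : B →ₐ[k] Module.End k N) (r : Bᵐᵒᵖ →ₐ[k] Module.End k N)
    (h : ∀ b c n, l b (r c n) = r c (l b n)) : Bimod (monOf k B) (monOf k B) where
  X := N
  actLeft := ModuleCat.ofHom (TensorProduct.lift l.toLinearMap)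
  one_actLeft := ModuleCat.hom_ext (TensorProduct.ext' fun c n => by
    change l (algebraMap k B c) n = c • n
    rw [l.commutes]; rfl)
  left_assoc := ModuleCat.hom_ext (TensorProduct.ext_threefold fun (a b : B) n => by
    change l (a * b) n = l a (l b n)
    rw [map_mul]; rfl)
  actRight := ModuleCat.ofHom
    (TensorProduct.lift (r.toLinearMap ∘ₗ (MulOpposite.opLinearEquiv k).toLinearMap).flip)
  actRight_one := ModuleCat.hom_ext (TensorProduct.ext' fun n c => by
    change r (algebraMap k Bᵐᵒᵖ c) n = c • n
    rw [r.commutes]; rfl)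
  right_assoc := ModuleCat.hom_ext <| by
    refine TensorProduct.ext (LinearMap.ext fun n => TensorProduct.ext' fun (a b : B) => ?_)
    change r (MulOpposite.op (a * b)) n = r (MulOpposite.op b) (r (MulOpposite.op a) n)
    rw [MulOpposite.op_mul, map_mul]; rfl
  middle_assoc := ModuleCat.hom_ext (TensorProduct.ext_threefold fun a n b => by
    exact (h a (MulOpposite.op b) n).symm)

/-- The algebra map giving the action of `L` on a module. -/
def smulHom (N : ModuleCat.{u} L) :
    L →ₐ[k] Module.End k ((ModuleCat.restrictScalars (algebraMap k L)).obj N) where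
  toFun x :=
    { toFun := fun n => (x • n : N)
      map_add' := fun n n' => smul_add x (n : N) (n' : N)
      map_smul' := fun c n => by
        change x • (algebraMap k L c • (n : N)) = algebraMap k L c • (x • (n : N))
        rw [smul_smul, smul_smul, Algebra.commutes] }
  map_one' := LinearMap.ext fun n => one_smul L (n : N)
  map_mul' x y := LinearMap.ext fun n => mul_smul x y (n : N)
  map_zero' := LinearMap.ext fun n => zero_smul L (n : N)
  map_add' x y := LinearMap.ext fun n => add_smul x y (n : N)
  commutes' c := rfl

/-- The forgetful functor from left `L`-modules to `B`-bimodules along algebra maps `s : B → L` and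
`t : Bᵒᵖ → L` with commuting images; the left action is `b n = s(b) n`, the right action is
`n b = t(b) n`. -/
def forgetBimod (s : B →ₐ[k] L) (t : Bᵐᵒᵖ →ₐ[k] L) (h : ∀ b c, Commute (s b) (t c)) :
    ModuleCat.{u} L ⥤ Bimod (monOf k B) (monOf k B) where
  obj N := bimodMk ((ModuleCat.restrictScalars (algebraMap k L)).obj N)
    ((smulHom N).comp s) ((smulHom N).comp t) fun b c n => by
      change s b • (t c • (n : N)) = t c • (s b • (n : N))
      rw [smul_smul, smul_smul, h b c]
  map {N N'} f :=
    { hom := (ModuleCat.restrictScalars (algebraMap k L)).map f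
      left_act_hom := ModuleCat.hom_ext (TensorProduct.ext' fun b n => by
        exact map_smul f.hom (s b) (show N from n))
      right_act_hom := ModuleCat.hom_ext (TensorProduct.ext' fun n b => by
        exact map_smul f.hom (t (MulOpposite.op b)) (show N from n)) }

end

open Comod

section
variable {k H : Type u} [Field k] [AddCommGroup H] [Module k H] [Coalgebra k H]
  [CoquasiBialgebra k H] (A : Mon (Comod k H))

variable {A} in
lemma freeLR_coinv {a b c d : A.X} (ha : a ∈ coinv A.X) (hb : b ∈ coinv A.X) :
    freeLR A (a ⊗ₜ b) (c ⊗ₜ d) = mulLin A (a ⊗ₜ c) ⊗ₜ mulLin A (d ⊗ₜ b) := by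
  rw [freeLR_tmul, as_right _ _ hb, LinearMap.lTensor_tmul, ← as_left ha,
    LinearEquiv.symm_apply_apply, LinearMap.rTensor_tmul]

/-- The source map `b ↦ b ⊗ 1`. -/
def srcMap : CoinvAlg A →ₐ[k] LAlg A :=
  AlgHom.ofLinearMap
    ⟨⟨fun b => ⟨CoinvAlg.val A b ⊗ₜ[k] unitElt A, tmul_mem_coinv b.2 unitElt_mem⟩,
      fun b c => LAlg.val_inj (by exact add_tmul _ _ _)⟩,
      fun r b => LAlg.val_inj (by exact (smul_tmul' r (CoinvAlg.val A b) (unitElt A)).symm)⟩ rfl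
    fun b c => LAlg.val_inj (by
      have h := freeLR_coinv (c := CoinvAlg.val A c) (d := unitElt A) b.val_mem unitElt_mem
      rw [unitElt_mul] at h
      exact h.symm)

/-- The target map `b ↦ 1 ⊗ b`. -/
def tgtMap : (CoinvAlg A)ᵐᵒᵖ →ₐ[k] LAlg A :=
  AlgHom.ofLinearMap
    ⟨⟨fun b => ⟨unitElt A ⊗ₜ[k] CoinvAlg.val A b.unop, tmul_mem_coinv unitElt_mem b.unop.2⟩,
      fun b c => LAlg.val_inj (by exact tmul_add _ _ _)⟩,
      fun r b => LAlg.val_inj (by exact tmul_smul r (unitElt A) (CoinvAlg.val A b.unop))⟩ rfl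
    fun b c => LAlg.val_inj (by
      have h := freeLR_coinv (c := unitElt A) (d := CoinvAlg.val A c.unop) unitElt_mem
        b.unop.val_mem
      rw [unitElt_mul] at h
      exact h.symm)

lemma val_srcMap (b : CoinvAlg A) :
    LAlg.val A (srcMap A b) = CoinvAlg.val A b ⊗ₜ unitElt A := rfl

lemma val_tgtMap (b : (CoinvAlg A)ᵐᵒᵖ) :
    LAlg.val A (tgtMap A b) = unitElt A ⊗ₜ CoinvAlg.val A b.unop := rfl

lemma srcMap_commute_tgtMap (b : CoinvAlg A) (c : (CoinvAlg A)ᵐᵒᵖ) :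
    Commute (srcMap A b) (tgtMap A c) := LAlg.val_inj <| by
  rw [LAlg.val_mul, LAlg.val_mul, val_srcMap, val_tgtMap, freeLR_coinv b.val_mem unitElt_mem,
    freeLR_coinv unitElt_mem c.unop.val_mem, mul_unitElt, mul_unitElt, unitElt_mul, unitElt_mul]

/-- The coinvariants of a bimodule. -/
def CoinvMod {A : Mon (Comod k H)} (M : Bimod A A) : Type u := coinv M.X

namespace CoinvMod
variable {A} (M N : Bimod A A)

instance : AddCommGroup (CoinvMod M) := inferInstanceAs (AddCommGroup (coinv M.X))

/-- The inclusion of the coinvariants. -/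
def val : CoinvMod M →+ M.X := (coinv M.X).subtype.toAddMonoidHom

lemma val_inj {m n : CoinvMod M} (h : val M m = val M n) : m = n := Subtype.ext h

/-- The action `(a ⊗ b) m = a (m b)` of `L` on the coinvariants of a bimodule. -/
instance : SMul (LAlg A) (CoinvMod M) :=
  ⟨fun x m => ⟨actLR M (LAlg.val A x) (val M m), actLR_mem x.2 m.2⟩⟩

lemma val_smul (x : LAlg A) (m : CoinvMod M) :
    val M (x • m) = actLR M (LAlg.val A x) (val M m) := rfl

instance : Module (LAlg A) (CoinvMod M) where
  one_smul m := val_inj M (actLR_one _)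
  mul_smul x y m := val_inj M (actLR_freeLR _ _ m.2)
  smul_zero x := val_inj M (by rw [val_smul, map_zero, map_zero])
  smul_add x m n := val_inj M (by simp only [val_smul, map_add])
  add_smul x y m := val_inj M (by simp only [val_smul, map_add, LinearMap.add_apply])
  zero_smul m := val_inj M (by simp only [val_smul, map_zero, LinearMap.zero_apply])

end CoinvMod

/-- The functor `M ↦ M^{co H}` from `A`-bimodules in the category of comodules to left
`L`-modules. -/
def coinvFunctor : Bimod A A ⥤ ModuleCat.{u} (LAlg A) where
  obj M := ModuleCat.of (LAlg A) (CoinvMod M)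
  map {M N} f := ModuleCat.ofHom
    { toFun := fun m => ⟨f.hom.lin m.1, map_mem_coinv f.hom m.2⟩
      map_add' := fun m n => CoinvMod.val_inj N (map_add f.hom.lin _ _)
      map_smul' := fun x m => CoinvMod.val_inj N (actLR_hom f _ _).symm }

/-- The forgetful functor from left `L`-modules to `B`-bimodules. -/
abbrev forgetL : ModuleCat.{u} (LAlg A) ⥤ Bimod (monOf k (CoinvAlg A)) (monOf k (CoinvAlg A)) :=
  forgetBimod (srcMap A) (tgtMap A) (srcMap_commute_tgtMap A)

end
end

noncomputable section

section Balanced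
variable {k B : Type*} [Field k] {N M N' M' : Type*} [AddCommGroup N] [Module k N]
  [AddCommGroup M] [Module k M] [AddCommGroup N'] [Module k N'] [AddCommGroup M'] [Module k M']

/-- The span of all `n b ⊗ m - n ⊗ b m`, for a right action `r` and a left action `l`. -/
def balRel (r : B → Module.End k N) (l : B → Module.End k M) : Submodule k (N ⊗[k] M) :=
  Submodule.span k {x | ∃ b n m, x = r b n ⊗ₜ m - n ⊗ₜ l b m}

/-- The balanced tensor product `N ⊗_B M`. -/
abbrev BTensor (r : B → Module.End k N) (l : B → Module.End k M) := (N ⊗[k] M) ⧸ balRel r l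

/-- The map `f ⊗_B g` induced by `B`-linear maps. -/
def BTensor.map {r : B → Module.End k N} {l : B → Module.End k M}
    {r' : B → Module.End k N'} {l' : B → Module.End k M'} (f : N →ₗ[k] N') (g : M →ₗ[k] M')
    (hf : ∀ b n, f (r b n) = r' b (f n)) (hg : ∀ b m, g (l b m) = l' b (g m)) :
    BTensor r l →ₗ[k] BTensor r' l' :=
  (balRel r l).mapQ (balRel r' l') (TensorProduct.map f g) <| by
    refine Submodule.span_le.2 ?_
    rintro _ ⟨b, n, m, rfl⟩
    refine Submodule.subset_span ⟨b, f n, g m, ?_⟩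
    rw [map_sub, TensorProduct.map_tmul, TensorProduct.map_tmul, hf, hg]

end Balanced

section Flat
variable {k B : Type u} [Field k] [Ring B] [Algebra k B]

/-- The right action on a right module. -/
def rightAct (N : Type u) [AddCommGroup N] [Module k N] [Module Bᵐᵒᵖ N] [IsScalarTower k Bᵐᵒᵖ N]
    (b : B) : Module.End k N := Algebra.lsmul k k N (MulOpposite.op b)

/-- A left `B`-module `A` with action `l` is faithfully flat: a sequence of right `B`-modules is
exact if and only if it is exact after applying `- ⊗_B A`. -/
def IsLeftFaithfullyFlat {A : Type u} [AddCommGroup A] [Module k A]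
    (l : B →ₐ[k] Module.End k A) : Prop :=
  ∀ (N₁ N₂ N₃ : Type u) [AddCommGroup N₁] [AddCommGroup N₂] [AddCommGroup N₃]
    [Module k N₁] [Module k N₂] [Module k N₃] [Module Bᵐᵒᵖ N₁] [Module Bᵐᵒᵖ N₂] [Module Bᵐᵒᵖ N₃]
    [IsScalarTower k Bᵐᵒᵖ N₁] [IsScalarTower k Bᵐᵒᵖ N₂] [IsScalarTower k Bᵐᵒᵖ N₃]
    (f : N₁ →ₗ[Bᵐᵒᵖ] N₂) (g : N₂ →ₗ[Bᵐᵒᵖ] N₃),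
    Function.Exact f g ↔ Function.Exact
      (BTensor.map (r := rightAct N₁) (r' := rightAct N₂) (l := l) (l' := l)
        (f.restrictScalars k) LinearMap.id (fun b n => f.map_smul (MulOpposite.op b) n)
        (fun _ _ => rfl))
      (BTensor.map (r := rightAct N₂) (r' := rightAct N₃) (l := l) (l' := l)
        (g.restrictScalars k) LinearMap.id (fun b n => g.map_smul (MulOpposite.op b) n)
        (fun _ _ => rfl))

end Flat

open Comod MonObj

section Galois
variable {k H : Type u} [Field k] [AddCommGroup H] [Module k H] [Coalgebra k H]

section
variable [CoquasiBialgebra k H] (A : Mon (Comod k H))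

variable {A} in
/-- Left multiplication by a coinvariant as a morphism of comodules. -/
def mulL (b : CoinvAlg A) : A.X ⟶ A.X := (λ_ A.X).inv ≫ point _ b.val_mem ▷ A.X ≫ μ

variable {A} in
/-- Right multiplication by a coinvariant as a morphism of comodules. -/
def mulR (b : CoinvAlg A) : A.X ⟶ A.X := (ρ_ A.X).inv ≫ A.X ◁ point _ b.val_mem ≫ μ

variable {A}

lemma mulL_lin (b : CoinvAlg A) (a : A.X) :
    (mulL b).lin a = mulLin A (CoinvAlg.val A b ⊗ₜ a) := by
  have : (mulL b).lin a = mulLin A (((1 : k) • CoinvAlg.val A b) ⊗ₜ a) := rfl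
  rw [this, one_smul]

lemma mulR_lin (b : CoinvAlg A) (a : A.X) :
    (mulR b).lin a = mulLin A (a ⊗ₜ CoinvAlg.val A b) := by
  have : (mulR b).lin a = mulLin A (a ⊗ₜ ((1 : k) • CoinvAlg.val A b)) := rfl
  rw [this, one_smul]

variable (A)

/-- The left action `a ↦ b a` of `B` on `A`. -/
def leftB : CoinvAlg A →ₐ[k] Module.End k A.X :=
  AlgHom.ofLinearMap (TensorProduct.curry (mulLin A) ∘ₗ CoinvAlg.val A)
    (LinearMap.ext fun a => unitElt_mul a) fun b c => LinearMap.ext fun a => by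
      have h := mulLin_assoc (CoinvAlg.val A b ⊗ₜ CoinvAlg.val A c ⊗ₜ a)
      rw [as_left b.val_mem] at h
      exact h

/-- The right action `a ↦ a b` of `B` on `A`. -/
def rightB (b : CoinvAlg A) : Module.End k A.X :=
  (TensorProduct.curry (mulLin A)).flip (CoinvAlg.val A b)

end

variable [CoquasiHopfAlgebra k H] (A : Mon (Comod k H))

/-- The map `h ↦ h₁ β(h₂) ⊗ (S(h₃) ⊗ h₄)`. -/
def sigmaMap (k H : Type u) [Field k] [AddCommGroup H] [Module k H] [Coalgebra k H]
    [CoquasiHopfAlgebra k H] : H →ₗ[k] H ⊗[k] (H ⊗[k] H) :=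
  TensorProduct.map (convR LinearMap.id CoquasiHopfAlgebra.β)
    (CoquasiHopfAlgebra.S.rTensor H ∘ₗ Coalgebra.comul) ∘ₗ Coalgebra.comul

/-- The map `g ⊗ h ↦ ω⁻¹(g, h₁ β(h₂), S(h₃)) h₄`. -/
def gammaMap (k H : Type u) [Field k] [AddCommGroup H] [Module k H] [Coalgebra k H]
    [CoquasiHopfAlgebra k H] : H ⊗[k] H →ₗ[k] H :=
  (TensorProduct.lid k H).toLinearMap ∘ₗ CoquasiBialgebra.ωInv.rTensor H ∘ₗ
    (TensorProduct.assoc k (H ⊗[k] H) H H).symm.toLinearMap ∘ₗ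
    (TensorProduct.assoc k H H (H ⊗[k] H)).symm.toLinearMap ∘ₗ (sigmaMap k H).lTensor H

/-- The map `a ⊗ b ↦ a₀ b₀ ⊗ b₄ ω⁻¹(a₁, b₁ β(b₂), S(b₃))` on `A ⊗ A`. -/
def galoisFun : A.X ⊗[k] A.X →ₗ[k] A.X ⊗[k] H :=
  TensorProduct.map (mulLin A) (gammaMap k H) ∘ₗ (A.X.coact.ext A.X.coact).ρ

/-- The Galois map `A ⊗_B A → A ⊗ H`, `a ⊗ b ↦ a₀ b₀ ⊗ b₄ ω⁻¹(a₁, b₁ β(b₂), S(b₃))`. -/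
def galoisMap : BTensor (rightB A) (leftB A) →ₗ[k] A.X ⊗[k] H :=
  (balRel (rightB A) (leftB A)).liftQ (galoisFun A) <| by
    refine Submodule.span_le.2 ?_
    rintro _ ⟨b, a, c, rfl⟩
    have h : ∀ (x : A.X ⊗[k] H) (y : A.X ⊗[k] H),
        TensorProduct.map (mulLin A) (gammaMap k H)
          (TensorProduct.tensorTensorTensorComm k A.X H A.X H ((mulR b).lin.rTensor H x ⊗ₜ y)) =
        TensorProduct.map (mulLin A) (gammaMap k H)
          (TensorProduct.tensorTensorTensorComm k A.X H A.X H (x ⊗ₜ (mulL b).lin.rTensor H y)) := by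
      intro x y
      induction x with
      | zero => simp only [map_zero, zero_tmul]
      | add x x' hx hx' => simp only [map_add, add_tmul, hx, hx']
      | tmul a g =>
        induction y with
        | zero => simp only [map_zero, tmul_zero]
        | add x x' hx hx' => simp only [map_add, tmul_add, hx, hx']
        | tmul c h =>
          have e := mulLin_assoc (a ⊗ₜ CoinvAlg.val A b ⊗ₜ c)
          rw [as_mid a b.val_mem, LinearMap.rTensor_tmul, LinearMap.lTensor_tmul] at e
          simp only [LinearMap.rTensor_tmul, TensorProduct.tensorTensorTensorComm_tmul,
            TensorProduct.map_tmul, mulR_lin, mulL_lin, e]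
    have h2 := h (A.X.coact.ρ a) (A.X.coact.ρ c)
    rw [← (mulR b).colinear, ← (mulL b).colinear, mulR_lin, mulL_lin] at h2
    rw [SetLike.mem_coe, LinearMap.mem_ker, map_sub, sub_eq_zero]
    exact h2

/-- `A` is Galois over its coinvariants. -/
def IsGaloisExt : Prop := Function.Bijective (galoisMap A)

end Galois

section Takeuchi
variable {k B L : Type u} [Field k] [Ring B] [Algebra k B] [Ring L] [Algebra k L]

/-- The left action `y ↦ s(b) y`. -/
def srcAct (s : B →ₐ[k] L) (b : B) : Module.End k L := LinearMap.mulLeft k (s b)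

/-- The right action `x ↦ t(b) x`. -/
def tgtAct (t : Bᵐᵒᵖ →ₐ[k] L) (b : B) : Module.End k L := LinearMap.mulLeft k (t (MulOpposite.op b))

/-- The relations defining `L ⊗_B L ⊗_B L`. -/
def tripleRel (s : B →ₐ[k] L) (t : Bᵐᵒᵖ →ₐ[k] L) : Submodule k (L ⊗[k] (L ⊗[k] L)) :=
  Submodule.span k
    ({x | ∃ b u v w, x = tgtAct t b u ⊗ₜ (v ⊗ₜ w) - u ⊗ₜ (srcAct s b v ⊗ₜ w)} ∪
      {x | ∃ b u v w, x = u ⊗ₜ (tgtAct t b v ⊗ₜ w) - u ⊗ₜ (v ⊗ₜ srcAct s b w)})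

/-- A `×_B`-bialgebra structure on an algebra `L` over `B ⊗ Bᵒᵖ`, given by algebra maps
`s : B → L` and `t : Bᵒᵖ → L`. Here `L ⊗_B L` is the quotient of `L ⊗ L` by the relations
`t(b) x ⊗ y = x ⊗ s(b) y`; conditions on `Δ(x)` are stated for representatives `z` of `Δ(x)`. -/
structure TakeuchiBialgebra (s : B →ₐ[k] L) (t : Bᵐᵒᵖ →ₐ[k] L) where
  comul : L →ₗ[k] BTensor (tgtAct t) (srcAct s)
  counit : L →ₐ[k] Module.End k B
  comul_src : ∀ b, comul (s b) = (balRel _ _).mkQ (s b ⊗ₜ 1)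
  comul_tgt : ∀ b, comul (t b) = (balRel _ _).mkQ (1 ⊗ₜ t b)
  /-- `x₁ t(b) ⊗ x₂ = x₁ ⊗ x₂ s(b)` -/
  takeuchi : ∀ x z, (balRel (tgtAct t) (srcAct s)).mkQ z = comul x → ∀ b : B,
    (balRel (tgtAct t) (srcAct s)).mkQ (z * (t (MulOpposite.op b) ⊗ₜ 1)) =
      (balRel (tgtAct t) (srcAct s)).mkQ (z * (1 ⊗ₜ s b))
  comul_mul : ∀ x y z w, (balRel (tgtAct t) (srcAct s)).mkQ z = comul x →
    (balRel (tgtAct t) (srcAct s)).mkQ w = comul y →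
    comul (x * y) = (balRel (tgtAct t) (srcAct s)).mkQ (z * w)
  coassoc : ∀ x z w₁ w₂, (balRel (tgtAct t) (srcAct s)).mkQ z = comul x →
    (balRel (tgtAct t) (srcAct s)).mkQ.rTensor L w₁ = comul.rTensor L z →
    (balRel (tgtAct t) (srcAct s)).mkQ.lTensor L w₂ = comul.lTensor L z →
    TensorProduct.assoc k L L L w₁ - w₂ ∈ tripleRel s t
  counit_src : ∀ b c, counit (s b) c = b * c
  counit_tgt : ∀ b c, counit (t b) c = c * b.unop
  /-- `s(ε(x₁)(1)) x₂ = x` -/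
  counit_comul : ∀ x z, (balRel (tgtAct t) (srcAct s)).mkQ z = comul x →
    LinearMap.mul' k L (TensorProduct.map
      (s.toLinearMap ∘ₗ counit.toLinearMap.flip 1) LinearMap.id z) = x
  /-- `t(ε(x₂)(1)) x₁ = x` -/
  comul_counit : ∀ x z, (balRel (tgtAct t) (srcAct s)).mkQ z = comul x →
    LinearMap.mul' k L (TensorProduct.map
      (t.toLinearMap ∘ₗ (MulOpposite.opLinearEquiv k).toLinearMap ∘ₗ counit.toLinearMap.flip 1)
      LinearMap.id (TensorProduct.comm k L L z)) = x

/-- The action `x ⊗ y ↦ x n ⊗ y n'` of `L ⊗ L` on an element `n ⊗ n'`. -/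
def diagAct (N N' : ModuleCat.{u} L) (n : N) (n' : N') :
    L ⊗[k] L →ₗ[k] ((ModuleCat.restrictScalars (algebraMap k L)).obj N) ⊗[k]
      ((ModuleCat.restrictScalars (algebraMap k L)).obj N') :=
  TensorProduct.map ((smulHom N).toLinearMap.flip n) ((smulHom N').toLinearMap.flip n')

end Takeuchi

section
open CategoryTheory.Limits
variable {C : Type*} [Category C] [MonoidalCategory C] [HasCoequalizers C]
  [∀ X : C, PreservesColimitsOfSize.{0, 0} (tensorLeft X)]
  [∀ X : C, PreservesColimitsOfSize.{0, 0} (tensorRight X)]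

/-- The canonical projection `M ⊗ N ⟶ M ⊗_A N`. -/
def tensorProj {A : Mon C} (M N : Bimod A A) : M.X ⊗ N.X ⟶ (M ⊗ N).X :=
  coequalizer.π (M.actRight ▷ N.X) ((α_ M.X A.X N.X).hom ≫ M.X ◁ N.actLeft)

end

section Forget
variable {k B L : Type u} [Field k] [Ring B] [Algebra k B] [Ring L] [Algebra k L]
  {s : B →ₐ[k] L} {t : Bᵐᵒᵖ →ₐ[k] L} (h : ∀ b c, Commute (s b) (t c))
  [MonoidalCategory (ModuleCat.{u} L)] [(forgetBimod s t h).LaxMonoidal]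

/-- The monoidal constraint `N ⊗ N' → N ⊗_B N' → U(N ⊗ N')` of the forgetful functor. -/
def forgetMu (N N' : ModuleCat.{u} L) :
    ((ModuleCat.restrictScalars (algebraMap k L)).obj N) ⊗[k]
      ((ModuleCat.restrictScalars (algebraMap k L)).obj N') →ₗ[k]
      (ModuleCat.restrictScalars (algebraMap k L)).obj (N ⊗ N') :=
  ModuleCat.Hom.hom (tensorProj ((forgetBimod s t h).obj N) ((forgetBimod s t h).obj N') ≫
    (Functor.LaxMonoidal.μ (forgetBimod s t h) N N').hom)

/-- The unit constraint `B → U(1)` of the forgetful functor. -/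
def forgetEps : B →ₗ[k] (ModuleCat.restrictScalars (algebraMap k L)).obj (𝟙_ (ModuleCat.{u} L)) :=
  ModuleCat.Hom.hom (Functor.LaxMonoidal.ε (forgetBimod s t h)).hom

end Forget
end

/-! The heart is a structure theorem for relative Hopf modules: for a right A-module M in the
category of comodules, multiplication M^{co H} ⊗_B A → M is bijective (`RMod.coinvAct_surjective`,
`RMod.ker_coinvAct`). Let H carry the coaction h ↦ h₂ ⊗ S(h₁). The axioms on β and ω make δ : m ↦ m₀
⊗ β(m₁)m₂ an injection of M into the coinvariants of M ⊗ H (`deltaFun_mem`, `deltaFun_injective`).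
Composing δ for A with the action gives can : M ⊗ A → M ⊗ H, natural in M and colinear once the
factor A is given the trivial coaction. For M = A it is the Galois map (`can_self_lin`), for M = V ⊗
A it is V ⊗ Galois map up to reassociators, and a general M is a split coequalizer of such free
modules in comodules; so can is onto and induces M ⊗_B A ≅ M ⊗ H (`RMod.canLin_surjective`,
`RMod.ker_canLin`). On coinvariant m one has can(m ⊗ a) = δ(ma). Flatness says that M^{co H} ⊗_B A
sits inside M ⊗_B A as the kernel of ρ(m) - m ⊗ 1 tensored with A, which contains every element
whose image under can is coinvariant, in particular the preimages of δ(M). Injectivity of δ then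
gives the theorem.

Faithful flatness adds a criterion: a map N → M^{co H} is bijective as soon as N ⊗_B A → M is
(`RMod.bijective_of_coinvAct`).

Applied to the free bimodule A ⊗ A the theorem reads L ⊗_B A ≅ A ⊗ A. Since (lc)m = (lm)c for l in
L, c in A and m coinvariant, the left action of A on M = M^{co H} ⊗_B A is determined by the
L-module M^{co H}. This gives full faithfulness of G, and it equips N ⊗_B A with a bimodule
structure for every L-module N, which gives essential surjectivity (`coinvFunctor_isEquivalence`).

The canonical constraint M^{co H} ⊗_B N^{co H} → (M ○_A N)^{co H} is bijective by the criterion,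
because after tensoring with A it becomes M^{co H} ⊗_B N → M ○_A N (`coinvMu_bijective`). Its
coherence is checked on coinvariants, where the reassociator is trivial. So U ∘ G is strong
monoidal, and transport along the equivalence G makes the category of L-modules, G and U monoidal
(`exists_monoidal_of_comp`).

Finally, a monoidal structure on L-modules with strong monoidal U gives a ×_B-bialgebra: Δ(x) is x ·
(1 ⊗ 1) in L ⊗_B L, and ε is the action on the unit object. Naturality along the maps L → N, x ↦ xn,
shows that Δ describes the action on all tensor products, and the coalgebra axioms express the
L-linearity of the associator and the unitors (`takeuchiOfMonoidal`). -/

noncomputable section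

/-! ### Balanced tensor products and faithful flatness -/

section LinearAlgebra
variable {k B : Type u} [Field k] [Ring B] [Algebra k B]

lemma exists_factor {V W X : Type*} [AddCommGroup V] [Module k V] [AddCommGroup W] [Module k W]
    [AddCommGroup X] [Module k X] (p : V →ₗ[k] W) (hp : Function.Surjective p) (f : V →ₗ[k] X)
    (h : LinearMap.ker p ≤ LinearMap.ker f) : ∃ g : W →ₗ[k] X, ∀ v, g (p v) = f v :=
  ⟨(LinearMap.ker p).liftQ f h ∘ₗ (p.quotKerEquivOfSurjective hp).symm.toLinearMap, fun v => by
    rw [LinearMap.comp_apply, LinearEquiv.coe_coe, ← p.quotKerEquivOfSurjective_apply_mk hp,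
      LinearEquiv.symm_apply_apply, Submodule.liftQ_apply]⟩

section
variable {B : Type*} {N M N' M' : Type*} [AddCommGroup N] [Module k N]
  [AddCommGroup M] [Module k M] [AddCommGroup N'] [Module k N'] [AddCommGroup M'] [Module k M']

lemma balRel_le_iff {r : B → Module.End k N} {l : B → Module.End k M} {K : Submodule k (N ⊗[k] M)} :
    balRel r l ≤ K ↔ ∀ b n m, r b n ⊗ₜ m - n ⊗ₜ l b m ∈ K := by
  rw [balRel, Submodule.span_le]
  exact ⟨fun h b n m => h ⟨b, n, m, rfl⟩, by rintro h _ ⟨b, n, m, rfl⟩; exact h b n m⟩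

lemma balRel_le_ker_iff {r : B → Module.End k N} {l : B → Module.End k M} {X : Type*}
    [AddCommGroup X] [Module k X] {f : N ⊗[k] M →ₗ[k] X} :
    balRel r l ≤ LinearMap.ker f ↔ ∀ b n m, f (r b n ⊗ₜ m) = f (n ⊗ₜ l b m) := by
  rw [balRel_le_iff]
  simp only [LinearMap.mem_ker, map_sub, sub_eq_zero]

lemma sub_mem_balRel {r : B → Module.End k N} {l : B → Module.End k M} (b : B) (n : N) (m : M) :
    r b n ⊗ₜ m - n ⊗ₜ l b m ∈ balRel r l :=
  Submodule.subset_span ⟨b, n, m, rfl⟩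

lemma map_mem_balRel {r : B → Module.End k N} {l : B → Module.End k M}
    {r' : B → Module.End k N'} {l' : B → Module.End k M'} {f : N →ₗ[k] N'} {g : M →ₗ[k] M'}
    (hf : ∀ b n, f (r b n) = r' b (f n)) (hg : ∀ b m, g (l b m) = l' b (g m)) {x : N ⊗[k] M}
    (hx : x ∈ balRel r l) : TensorProduct.map f g x ∈ balRel r' l' := by
  have : balRel r l ≤ (balRel r' l').comap (TensorProduct.map f g) := by
    rw [balRel_le_iff]
    intro b n m
    rw [Submodule.mem_comap, map_sub, TensorProduct.map_tmul, TensorProduct.map_tmul, hf, hg]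
    exact sub_mem_balRel b _ _
  exact this hx

lemma rTensor_mem_balRel {r : B → Module.End k N} {l : B → Module.End k M}
    {r' : B → Module.End k N'} (f : N →ₗ[k] N') (hf : ∀ b n, f (r b n) = r' b (f n))
    {x : N ⊗[k] M} (hx : x ∈ balRel r l) : f.rTensor M x ∈ balRel r' l := by
  have : balRel r l ≤ (balRel r' l).comap (f.rTensor M) := by
    rw [balRel_le_iff]
    intro b n m
    rw [Submodule.mem_comap, map_sub, LinearMap.rTensor_tmul, LinearMap.rTensor_tmul, hf]
    exact sub_mem_balRel b _ _
  exact this hx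

end

variable {A : Type u} [AddCommGroup A] [Module k A] {l : B →ₐ[k] Module.End k A}
  {N₁ N₂ N₃ : Type u} [AddCommGroup N₁] [AddCommGroup N₂] [AddCommGroup N₃]
  [Module k N₁] [Module k N₂] [Module k N₃]

/-- Faithful flatness in terms of balanced relations. -/
lemma IsLeftFaithfullyFlat.exact_iff (hff : IsLeftFaithfullyFlat l)
    (r₁ : Bᵐᵒᵖ →ₐ[k] Module.End k N₁) (r₂ : Bᵐᵒᵖ →ₐ[k] Module.End k N₂)
    (r₃ : Bᵐᵒᵖ →ₐ[k] Module.End k N₃) (f : N₁ →ₗ[k] N₂) (g : N₂ →ₗ[k] N₃)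
    (hf : ∀ b n, f (r₁ b n) = r₂ b (f n)) (hg : ∀ b n, g (r₂ b n) = r₃ b (g n)) :
    Function.Exact f g ↔ ∀ y : N₂ ⊗[k] A,
      g.rTensor A y ∈ balRel (fun b => r₃ (.op b)) l ↔
        ∃ x : N₁ ⊗[k] A, y - f.rTensor A x ∈ balRel (fun b => r₂ (.op b)) l := by
  -- Faithful flatness is phrased with module instances, so the three actions given as algebra maps
  -- are turned into instances.
  let m₁ : Module Bᵐᵒᵖ N₁ := Module.compHom N₁ r₁.toRingHom
  let m₂ : Module Bᵐᵒᵖ N₂ := Module.compHom N₂ r₂.toRingHom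
  let m₃ : Module Bᵐᵒᵖ N₃ := Module.compHom N₃ r₃.toRingHom
  have : IsScalarTower k Bᵐᵒᵖ N₁ := ⟨fun c b n => by
    change r₁ (c • b) n = c • r₁ b n
    rw [map_smul]; rfl⟩
  have : IsScalarTower k Bᵐᵒᵖ N₂ := ⟨fun c b n => by
    change r₂ (c • b) n = c • r₂ b n
    rw [map_smul]; rfl⟩
  have : IsScalarTower k Bᵐᵒᵖ N₃ := ⟨fun c b n => by
    change r₃ (c • b) n = c • r₃ b n
    rw [map_smul]; rfl⟩
  let f' : N₁ →ₗ[Bᵐᵒᵖ] N₂ := { toFun := f, map_add' := map_add f, map_smul' := hf }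
  let g' : N₂ →ₗ[Bᵐᵒᵖ] N₃ := { toFun := g, map_add' := map_add g, map_smul' := hg }
  have h := hff N₁ N₂ N₃ f' g'
  have ef : f'.restrictScalars k = f := rfl
  have eg : g'.restrictScalars k = g := rfl
  refine h.trans ⟨fun e y => ?_, fun e y => ?_⟩
  -- Membership in a balanced relation is vanishing in the quotient, so both conditions are the same
  -- statement about representatives.
  · have e1 := e ((balRel _ _).mkQ y)
    have e2 : _ ↔ _ := Submodule.Quotient.mk_eq_zero (balRel (fun b => r₃ (.op b)) l)
      (x := g.rTensor A y)
    refine e2.symm.trans (e1.trans ⟨?_, ?_⟩)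
    · rintro ⟨x, hx⟩
      obtain ⟨x, rfl⟩ := Submodule.Quotient.mk_surjective _ x
      exact ⟨x, (Submodule.Quotient.eq _).1 hx.symm⟩
    · rintro ⟨x, hx⟩
      exact ⟨(balRel _ _).mkQ x, ((Submodule.Quotient.eq _).2 hx).symm⟩
  · obtain ⟨y, rfl⟩ := Submodule.Quotient.mk_surjective _ y
    have e1 := e y
    have e2 : _ ↔ _ := Submodule.Quotient.mk_eq_zero (balRel (fun b => r₃ (.op b)) l)
      (x := g.rTensor A y)
    refine e2.trans (e1.trans ⟨?_, ?_⟩)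
    · rintro ⟨x, hx⟩
      exact ⟨(balRel _ _).mkQ x, ((Submodule.Quotient.eq _).2 hx).symm⟩
    · rintro ⟨x, hx⟩
      obtain ⟨x, rfl⟩ := Submodule.Quotient.mk_surjective _ x
      exact ⟨x, (Submodule.Quotient.eq _).1 hx.symm⟩

/-- The zero module. -/
def zeroAct (k B : Type u) [Field k] [Ring B] [Algebra k B] :
    Bᵐᵒᵖ →ₐ[k] Module.End k PUnit.{u + 1} :=
  AlgHom.ofLinearMap 0 (Subsingleton.elim _ _) (fun _ _ => Subsingleton.elim _ _)

lemma exact_zero_left_iff {f : N₁ →ₗ[k] N₂} :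
    Function.Exact (0 : PUnit.{u + 1} →ₗ[k] N₁) f ↔ Function.Injective f := by
  rw [← LinearMap.ker_eq_bot, LinearMap.ker_eq_bot']
  constructor
  · intro h m hm
    obtain ⟨x, hx⟩ := (h m).1 hm
    exact hx.symm
  · exact fun h m => ⟨fun hm => ⟨0, (h m hm).symm⟩, by rintro ⟨x, rfl⟩; exact map_zero f⟩

/-- Faithful flatness applied to 0 → N₁ → N₂. -/
lemma IsLeftFaithfullyFlat.injective_iff (hff : IsLeftFaithfullyFlat l)
    (r₁ : Bᵐᵒᵖ →ₐ[k] Module.End k N₁) (r₂ : Bᵐᵒᵖ →ₐ[k] Module.End k N₂)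
    (f : N₁ →ₗ[k] N₂) (hf : ∀ b n, f (r₁ b n) = r₂ b (f n)) :
    Function.Injective f ↔ ∀ y : N₁ ⊗[k] A,
      f.rTensor A y ∈ balRel (fun b => r₂ (.op b)) l → y ∈ balRel (fun b => r₁ (.op b)) l := by
  have h := hff.exact_iff (zeroAct k B) r₁ r₂ 0 f (fun b _ => (map_zero (r₁ b)).symm) hf
  refine exact_zero_left_iff.symm.trans (h.trans (forall_congr' fun y => ?_))
  have e : ∀ x : PUnit.{u + 1} ⊗[k] A, (0 : PUnit.{u + 1} →ₗ[k] N₁).rTensor A x = 0 := fun x => by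
    rw [LinearMap.rTensor_zero]; rfl
  refine ⟨fun h hy => ?_, fun h => ⟨fun hy => ⟨0, ?_⟩, ?_⟩⟩
  · obtain ⟨x, hx⟩ := h.1 hy
    rwa [e, sub_zero] at hx
  · rw [e, sub_zero]; exact h hy
  · rintro ⟨x, hx⟩
    rw [e, sub_zero] at hx
    exact rTensor_mem_balRel f (fun b => hf (.op b)) hx

/-- Faithful flatness applied to N₁ → N₂ → 0. -/
lemma IsLeftFaithfullyFlat.surjective_iff (hff : IsLeftFaithfullyFlat l)
    (r₁ : Bᵐᵒᵖ →ₐ[k] Module.End k N₁) (r₂ : Bᵐᵒᵖ →ₐ[k] Module.End k N₂)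
    (f : N₁ →ₗ[k] N₂) (hf : ∀ b n, f (r₁ b n) = r₂ b (f n)) :
    Function.Surjective f ↔ ∀ y : N₂ ⊗[k] A,
      ∃ x : N₁ ⊗[k] A, y - f.rTensor A x ∈ balRel (fun b => r₂ (.op b)) l := by
  have h := hff.exact_iff r₁ r₂ (zeroAct k B) f 0 hf (fun b n => Subsingleton.elim _ _)
  have h2 : Function.Exact f (0 : N₂ →ₗ[k] PUnit.{u + 1}) ↔ Function.Surjective f :=
    ⟨fun h y => (h y).1 rfl, fun h y => ⟨fun _ => h y, fun _ => rfl⟩⟩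
  rw [← h2, h]
  refine forall_congr' fun y => ?_
  rw [LinearMap.rTensor_zero]
  simp

end LinearAlgebra
end

/-! ### The antipode and the coinvariant map δ -/

noncomputable section

open Comod MonObj

section Antipode
variable {k H : Type u} [Field k] [AddCommGroup H] [Module k H] [Coalgebra k H]

/-- A coalgebra as a comodule over itself. -/
def selfCoaction (k H : Type u) [Field k] [AddCommGroup H] [Module k H] [Coalgebra k H] :
    Coaction k H H where
  ρ := Coalgebra.comul
  coassoc := Coalgebra.coassoc_apply
  counit h := by simp

/-- Both sides are h₁ ⊗ φ(h₂) f(h₃); this is coassociativity, read off from H as a comodule over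
itself. -/
lemma lTensor_convL_comul {V : Type*} [AddCommGroup V] [Module k V] (φ : H →ₗ[k] k)
    (f : H →ₗ[k] V) (h : H) :
    (convL φ f).lTensor H (Coalgebra.comul (R := k) h) =
      TensorProduct.map (convR LinearMap.id φ) f (Coalgebra.comul (R := k) h) :=
  ((selfCoaction k H).map_act_ρ φ f h).symm

variable [CoquasiHopfAlgebra k H]

open CoquasiHopfAlgebra CoquasiBialgebra

/-- The coalgebra `H` with the coaction `h ↦ h₂ ⊗ S(h₁)`. -/
def antipodeCoaction (k H : Type u) [Field k] [AddCommGroup H] [Module k H] [Coalgebra k H]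
    [CoquasiHopfAlgebra k H] : Coaction k H H where
  ρ := S.lTensor H ∘ₗ (TensorProduct.comm k H H).toLinearMap ∘ₗ Coalgebra.comul
  coassoc h := by
    -- Both sides of the axiom are F applied to one of the two iterated comultiplications of h, so
    -- the axiom reduces to coassociativity of H; that S reverses the comultiplication enters only
    -- in `h2`.
    let F : H ⊗[k] (H ⊗[k] H) →ₗ[k] H ⊗[k] (H ⊗[k] H) :=
      (TensorProduct.map S S).lTensor H ∘ₗ
        (TensorProduct.assoc k H H H).toLinearMap ∘ₗ
        ((TensorProduct.comm k H H).toLinearMap).rTensor H ∘ₗ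
        (TensorProduct.assoc k H H H).symm.toLinearMap ∘ₗ
        (TensorProduct.comm k H H).toLinearMap.lTensor H ∘ₗ
        (TensorProduct.assoc k H H H).toLinearMap ∘ₗ
        ((TensorProduct.comm k H H).toLinearMap).rTensor H ∘ₗ
        (TensorProduct.assoc k H H H).symm.toLinearMap
    have hF : ∀ a b c : H, F (a ⊗ₜ (b ⊗ₜ c)) = c ⊗ₜ (S (k := k) b ⊗ₜ S (k := k) a) := fun a b c => by
      simp [F]
    have h1 : ∀ x : H ⊗[k] H, TensorProduct.assoc k H H H
        ((S.lTensor H ∘ₗ (TensorProduct.comm k H H).toLinearMap ∘ₗ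
          Coalgebra.comul (R := k)).rTensor H
          (S.lTensor H (TensorProduct.comm k H H x))) =
        F ((Coalgebra.comul (R := k)).lTensor H x) := by
      intro x
      induction x with
      | zero => simp
      | add a b ha hb => simp only [map_add, ha, hb]
      | tmul a b =>
        simp only [TensorProduct.comm_tmul, LinearMap.lTensor_tmul, LinearMap.rTensor_tmul,
          LinearMap.comp_apply, LinearEquiv.coe_coe]
        generalize Coalgebra.comul (R := k) b = y
        induction y with
        | zero => simp
        | add a b ha hb => simp only [map_add, ha, hb, add_tmul, tmul_add]
        | tmul c d => rw [hF]; simp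
    have h2 : ∀ x : H ⊗[k] H, (Coalgebra.comul (R := k)).lTensor H
          (S.lTensor H (TensorProduct.comm k H H x)) =
        F (TensorProduct.assoc k H H H ((Coalgebra.comul (R := k)).rTensor H x)) := by
      intro x
      induction x with
      | zero => simp
      | add a b ha hb => simp only [map_add, ha, hb]
      | tmul a b =>
        have e : Coalgebra.comul (R := k) (S (k := k) a) = _ :=
          LinearMap.congr_fun (comul_S (k := k) (H := H)) a
        simp only [TensorProduct.comm_tmul, LinearMap.lTensor_tmul, LinearMap.rTensor_tmul, e,
          LinearMap.comp_apply, LinearEquiv.coe_coe]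
        generalize Coalgebra.comul (R := k) a = y
        induction y with
        | zero => simp
        | add a b ha hb => simp only [map_add, ha, hb, add_tmul, tmul_add]
        | tmul c d => rw [TensorProduct.assoc_tmul, hF]; simp
    rw [LinearMap.comp_apply, LinearMap.comp_apply, LinearEquiv.coe_coe, h1, h2,
      Coalgebra.coassoc_apply]
  counit h := by
    have h1 : ∀ x : H ⊗[k] H, TensorProduct.rid k H ((Coalgebra.counit (R := k)).lTensor H
        (S.lTensor H (TensorProduct.comm k H H x))) =
        TensorProduct.lid k H ((Coalgebra.counit (R := k)).rTensor H x) := by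
      intro x
      induction x with
      | zero => simp
      | add a b ha hb => simp only [map_add, ha, hb]
      | tmul a b =>
        have e : Coalgebra.counit (R := k) (S (k := k) a) = Coalgebra.counit (R := k) a :=
          LinearMap.congr_fun (counit_S (k := k) (H := H)) a
        simp [e]
    rw [LinearMap.comp_apply, LinearMap.comp_apply, LinearEquiv.coe_coe, h1]
    simp

/-- The comodule `H` with the coaction `h ↦ h₂ ⊗ S(h₁)`. -/
def antipodeComod (k H : Type u) [Field k] [AddCommGroup H] [Module k H] [Coalgebra k H]
    [CoquasiHopfAlgebra k H] : Comod k H := .of H (antipodeCoaction k H)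

/-- The map `h ↦ β(h₁) h₂`. -/
def betaMap (k H : Type u) [Field k] [AddCommGroup H] [Module k H] [Coalgebra k H]
    [CoquasiHopfAlgebra k H] : H →ₗ[k] H := convL β LinearMap.id

/-- The map `g ⊗ h ↦ h₂ ⊗ g S(h₁)`. -/
def mulAntipode (k H : Type u) [Field k] [AddCommGroup H] [Module k H] [Coalgebra k H]
    [CoquasiHopfAlgebra k H] : H ⊗[k] H →ₗ[k] H ⊗[k] H :=
  (TensorProduct.comm k H H).toLinearMap ∘ₗ
    ((mul (k := k)).toLinearMap ∘ₗ (S (k := k)).lTensor H).rTensor H ∘ₗ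
    (TensorProduct.assoc k H H H).symm.toLinearMap ∘ₗ Coalgebra.comul.lTensor H

/-- The left side is h₄ ⊗ h₁β(h₂)S(h₃), and `β_S` collapses the second factor to a multiple of 1. -/
lemma mulAntipode_beta (h : H) :
    mulAntipode k H ((betaMap k H).lTensor H (Coalgebra.comul (R := k) h)) =
      betaMap k H h ⊗ₜ unit (k := k) 1 := by
  rw [betaMap, lTensor_convL_comul]
  have h1 : ∀ x : H ⊗[k] H, mulAntipode k H (TensorProduct.map (convR LinearMap.id β)
      LinearMap.id x) = (TensorProduct.comm k H H).toLinearMap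
        ((mul.toLinearMap ∘ₗ TensorProduct.map (convR LinearMap.id β) S).rTensor H
        ((TensorProduct.assoc k H H H).symm ((Coalgebra.comul (R := k)).lTensor H x))) := by
    intro x
    induction x with
    | zero => simp
    | add a b ha hb => simp only [map_add, ha, hb]
    | tmul a b =>
      simp only [mulAntipode, LinearMap.comp_apply, TensorProduct.map_tmul, LinearMap.lTensor_tmul,
        LinearMap.id_apply, LinearEquiv.coe_coe]
      generalize Coalgebra.comul (R := k) b = y
      induction y with
      | zero => simp
      | add a b ha hb => simp only [map_add, ha, hb, tmul_add]
      | tmul c d => simp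
  rw [h1, ← Coalgebra.coassoc_apply, LinearEquiv.symm_apply_apply,
    ← LinearMap.comp_apply (LinearMap.rTensor _ _), ← LinearMap.rTensor_comp, LinearMap.comp_assoc, β_S]
  have h2 : ∀ x : H ⊗[k] H, (TensorProduct.comm k H H).toLinearMap
      ((β.smulRight (unit (k := k) (1 : k))).rTensor H x) =
      (TensorProduct.lid k H (TensorProduct.map β LinearMap.id x)) ⊗ₜ[k] unit (k := k) (1 : k) := by
    intro x
    induction x with
    | zero => simp
    | add a b ha hb => simp only [map_add, ha, hb, add_tmul]
    | tmul a b => simp [TensorProduct.smul_tmul]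
  rw [h2]; rfl

/-- The map `m ↦ m₀ ⊗ β(m₁) m₂`. -/
def deltaFun (X : Comod k H) : X →ₗ[k] X ⊗[k] H :=
  (betaMap k H).lTensor X ∘ₗ X.coact.ρ

/-- By coassociativity the coaction of δ(m) is m₀ ⊗ (`mulAntipode` of m₁ ⊗ β(m₂)m₃), so the claim
reduces to `mulAntipode_beta`. -/
lemma deltaFun_mem (X : Comod k H) (m : X) : deltaFun X m ∈ coinv (X ⊗ antipodeComod k H) := by
  refine mem_coinv.2 ?_
  have h1 : ∀ y : X ⊗[k] H, (X.coact.tensor (antipodeCoaction k H)).ρ ((betaMap k H).lTensor X y) =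
      (TensorProduct.assoc k X H H).symm ((mulAntipode k H ∘ₗ
        (betaMap k H).lTensor H).lTensor X
          (TensorProduct.assoc k X H H (X.coact.ρ.rTensor H y))) := by
    intro y
    induction y with
    | zero => simp
    | add a b ha hb => simp only [map_add, ha, hb]
    | tmul x h =>
      simp only [LinearMap.lTensor_tmul, LinearMap.rTensor_tmul]
      generalize betaMap k H = D
      change mul.toLinearMap.lTensor (X ⊗[k] H) (TensorProduct.tensorTensorTensorComm k X H H H
        (X.coact.ρ x ⊗ₜ (S.lTensor H (TensorProduct.comm k H H (Coalgebra.comul (R := k) (D h)))))) = _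
      generalize X.coact.ρ x = z
      induction z with
      | zero => simp
      | add a b ha hb => simp only [map_add, ha, hb, add_tmul]
      | tmul z g =>
        simp only [TensorProduct.assoc_tmul, LinearMap.lTensor_tmul, LinearMap.comp_apply,
          mulAntipode, LinearEquiv.coe_coe]
        generalize Coalgebra.comul (R := k) (D h) = y
        induction y with
        | zero => simp
        | add a b ha hb => simp only [map_add, ha, hb, tmul_add]
        | tmul c d => simp
  have h2 : ∀ y : X ⊗[k] H, (TensorProduct.assoc k X H H).symm ((mulAntipode k H ∘ₗ
        (betaMap k H).lTensor H).lTensor X ((Coalgebra.comul (R := k)).lTensor X y)) =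
      ((betaMap k H).lTensor X y) ⊗ₜ unit (k := k) 1 := by
    intro y
    induction y with
    | zero => simp
    | add a b ha hb => simp only [map_add, ha, hb, add_tmul]
    | tmul x h =>
      simp only [LinearMap.lTensor_tmul, LinearMap.comp_apply, mulAntipode_beta]
      simp
  refine (h1 _).trans ?_
  rw [X.coact.coassoc, h2]
  rfl

/-- A retraction is m ⊗ h ↦ m₀ ω(m₁, S(h₁), α(h₂)h₃): applied to δ(m) it gives m₀ ω(m₁β(m₂), S(m₃),
α(m₄)m₅), which is m by `ω_S`. -/
lemma deltaFun_injective (X : Comod k H) : Function.Injective (deltaFun X) := by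
  -- The functional g ⊗ h ↦ ω(g, S(h₁), α(h₂)h₃).
  let Ω : H ⊗[k] H →ₗ[k] k := ω ∘ₗ (TensorProduct.assoc k H H H).symm.toLinearMap ∘ₗ
    (TensorProduct.map S (convL α LinearMap.id) ∘ₗ Coalgebra.comul).lTensor H
  have hΩ : ∀ h, Ω ((betaMap k H).lTensor H (Coalgebra.comul (R := k) h)) =
      Coalgebra.counit (R := k) h := by
    intro h
    have h1 : ∀ x : H ⊗[k] H, Ω (TensorProduct.map (convR LinearMap.id β) LinearMap.id x) =
        ω (TensorProduct.map (TensorProduct.map (convR LinearMap.id β) S) (convL α LinearMap.id)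
          ((TensorProduct.assoc k H H H).symm ((Coalgebra.comul (R := k)).lTensor H x))) := by
      intro x
      induction x with
      | zero => simp
      | add a b ha hb => simp only [map_add, ha, hb]
      | tmul a b =>
        simp only [Ω, LinearMap.comp_apply, TensorProduct.map_tmul, LinearMap.lTensor_tmul,
          LinearMap.id_apply, LinearEquiv.coe_coe]
        generalize Coalgebra.comul (R := k) b = y
        induction y with
        | zero => simp
        | add a b ha hb => simp only [map_add, ha, hb, tmul_add]
        | tmul c d => simp
    have h2 := LinearMap.congr_fun (ω_S (k := k) (H := H)) h
    rw [betaMap, lTensor_convL_comul, h1, ← Coalgebra.coassoc_apply, LinearEquiv.symm_apply_apply, ← h2]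
    simp only [LinearMap.comp_apply]
    generalize Coalgebra.comul (R := k) h = y
    induction y with
    | zero => simp
    | add a b ha hb => simp only [map_add, ha, hb]
    | tmul c d => simp
  let Φ : X ⊗[k] H →ₗ[k] X := (TensorProduct.rid k X).toLinearMap ∘ₗ Ω.lTensor X ∘ₗ
    (TensorProduct.assoc k X H H).toLinearMap ∘ₗ X.coact.ρ.rTensor H
  refine Function.LeftInverse.injective (g := Φ) fun m => ?_
  have h3 : ∀ y : X ⊗[k] H, Φ ((betaMap k H).lTensor X y) =
      TensorProduct.rid k X ((Ω ∘ₗ (betaMap k H).lTensor H).lTensor X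
        (TensorProduct.assoc k X H H (X.coact.ρ.rTensor H y))) := by
    intro y
    induction y with
    | zero => simp
    | add a b ha hb => simp only [map_add, ha, hb]
    | tmul x h =>
      simp only [Φ, LinearMap.lTensor_tmul, LinearMap.rTensor_tmul, LinearMap.comp_apply,
        LinearEquiv.coe_coe]
      generalize X.coact.ρ x = z
      induction z with
      | zero => simp
      | add a b ha hb => simp only [map_add, ha, hb, add_tmul]
      | tmul c d => simp
  refine (h3 _).trans ?_
  rw [X.coact.coassoc, ← LinearMap.comp_apply, ← LinearMap.lTensor_comp]
  have e : (Ω ∘ₗ (betaMap k H).lTensor H) ∘ₗ Coalgebra.comul = Coalgebra.counit :=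
    LinearMap.ext hΩ
  rw [e]
  exact X.coact.counit m

end Antipode
end

/-! ### Right modules in comodules and their canonical maps -/

noncomputable section

open Comod MonObj

section
variable {C : Type*} [Category C] [MonoidalCategory C]

/-- Right modules over an algebra in a monoidal category. -/
structure RMod (A : Mon C) where
  X : C
  act : X ⊗ A.X ⟶ X
  act_one : X ◁ η ≫ act = (ρ_ X).hom
  assoc : X ◁ μ ≫ act = (α_ X A.X A.X).inv ≫ act ▷ A.X ≫ act

/-- Naturality of the canonical map in the module, isolated in a bare monoidal category; d plays the
role of δ. -/
lemma whiskerLeft_act_natural {X Y A T S : C} (d : T ⟶ A ⊗ S) (r : X ⊗ A ⟶ X) (r' : Y ⊗ A ⟶ Y)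
    (f : X ⟶ Y) (h : r ≫ f = f ▷ A ≫ r') :
    (X ◁ d ≫ (α_ X A S).inv ≫ r ▷ S) ≫ f ▷ S = f ▷ T ≫ Y ◁ d ≫ (α_ Y A S).inv ≫ r' ▷ S := by
  rw [Category.assoc, Category.assoc, ← comp_whiskerRight, h, ← whisker_exchange_assoc,
    comp_whiskerRight, associator_inv_naturality_left_assoc]

/-- Pure coherence: on a free module the canonical map only involves the factor A, up to
reassociators. -/
lemma whiskerLeft_act_free {V A T S : C} (d : T ⟶ A ⊗ S) (m : A ⊗ A ⟶ A) :
    (V ⊗ A) ◁ d ≫ (α_ (V ⊗ A) A S).inv ≫ ((α_ V A A).hom ≫ V ◁ m) ▷ S =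
      (α_ V A T).hom ≫ V ◁ (A ◁ d ≫ (α_ A A S).inv ≫ m ▷ S) ≫ (α_ V A S).inv := by
  simp

namespace RMod
variable {A : Mon C}

/-- Morphisms of right modules. -/
def IsLinear {M N : RMod A} (f : M.X ⟶ N.X) : Prop := M.act ≫ f = f ▷ A.X ≫ N.act

/-- The free right module `V ⊗ A`. -/
@[simps]
def free (A : Mon C) (V : C) : RMod A where
  X := V ⊗ A.X
  act := (α_ V A.X A.X).hom ≫ V ◁ μ
  act_one := by
    rw [associator_naturality_right_assoc, ← MonoidalCategory.whiskerLeft_comp, MonObj.mul_one,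
      rightUnitor_tensor_hom]
  assoc := by
    simp only [tensor_whiskerLeft, Category.assoc, Iso.inv_hom_id_assoc, comp_whiskerRight,
      associator_naturality_middle_assoc, ← MonoidalCategory.whiskerLeft_comp]
    rw [mul_assoc_flip]
    simp

lemma isLinear_act (M : RMod A) : IsLinear (M := free A M.X) (N := M) M.act := by
  change ((α_ M.X A.X A.X).hom ≫ M.X ◁ μ) ≫ M.act = _
  rw [Category.assoc, M.assoc, Iso.hom_inv_id_assoc]
  rfl

lemma isLinear_whiskerRight {V W : C} (f : V ⟶ W) :
    IsLinear (M := free A V) (N := free A W) (f ▷ A.X) := by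
  change ((α_ V A.X A.X).hom ≫ V ◁ μ) ≫ f ▷ A.X = (f ▷ A.X) ▷ A.X ≫ (α_ W A.X A.X).hom ≫ W ◁ μ
  rw [Category.assoc, whisker_exchange, associator_naturality_left_assoc]

/-- A bimodule as a right module. -/
@[simps]
def ofBimod (M : Bimod A A) : RMod A where
  X := M.X
  act := M.actRight
  act_one := M.actRight_one
  assoc := M.right_assoc

end RMod
end

section
variable {k H : Type u} [Field k] [AddCommGroup H] [Module k H] [Coalgebra k H]

section
variable [CoquasiBialgebra k H]

/-- The trivial coaction `v ↦ v ⊗ 1` on a vector space. -/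
def trivialCoaction (H : Type u) [AddCommGroup H] [Module k H] [Coalgebra k H]
    [CoquasiBialgebra k H] (V : Type u) [AddCommGroup V] [Module k V] : Coaction k H V where
  ρ := (TensorProduct.mk k V H).flip (CoquasiBialgebra.unit (k := k) 1)
  coassoc v := by
    have h := CoalgHomClass.map_comp_comul_apply (CoquasiBialgebra.unit (k := k) (H := H)) 1
    simp only [CommSemiring.comul_apply, TensorProduct.map_tmul] at h
    simp [← h]
  counit v := by
    have h := CoalgHomClass.counit_comp_apply (CoquasiBialgebra.unit (k := k) (H := H)) 1
    simp only [CommSemiring.counit_apply] at h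
    simp [h]

/-- A vector space as a comodule with the trivial coaction. -/
def trivialComod (H : Type u) [AddCommGroup H] [Module k H] [Coalgebra k H]
    [CoquasiBialgebra k H] (V : Type u) [AddCommGroup V] [Module k V] : Comod k H :=
  .of V (trivialCoaction H V)

lemma mem_coinv_trivialComod {V : Type u} [AddCommGroup V] [Module k V] (v : V) :
    v ∈ coinv (trivialComod (k := k) H V) :=
  mem_coinv.2 rfl

end

variable [CoquasiHopfAlgebra k H]

/-- The map `m ↦ m₀ ⊗ β(m₁) m₂` as a morphism of comodules. -/
def delta (X : Comod k H) : trivialComod H X ⟶ X ⊗ antipodeComod k H where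
  lin := deltaFun X
  colinear m := mem_coinv.1 (deltaFun_mem X m)

variable {A : Mon (Comod k H)}

/-- The canonical map `m ⊗ a ↦ m₀a₀ ⊗ a₄ ω⁻¹(m₁, a₁ β(a₂), S(a₃))`. -/
def can (M : RMod A) : M.X ⊗ trivialComod H A.X ⟶ M.X ⊗ antipodeComod k H :=
  M.X ◁ delta A.X ≫ (α_ _ _ _).inv ≫ M.act ▷ _

lemma can_natural {M N : RMod A} {f : M.X ⟶ N.X} (hf : RMod.IsLinear f) :
    can M ≫ f ▷ _ = f ▷ _ ≫ can N :=
  whiskerLeft_act_natural _ _ _ f hf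

/-- `A` as a right module. -/
@[simps]
def RMod.self (A : Mon (Comod k H)) : RMod A where
  X := A.X
  act := μ
  act_one := MonObj.mul_one _
  assoc := by rw [mul_assoc_flip]

lemma can_free (V : Comod k H) : can (RMod.free A V) =
    (α_ V A.X _).hom ≫ V ◁ can (RMod.self A) ≫ (α_ V A.X _).inv :=
  whiskerLeft_act_free _ _

lemma betaMap_sigma (h : H) :
    (CoquasiHopfAlgebra.S.rTensor H ∘ₗ Coalgebra.comul (R := k)).lTensor H
      ((betaMap k H).lTensor H (Coalgebra.comul (R := k) h)) = sigmaMap k H h := by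
  rw [betaMap, lTensor_convL_comul, sigmaMap, LinearMap.comp_apply]
  generalize Coalgebra.comul (R := k) h = x
  rw [LinearMap.lTensor, ← LinearMap.comp_apply, ← TensorProduct.map_comp, LinearMap.id_comp,
    LinearMap.comp_id]

/-- This is where the Galois hypothesis enters: the composite of δ, the inverse reassociator and the
multiplication unwinds to the explicit formula. The comodule H with h ↦ h₂ ⊗ S(h₁) produces the
argument S(b₃) of ω⁻¹. -/
lemma can_self_lin (A : Mon (Comod k H)) : (can (RMod.self A)).lin = galoisFun A := by
  suffices h : ∀ a b : A.X, (mulLin A).rTensor H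
      (Coaction.assocInvFun A.X.coact A.X.coact (antipodeCoaction k H)
        (a ⊗ₜ deltaFun A.X b)) = galoisFun A (a ⊗ₜ b) from TensorProduct.ext' h
  intro a b
  -- Z sends (a ⊗ g) ⊗ (b ⊗ (h' ⊗ h)) to ab ⊗ ω⁻¹(g, h', S(h₁)) h₂. Both sides become Z after the
  -- coaction of b has been iterated.
  let Z : (A.X ⊗[k] H) ⊗[k] (A.X ⊗[k] (H ⊗[k] H)) →ₗ[k] A.X ⊗[k] H :=
    (TensorProduct.map (mulLin A) ((TensorProduct.lid k H).toLinearMap ∘ₗ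
      CoquasiBialgebra.ωInv.rTensor H ∘ₗ
    (TensorProduct.assoc k (H ⊗[k] H) H H).symm.toLinearMap ∘ₗ
    (TensorProduct.assoc k H H (H ⊗[k] H)).symm.toLinearMap ∘ₗ
    ((CoquasiHopfAlgebra.S.rTensor H ∘ₗ Coalgebra.comul (R := k)).lTensor H).lTensor H)) ∘ₗ
      (TensorProduct.tensorTensorTensorComm k A.X H A.X (H ⊗[k] H)).toLinearMap
  have h1 : ∀ y : A.X ⊗[k] H, (mulLin A).rTensor H
      (Coaction.assocInvFun A.X.coact A.X.coact (antipodeCoaction k H)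
        (a ⊗ₜ (betaMap k H).lTensor A.X y)) =
      Z (A.X.coact.ρ a ⊗ₜ ((betaMap k H).lTensor H).lTensor A.X
        (TensorProduct.assoc k A.X H H (A.X.coact.ρ.rTensor H y))) := by
    intro y
    induction y with
    | zero => simp
    | add a b ha hb => simp only [map_add, tmul_add, ha, hb]
    | tmul b h =>
      simp only [LinearMap.lTensor_tmul, LinearMap.rTensor_tmul]
      generalize betaMap k H = D
      change (mulLin A).rTensor H (TensorProduct.rid k _ (CoquasiBialgebra.ωInv.lTensor _
        (TensorProduct.tensorTensorTensorComm k (A.X ⊗[k] A.X) (H ⊗[k] H) H H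
          ((TensorProduct.tensorTensorTensorComm k A.X H A.X H
            (A.X.coact.ρ a ⊗ₜ A.X.coact.ρ b)) ⊗ₜ
            (CoquasiHopfAlgebra.S.lTensor H
              (TensorProduct.comm k H H (Coalgebra.comul (R := k) (D h)))))))) = _
      generalize A.X.coact.ρ a = x
      generalize A.X.coact.ρ b = y
      induction x with
      | zero => simp
      | add a b ha hb => simp only [map_add, add_tmul, ha, hb]
      | tmul a g =>
        induction y with
        | zero => simp
        | add a b ha hb => simp only [map_add, add_tmul, tmul_add, ha, hb]
        | tmul b h' =>
          simp only [TensorProduct.assoc_tmul, LinearMap.lTensor_tmul, LinearMap.comp_apply, Z,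
            LinearEquiv.coe_coe, TensorProduct.tensorTensorTensorComm_tmul, TensorProduct.map_tmul]
          generalize Coalgebra.comul (R := k) (D h) = z
          induction z with
          | zero => simp
          | add a b ha hb => simp only [map_add, tmul_add, ha, hb]
          | tmul c d => simp
  refine (h1 _).trans ?_
  rw [A.X.coact.coassoc]
  change _ = TensorProduct.map (mulLin A) (gammaMap k H)
    (TensorProduct.tensorTensorTensorComm k A.X H A.X H (A.X.coact.ρ a ⊗ₜ A.X.coact.ρ b))
  generalize A.X.coact.ρ a = x
  generalize A.X.coact.ρ b = y
  induction x with
  | zero => simp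
  | add a b ha hb => simp only [map_add, add_tmul, ha, hb]
  | tmul a g =>
    induction y with
    | zero => simp
    | add a b ha hb => simp only [map_add, tmul_add, ha, hb]
    | tmul b h' =>
      simp only [LinearMap.lTensor_tmul, LinearMap.comp_apply, Z, gammaMap,
            LinearEquiv.coe_coe, TensorProduct.tensorTensorTensorComm_tmul, TensorProduct.map_tmul]
      -- Only here does the factor β have to move from h₁ ⊗ β(h₂)h₃ to h₁β(h₂) ⊗ h₃.
      rw [← betaMap_sigma]
end
end

/-! ### Surjectivity and kernel of the canonical map -/

noncomputable section

open Comod MonObj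

section
variable {k X Y Z T S : Type*} [Field k] [AddCommGroup X] [Module k X] [AddCommGroup Y] [Module k Y]
  [AddCommGroup Z] [Module k Z] [AddCommGroup T] [Module k T] [AddCommGroup S] [Module k S]

/-- Only the projection p has to commute with the two maps; the section i is merely linear. -/
lemma surjective_of_retract {p : Y →ₗ[k] X} {i : X →ₗ[k] Y} (hpi : ∀ x, p (i x) = x)
    {cX : X ⊗[k] T →ₗ[k] X ⊗[k] S} {cY : Y ⊗[k] T →ₗ[k] Y ⊗[k] S}
    (hp : ∀ y, p.rTensor S (cY y) = cX (p.rTensor T y)) (hY : Function.Surjective cY) :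
    Function.Surjective cX := by
  have e : p ∘ₗ i = LinearMap.id := LinearMap.ext hpi
  intro x
  obtain ⟨y, hy⟩ := hY (i.rTensor S x)
  refine ⟨p.rTensor T y, ?_⟩
  rw [← hp, hy, ← LinearMap.rTensor_comp_apply, e, LinearMap.rTensor_id,
    LinearMap.id_apply]

/-- The kernel of a natural map at the target of a split coequalizer. -/
lemma ker_eq_of_split {p : Y →ₗ[k] X} {i : X →ₗ[k] Y} {d₀ d₁ : Z →ₗ[k] Y} {j : Y →ₗ[k] Z}
    (hpi : ∀ x, p (i x) = x) (h₁ : ∀ y, d₁ (j y) = y) (h₀ : ∀ y, d₀ (j y) = i (p y))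
    (hpd : ∀ z, p (d₀ z) = p (d₁ z))
    {cX : X ⊗[k] T →ₗ[k] X ⊗[k] S} {cY : Y ⊗[k] T →ₗ[k] Y ⊗[k] S} {cZ : Z ⊗[k] T →ₗ[k] Z ⊗[k] S}
    (hp : ∀ y, p.rTensor S (cY y) = cX (p.rTensor T y))
    (hd₀ : ∀ z, d₀.rTensor S (cZ z) = cY (d₀.rTensor T z))
    (hd₁ : ∀ z, d₁.rTensor S (cZ z) = cY (d₁.rTensor T z))
    (hZ : Function.Surjective cZ) :
    LinearMap.ker cX = (LinearMap.ker cY).map (p.rTensor T) := by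
  have epi : p ∘ₗ i = LinearMap.id := LinearMap.ext hpi
  have e₁ : d₁ ∘ₗ j = LinearMap.id := LinearMap.ext h₁
  have e₀ : d₀ ∘ₗ j = i ∘ₗ p := LinearMap.ext h₀
  have epd : p ∘ₗ d₀ = p ∘ₗ d₁ := LinearMap.ext hpd
  ext x
  rw [Submodule.mem_map]
  constructor
  · intro hx
    rw [LinearMap.mem_ker] at hx
    -- Start from the lift i(x), whose image y under cY satisfies p(y) = 0. A preimage w of j(y)
    -- under cZ has d₁(w) - d₀(w) mapping to y - i(p(y)) = y, so subtracting this difference moves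
    -- i(x) into the kernel of cY; p does not see the correction.
    obtain ⟨w, hw⟩ := hZ (j.rTensor S (cY (i.rTensor T x)))
    refine ⟨i.rTensor T x - (d₁.rTensor T w - d₀.rTensor T w), ?_, ?_⟩
    · rw [LinearMap.mem_ker, map_sub, map_sub, ← hd₀, ← hd₁, hw,
        ← LinearMap.rTensor_comp_apply, e₁, LinearMap.rTensor_id, LinearMap.id_apply,
        ← LinearMap.rTensor_comp_apply, e₀, LinearMap.rTensor_comp_apply, hp,
        ← LinearMap.rTensor_comp_apply, epi, LinearMap.rTensor_id, LinearMap.id_apply, hx, map_zero, sub_zero, sub_self]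
    · rw [map_sub, map_sub, ← LinearMap.rTensor_comp_apply, epi,
        LinearMap.rTensor_id, LinearMap.id_apply, ← LinearMap.rTensor_comp_apply,
        ← LinearMap.rTensor_comp_apply, epd, sub_self, sub_zero]
  · rintro ⟨y, hy, rfl⟩
    rw [LinearMap.mem_ker] at hy ⊢
    rw [← hp, hy, map_zero]

end

section
variable {k H : Type u} [Field k] [AddCommGroup H] [Module k H] [Coalgebra k H]

namespace RMod
variable [CoquasiBialgebra k H] {A : Mon (Comod k H)} (M : RMod A)

/-- The action of a right module on elements. -/
def actLin : M.X ⊗[k] A.X →ₗ[k] M.X := M.act.lin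

lemma actLin_assoc (x : (M.X ⊗[k] A.X) ⊗[k] A.X) :
    M.actLin ((mulLin A).lTensor M.X (as M.X A.X A.X x)) = M.actLin (M.actLin.rTensor A.X x) := by
  have h : (α_ M.X A.X A.X).hom ≫ M.X ◁ μ ≫ M.act = M.act ▷ A.X ≫ M.act := by
    rw [M.assoc, Iso.hom_inv_id_assoc]
  exact LinearMap.congr_fun (congrArg Hom.lin h) x

lemma actLin_unitElt (m : M.X) : M.actLin (m ⊗ₜ unitElt A) = m :=
  (LinearMap.congr_fun (congrArg Hom.lin M.act_one) (m ⊗ₜ[k] (1 : k))).trans (one_smul k m)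

lemma actLin_coinv_left {m : M.X} (hm : m ∈ coinv M.X) (a b : A.X) :
    M.actLin (M.actLin (m ⊗ₜ a) ⊗ₜ b) = M.actLin (m ⊗ₜ mulLin A (a ⊗ₜ b)) := by
  have := M.actLin_assoc (m ⊗ₜ a ⊗ₜ b)
  rw [as_left hm, LinearMap.lTensor_tmul, LinearMap.rTensor_tmul] at this
  exact this.symm

lemma actLin_coinv_mid (m : M.X) {a : A.X} (ha : a ∈ coinv A.X) (b : A.X) :
    M.actLin (M.actLin (m ⊗ₜ a) ⊗ₜ b) = M.actLin (m ⊗ₜ mulLin A (a ⊗ₜ b)) := by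
  have := M.actLin_assoc (m ⊗ₜ a ⊗ₜ b)
  rw [as_mid _ ha, LinearMap.lTensor_tmul, LinearMap.rTensor_tmul] at this
  exact this.symm

lemma actLin_coinv_right (m : M.X) (a : A.X) {b : A.X} (hb : b ∈ coinv A.X) :
    M.actLin (M.actLin (m ⊗ₜ a) ⊗ₜ b) = M.actLin (m ⊗ₜ mulLin A (a ⊗ₜ b)) := by
  have := M.actLin_assoc (m ⊗ₜ a ⊗ₜ b)
  rw [as_right _ _ hb, LinearMap.lTensor_tmul, LinearMap.rTensor_tmul] at this
  exact this.symm

/-- The right action of the algebra of coinvariants on a right module. -/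
def rightCoinv : (CoinvAlg A)ᵐᵒᵖ →ₐ[k] Module.End k M.X :=
  AlgHom.ofLinearMap ((TensorProduct.curry M.actLin).flip ∘ₗ CoinvAlg.val A ∘ₗ
      (MulOpposite.opLinearEquiv k).symm.toLinearMap)
    (LinearMap.ext fun m => M.actLin_unitElt m) fun b c => LinearMap.ext fun m => by
      exact (M.actLin_coinv_mid m c.unop.val_mem _).symm

/-- Right multiplication by a coinvariant as a morphism of comodules. -/
def rightHom (b : (CoinvAlg A)ᵐᵒᵖ) : M.X ⟶ M.X :=
  (ρ_ M.X).inv ≫ M.X ◁ point _ b.unop.val_mem ≫ M.act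

lemma rightHom_lin (b : (CoinvAlg A)ᵐᵒᵖ) : (M.rightHom b).lin = M.rightCoinv b :=
  LinearMap.ext fun m => by
    have : (M.rightHom b).lin m = M.actLin (m ⊗ₜ ((1 : k) • CoinvAlg.val A b.unop)) := rfl
    rw [this, one_smul]; rfl

/-- The right action of the algebra of coinvariants on the coinvariants of a right module. -/
def coinvRight : (CoinvAlg A)ᵐᵒᵖ →ₐ[k] Module.End k (coinv M.X) :=
  AlgHom.ofLinearMap
    { toFun := fun b => (M.rightCoinv b).restrict fun m hm => by
        rw [← rightHom_lin]; exact map_mem_coinv _ hm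
      map_add' := fun b c => LinearMap.ext fun m => Subtype.ext (by simp)
      map_smul' := fun b c => LinearMap.ext fun m => Subtype.ext (by simp) }
    (LinearMap.ext fun m => Subtype.ext (by simp))
    fun b c => LinearMap.ext fun m => Subtype.ext (by simp)

lemma coinvRight_val (b : (CoinvAlg A)ᵐᵒᵖ) (m : coinv M.X) :
    (M.coinvRight b m : M.X) = M.rightCoinv b m := rfl

/-- The relations defining `M ⊗_B A`. -/
abbrev rel : Submodule k (M.X ⊗[k] A.X) := balRel (fun b => M.rightCoinv (.op b)) (leftB A)

/-- The relations defining `M^{co H} ⊗_B A`. -/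
abbrev coinvRel : Submodule k (coinv M.X ⊗[k] A.X) :=
  balRel (fun b => M.coinvRight (.op b)) (leftB A)

/-- The map `m ⊗ a ↦ m a` from `M^{co H} ⊗ A` to `M`. -/
def coinvAct : coinv M.X ⊗[k] A.X →ₗ[k] M.X := M.actLin ∘ₗ (coinv M.X).subtype.rTensor A.X

lemma coinvAct_tmul (m : coinv M.X) (a : A.X) : M.coinvAct (m ⊗ₜ a) = M.actLin (m.1 ⊗ₜ a) := rfl

/-- The reassociator is trivial on a coinvariant m, so (mb)a = m(ba) holds strictly. -/
lemma coinvRel_le_ker : M.coinvRel ≤ LinearMap.ker M.coinvAct := by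
  rw [balRel_le_ker_iff]
  intro b m a
  rw [coinvAct_tmul, coinvAct_tmul]
  exact M.actLin_coinv_left m.2 _ _

end RMod

variable [CoquasiHopfAlgebra k H] {A : Mon (Comod k H)}

lemma IsGaloisExt.surjective (hGal : IsGaloisExt A) : Function.Surjective (galoisFun A) := by
  intro y
  obtain ⟨x, rfl⟩ := hGal.2 y
  obtain ⟨x, rfl⟩ := Submodule.Quotient.mk_surjective _ x
  exact ⟨x, rfl⟩

lemma IsGaloisExt.ker_eq (hGal : IsGaloisExt A) :
    LinearMap.ker (galoisFun A) = balRel (rightB A) (leftB A) := by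
  ext x
  have h : galoisMap A ((balRel (rightB A) (leftB A)).mkQ x) = galoisFun A x := rfl
  rw [LinearMap.mem_ker, ← h, map_eq_zero_iff _ hGal.1, Submodule.mkQ_apply,
    Submodule.Quotient.mk_eq_zero]

namespace RMod
variable (M : RMod A)

/-- The canonical map of a right module on elements. -/
def canLin : M.X ⊗[k] A.X →ₗ[k] M.X ⊗[k] H := (can M).lin

lemma canLin_natural {M N : RMod A} {f : M.X ⟶ N.X} (hf : IsLinear f) (x : M.X ⊗[k] A.X) :
    f.lin.rTensor H (M.canLin x) = N.canLin (f.lin.rTensor A.X x) :=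
  LinearMap.congr_fun (congrArg Hom.lin (can_natural hf)) x

variable (A) in
/-- The canonical map of the free right module on elements. -/
def freeCanLin (V : Comod k H) : (V ⊗[k] A.X) ⊗[k] A.X →ₗ[k] (V ⊗[k] A.X) ⊗[k] H :=
  (free A V).canLin

/-- In the source the last factor A has the trivial coaction, so there the reassociator is the plain
one; it survives only in the target. -/
lemma freeCanLin_apply (V : Comod k H) (x : (V ⊗[k] A.X) ⊗[k] A.X) : freeCanLin A V x =
    (as V A.X (antipodeComod k H)).symm
      ((galoisFun A).lTensor V (TensorProduct.assoc k V A.X A.X x)) := by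
  have h : freeCanLin A V x = (as V A.X (antipodeComod k H)).symm
      ((can (self A)).lin.lTensor V (as V A.X (trivialComod H A.X) x)) :=
    LinearMap.congr_fun (congrArg Hom.lin (can_free V)) x
  have e : as V A.X (trivialComod H A.X) x = TensorProduct.assoc k V A.X A.X x := by
    refine LinearMap.congr_fun (f := (as V A.X (trivialComod H A.X)).toLinearMap)
      (g := (TensorProduct.assoc k V A.X A.X).toLinearMap) (TensorProduct.ext_threefold ?_) x
    intro v a b
    exact as_right v a (mem_coinv_trivialComod b)
  rw [h, can_self_lin]
  exact congrArg (fun y => (as V A.X (antipodeComod k H)).symm ((galoisFun A).lTensor V y)) e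

lemma freeCanLin_surjective (hGal : IsGaloisExt A) (V : Comod k H) :
    Function.Surjective (freeCanLin A V) := by
  have h : (freeCanLin A V : _ → _) = (as V A.X (antipodeComod k H)).symm ∘
      (galoisFun A).lTensor V ∘ TensorProduct.assoc k V A.X A.X := funext (freeCanLin_apply V)
  rw [h]
  exact (LinearEquiv.surjective _).comp
    ((LinearMap.lTensor_surjective V hGal.surjective).comp (LinearEquiv.surjective _))

/-- Tensoring with V over the field k is exact, so the kernel is V ⊗ (kernel of the Galois map), up
to rebracketing. -/
lemma ker_freeCanLin (hGal : IsGaloisExt A) (V : Comod k H) :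
    LinearMap.ker (freeCanLin A V) = balRel (fun b => (rightB A b).lTensor V) (leftB A) := by
  apply le_antisymm
  · intro x hx
    replace hx := (as V A.X (antipodeComod k H)).symm.map_eq_zero_iff.1
      ((freeCanLin_apply V x).symm.trans hx)
    have hex : Function.Exact (balRel (rightB A) (leftB A)).subtype (galoisFun A) := by
      rw [LinearMap.exact_iff, Submodule.range_subtype, hGal.ker_eq]
    obtain ⟨y, hy⟩ := (Module.Flat.lTensor_exact V hex _).1 hx
    rw [← LinearEquiv.symm_apply_eq] at hy
    rw [← hy]
    clear hy hx
    induction y with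
    | zero => simp
    | add x y hx hy => rw [map_add, map_add]; exact Submodule.add_mem _ hx hy
    | tmul v z =>
      rw [LinearMap.lTensor_tmul]
      obtain ⟨z, hz⟩ := z
      have : balRel (rightB A) (leftB A) ≤ (balRel (fun b => (rightB A b).lTensor V)
          (leftB A)).comap
          ((TensorProduct.assoc k V A.X A.X).symm.toLinearMap ∘ₗ TensorProduct.mk k V _ v) := by
        rw [balRel_le_iff]
        intro b a c
        have h := sub_mem_balRel (r := fun b => (rightB A b).lTensor V) (l := leftB A) b
          (v ⊗ₜ[k] a) c
        rw [LinearMap.lTensor_tmul] at h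
        simpa [tmul_sub] using h
      exact this hz
  · rw [balRel_le_ker_iff]
    intro b y a
    induction y with
    | zero => simp
    | add x y hx hy => simp only [map_add, add_tmul, hx, hy]
    | tmul v c =>
      rw [LinearMap.lTensor_tmul, freeCanLin_apply, freeCanLin_apply, TensorProduct.assoc_tmul,
        TensorProduct.assoc_tmul, LinearMap.lTensor_tmul, LinearMap.lTensor_tmul]
      congr 2
      have : balRel (rightB A) (leftB A) ≤ LinearMap.ker (galoisFun A) := hGal.ker_eq.ge
      exact balRel_le_ker_iff.1 this b c a

variable (A) in
/-- The map `v ↦ v ⊗ 1`. -/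
def unitHom (V : Comod k H) : V ⟶ V ⊗ A.X := (ρ_ V).inv ≫ V ◁ η

/-- The section m ↦ m ⊗ 1 of the action is colinear but not A-linear in general, so can need not be
natural along it; the splitting arguments do not require that. -/
lemma unitHom_act : unitHom A M.X ≫ M.act = 𝟙 _ := by
  rw [unitHom, Category.assoc, M.act_one, Iso.inv_hom_id]

lemma unitHom_mul (V : Comod k H) : unitHom A (V ⊗ A.X) ≫ (free A V).act = 𝟙 _ :=
  (free A V).unitHom_act

lemma unitHom_natural {V W : Comod k H} (f : V ⟶ W) :
    unitHom A V ≫ f ▷ A.X = f ≫ unitHom A W := by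
  simp [unitHom, whisker_exchange]

/-- M is a retract, as a comodule, of the free module M ⊗ A, through the A-linear action map. -/
lemma canLin_surjective (hGal : IsGaloisExt A) : Function.Surjective M.canLin :=
  surjective_of_retract (p := M.actLin) (i := (unitHom A M.X).lin)
    (fun x => LinearMap.congr_fun (congrArg Hom.lin M.unitHom_act) x)
    (canLin_natural M.isLinear_act) (freeCanLin_surjective hGal M.X)

/-- The start (M ⊗ A) ⊗ A ⇉ M ⊗ A → M of the bar resolution is a split coequalizer whose arrows,
though not its splittings, are A-linear; hence the kernel is the image of the kernel for the free
module M ⊗ A. -/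
lemma ker_canLin (hGal : IsGaloisExt A) : LinearMap.ker M.canLin = M.rel := by
  have h : LinearMap.ker M.canLin =
      (LinearMap.ker (freeCanLin A M.X)).map (M.actLin.rTensor A.X) :=
    ker_eq_of_split (p := M.actLin) (i := (unitHom A M.X).lin) (cY := freeCanLin A M.X)
      (cZ := freeCanLin A (M.X ⊗ A.X)) (d₀ := (M.act ▷ A.X).lin) (d₁ := (free A M.X).act.lin)
      (j := (unitHom A (M.X ⊗ A.X)).lin)
      (fun x => LinearMap.congr_fun (congrArg Hom.lin M.unitHom_act) x)
      (fun x => LinearMap.congr_fun (congrArg Hom.lin (unitHom_mul M.X)) x)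
      (fun x => LinearMap.congr_fun (congrArg Hom.lin (unitHom_natural M.act)) x)
      (fun x => LinearMap.congr_fun (congrArg Hom.lin M.isLinear_act.symm) x)
      (canLin_natural M.isLinear_act)
      (canLin_natural (isLinear_whiskerRight (A := A) M.act))
      (canLin_natural (free A M.X).isLinear_act)
      (freeCanLin_surjective hGal _)
  rw [h, ker_freeCanLin hGal]
  have e : ∀ (b : CoinvAlg A) (y : M.X ⊗[k] A.X),
      M.actLin ((rightB A b).lTensor M.X y) = M.rightCoinv (.op b) (M.actLin y) := by
    intro b y
    induction y with
    | zero => simp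
    | add x y hx hy => simp only [map_add, hx, hy]
    | tmul m a => exact (M.actLin_coinv_right m a b.val_mem).symm
  apply le_antisymm
  · rw [Submodule.map_le_iff_le_comap]
    intro x hx
    exact rTensor_mem_balRel M.actLin e hx
  · rw [balRel_le_iff]
    intro b m a
    -- The relation for m is the image of the relation for the element m ⊗ 1 of the free module.
    refine ⟨_, sub_mem_balRel b (m ⊗ₜ[k] unitElt A) a, ?_⟩
    rw [map_sub, LinearMap.rTensor_tmul, LinearMap.rTensor_tmul, e, actLin_unitElt]

end RMod
end
end

/-! ### The structure theorem for relative Hopf modules -/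

noncomputable section

open Comod MonObj

section
variable {k H : Type u} [Field k] [AddCommGroup H] [Module k H] [Coalgebra k H]
  [CoquasiHopfAlgebra k H] {A : Mon (Comod k H)}

lemma as_symm_left {U V W : Comod k H} {u : U} (hu : u ∈ coinv U) (y : V ⊗[k] W) :
    (as U V W).symm (u ⊗ₜ y) = (TensorProduct.mk k U V u).rTensor W y := by
  induction y with
  | zero => simp
  | add a b ha hb => simp only [tmul_add, map_add, ha, hb]
  | tmul a h => exact (LinearEquiv.symm_apply_eq _).2 (as_left hu a h).symm

lemma deltaFun_natural {X Y : Comod k H} (f : X ⟶ Y) (x : X) :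
    deltaFun Y (f.lin x) = f.lin.rTensor H (deltaFun X x) := by
  rw [deltaFun, deltaFun, LinearMap.comp_apply, LinearMap.comp_apply, f.colinear]
  simp only [LinearMap.lTensor, LinearMap.rTensor, TensorProduct.map_map, LinearMap.id_comp,
    LinearMap.comp_id]

namespace RMod
variable (M : RMod A)

/-- Multiplication `a ↦ m a` for a coinvariant `m`. -/
def coinvHom {m : M.X} (hm : m ∈ coinv M.X) : A.X ⟶ M.X := (λ_ A.X).inv ≫ point m hm ▷ A.X ≫ M.act

lemma coinvHom_lin {m : M.X} (hm : m ∈ coinv M.X) (a : A.X) :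
    (M.coinvHom hm).lin a = M.actLin (m ⊗ₜ a) := by
  have : (M.coinvHom hm).lin a = M.actLin (((1 : k) • m) ⊗ₜ a) := rfl
  rw [this, one_smul]

lemma actLin_as_symm (V : Comod k H) {m : M.X} (hm : m ∈ coinv M.X) (y : A.X ⊗[k] V) :
    M.actLin.rTensor V ((as M.X A.X V).symm (m ⊗ₜ y)) = (M.coinvHom hm).lin.rTensor V y := by
  rw [as_symm_left hm, ← LinearMap.rTensor_comp_apply]
  congr 2
  exact LinearMap.ext fun a => (M.coinvHom_lin hm a).symm

/-- For coinvariant m the map a ↦ ma is colinear and the reassociator at m is trivial, so naturality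
of δ carries m δ(a) to δ(ma). -/
lemma canLin_coinv (x : coinv M.X ⊗[k] A.X) :
    M.canLin ((coinv M.X).subtype.rTensor A.X x) = deltaFun M.X (M.coinvAct x) := by
  induction x with
  | zero => simp
  | add x y hx hy => simp only [map_add, hx, hy]
  | tmul m a =>
    obtain ⟨m, hm⟩ := m
    rw [coinvAct_tmul, ← M.coinvHom_lin hm, deltaFun_natural]
    have h : M.canLin (m ⊗ₜ a) = M.actLin.rTensor H
      ((as M.X A.X (antipodeComod k H)).symm (m ⊗ₜ deltaFun A.X a)) := rfl
    exact h.trans (M.actLin_as_symm (antipodeComod k H) hm (deltaFun A.X a))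

/-- The map `m ↦ m₀ ⊗ m₁ - m ⊗ 1`. -/
def coinvDiff : M.X →ₗ[k] M.X ⊗[k] H :=
  M.X.coact.ρ - (TensorProduct.mk k M.X H).flip (CoquasiBialgebra.unit (k := k) (H := H) 1)

/-- The right action of the algebra of coinvariants on `M ⊗ H`. -/
def rightCoinvTensor : (CoinvAlg A)ᵐᵒᵖ →ₐ[k] Module.End k (M.X ⊗[k] H) :=
  (Module.End.rTensorAlgHom k M.X H).comp M.rightCoinv

lemma rightCoinvTensor_apply (b : (CoinvAlg A)ᵐᵒᵖ) (x : M.X ⊗[k] H) :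
    M.rightCoinvTensor b x = (M.rightCoinv b).rTensor H x := rfl

lemma coinvDiff_rightCoinv (b : (CoinvAlg A)ᵐᵒᵖ) (m : M.X) :
    M.coinvDiff (M.rightCoinv b m) = M.rightCoinvTensor b (M.coinvDiff m) := by
  rw [rightCoinvTensor_apply, ← rightHom_lin, coinvDiff, LinearMap.sub_apply, LinearMap.sub_apply,
    (M.rightHom b).colinear, map_sub]
  rfl

/-- In the source of can only M carries a nontrivial coaction, so colinearity turns coinvariance of
can(y) into the vanishing of can ⊗ H on ρ(y) - y ⊗ 1. The kernel of can ⊗ H is that of can tensored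
with H. -/
lemma coinvDiff_rTensor_mem (hGal : IsGaloisExt A) {y : M.X ⊗[k] A.X}
    (hy : M.canLin y ∈ coinv (M.X ⊗ antipodeComod k H)) :
    M.coinvDiff.rTensor A.X y ∈ balRel (fun b => M.rightCoinvTensor (.op b)) (leftB A) := by
  -- The coaction of M puts H between M and A; the swap moves it to the end, where can ⊗ H applies.
  let sw := TensorProduct.rightComm k M.X H A.X
  have h1 : M.canLin.rTensor H (sw (M.coinvDiff.rTensor A.X y)) =
      (M.X.coact.tensor (antipodeCoaction k H)).ρ (M.canLin y) -
        M.canLin y ⊗ₜ CoquasiBialgebra.unit (k := k) (1 : k) := by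
    have e1 : (M.X.coact.tensor (antipodeCoaction k H)).ρ (M.canLin y) =
      M.canLin.rTensor H ((M.X.coact.tensor (trivialCoaction H A.X)).ρ y) := (can M).colinear y
    have e2 : (M.X.coact.tensor (trivialCoaction H A.X)).ρ y =
        sw (M.X.coact.ρ.rTensor A.X y) := by
      clear hy e1
      induction y with
      | zero => simp
      | add x y hx hy => simp only [map_add, hx, hy]
      | tmul m a =>
        rw [LinearMap.rTensor_tmul]
        change CoquasiBialgebra.mul.toLinearMap.lTensor (M.X ⊗[k] A.X)
          (TensorProduct.tensorTensorTensorComm k M.X H A.X H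
          (M.X.coact.ρ m ⊗ₜ (a ⊗ₜ CoquasiBialgebra.unit (k := k) 1))) = _
        generalize M.X.coact.ρ m = z
        induction z with
        | zero => simp
        | add x y hx hy => simp only [map_add, add_tmul, hx, hy]
        | tmul m h => simp [sw, CoquasiBialgebra.mul_one']
    have e3 : M.canLin y ⊗ₜ CoquasiBialgebra.unit (k := k) (1 : k) = M.canLin.rTensor H (sw
        (((TensorProduct.mk k M.X H).flip (CoquasiBialgebra.unit (k := k) (H := H) 1)).rTensor
          A.X y)) := by
      have : sw (((TensorProduct.mk k M.X H).flip (CoquasiBialgebra.unit (k := k) (H := H)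
          1)).rTensor A.X y) = y ⊗ₜ CoquasiBialgebra.unit (k := k) (1 : k) := by
        clear hy e1 e2
        induction y with
        | zero => simp
        | add x y hx hy => simp only [map_add, add_tmul, hx, hy]
        | tmul m a => simp [sw]
      rw [this, LinearMap.rTensor_tmul]
    rw [e1, e2, e3, ← map_sub, ← map_sub, coinvDiff, LinearMap.rTensor_sub, LinearMap.sub_apply]
  have h2 : M.canLin.rTensor H (sw (M.coinvDiff.rTensor A.X y)) = 0 := by
    rw [h1, sub_eq_zero]
    exact mem_coinv.1 hy
  have hex : Function.Exact M.rel.subtype M.canLin := by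
    rw [LinearMap.exact_iff, Submodule.range_subtype, M.ker_canLin hGal]
  -- Flatness of H over k: an element killed by can ⊗ H comes from the balanced relations tensored
  -- with H.
  obtain ⟨z, hz⟩ := (Module.Flat.rTensor_exact H hex _).1 h2
  rw [← LinearEquiv.symm_apply_eq] at hz
  rw [← hz]
  clear hz h1 h2
  induction z with
  | zero => simp
  | add x y hx hy => rw [map_add, map_add]; exact Submodule.add_mem _ hx hy
  | tmul z h =>
    rw [LinearMap.rTensor_tmul]
    obtain ⟨z, hz⟩ := z
    have : M.rel ≤ (balRel (fun b => M.rightCoinvTensor (.op b)) (leftB A)).comap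
        (sw.symm.toLinearMap ∘ₗ (TensorProduct.mk k _ H).flip h) := by
      rw [balRel_le_iff]
      intro b m a
      have h := sub_mem_balRel (r := fun b => M.rightCoinvTensor (.op b)) (l := leftB A) b
        (m ⊗ₜ[k] h) a
      rw [rightCoinvTensor_apply, LinearMap.rTensor_tmul] at h
      simpa [sub_tmul, sw] using h
    exact this hz

lemma exact_coinvDiff : Function.Exact (coinv M.X).subtype M.coinvDiff := by
  rw [LinearMap.exact_iff, Submodule.range_subtype]; rfl

/-- The structure theorem for relative Hopf modules: surjectivity of `M^{co H} ⊗_B A → M`. -/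
theorem coinvAct_surjective (hff : IsLeftFaithfullyFlat (leftB A)) (hGal : IsGaloisExt A) :
    Function.Surjective M.coinvAct := by
  intro m
  obtain ⟨y, hy⟩ := M.canLin_surjective hGal (deltaFun M.X m)
  -- Tensoring 0 → M^{co H} → M → M ⊗ H with A over B stays exact, so y is congruent to an element x
  -- of M^{co H} ⊗ A modulo the balanced relations.
  obtain ⟨x, hx⟩ := ((hff.exact_iff M.coinvRight M.rightCoinv M.rightCoinvTensor
    (coinv M.X).subtype M.coinvDiff M.coinvRight_val M.coinvDiff_rightCoinv).1
    M.exact_coinvDiff y).1 (M.coinvDiff_rTensor_mem hGal (by rw [hy]; exact deltaFun_mem M.X m))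
  refine ⟨x, deltaFun_injective M.X ?_⟩
  -- δ of the product of x equals can(x), and can(x) = can(y) = δ(m) since x and y differ by an
  -- element of the kernel of can.
  rw [← canLin_coinv, ← hy, eq_comm, ← sub_eq_zero, ← map_sub]
  change _ ∈ LinearMap.ker M.canLin
  rw [M.ker_canLin hGal]
  exact hx

/-- The structure theorem for relative Hopf modules: injectivity of `M^{co H} ⊗_B A → M`. -/
theorem ker_coinvAct (hff : IsLeftFaithfullyFlat (leftB A)) (hGal : IsGaloisExt A) :
    LinearMap.ker M.coinvAct = M.coinvRel := by
  refine le_antisymm (fun x hx => ?_) M.coinvRel_le_ker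
  -- By flatness M^{co H} ⊗_B A embeds in M ⊗_B A, where vanishing is detected by can; and can(x) is
  -- δ of the product of x, which is zero.
  refine (hff.injective_iff M.coinvRight M.rightCoinv (coinv M.X).subtype M.coinvRight_val).1
    (coinv M.X).injective_subtype x ?_
  change _ ∈ M.rel
  rw [← M.ker_canLin hGal, LinearMap.mem_ker, canLin_coinv, LinearMap.mem_ker.1 hx, map_zero]

/-- A map to the coinvariants is bijective if it becomes so after tensoring with `A`. -/
theorem bijective_of_coinvAct (hff : IsLeftFaithfullyFlat (leftB A)) (hGal : IsGaloisExt A)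
    {N : Type u} [AddCommGroup N] [Module k N] (r : (CoinvAlg A)ᵐᵒᵖ →ₐ[k] Module.End k N)
    (f : N →ₗ[k] coinv M.X) (hf : ∀ b n, f (r b n) = M.coinvRight b (f n))
    (hs : Function.Surjective (M.coinvAct ∘ₗ f.rTensor A.X))
    (hk : LinearMap.ker (M.coinvAct ∘ₗ f.rTensor A.X) ≤ balRel (fun b => r (.op b)) (leftB A)) :
    Function.Bijective f := by
  -- Faithfulness: f is tested after tensoring with A, where the product map identifies M^{co H} ⊗_B
  -- A with M.
  constructor
  · refine (hff.injective_iff r M.coinvRight f hf).2 fun y hy => hk ?_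
    exact M.coinvRel_le_ker hy
  · refine (hff.surjective_iff r M.coinvRight f hf).2 fun y => ?_
    obtain ⟨x, hx⟩ := hs (M.coinvAct y)
    refine ⟨x, ?_⟩
    change _ ∈ M.coinvRel
    rw [← M.ker_coinvAct hff hGal, LinearMap.mem_ker, map_sub, sub_eq_zero]
    exact hx.symm

end RMod
end
end

/-! ### Structures on a space spanned by compatible images -/

noncomputable section

open Comod MonObj

section
variable {k H : Type u} [Field k] [AddCommGroup H] [Module k H] [Coalgebra k H]

/-- The coaction on a space spanned by compatible images of a comodule. -/
def coactionOfFamily (V : Comod k H) {X : Type u} [AddCommGroup X] [Module k X] {I : Type u}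
    (J : I → V →ₗ[k] X)
    (hJ : ∀ {W : Type u} [AddCommGroup W] [Module k W] (f g : X →ₗ[k] W),
      (∀ i v, f (J i v) = g (J i v)) → f = g)
    (ρ : X →ₗ[k] X ⊗[k] H) (hρ : ∀ i v, ρ (J i v) = (J i).rTensor H (V.coact.ρ v)) :
    Coaction k H X where
  ρ := ρ
  coassoc x := by
    refine LinearMap.congr_fun (f := (TensorProduct.assoc k X H H).toLinearMap ∘ₗ ρ.rTensor H ∘ₗ ρ)
      (g := Coalgebra.comul.lTensor X ∘ₗ ρ) (hJ _ _ fun i v => ?_) x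
    have e : ρ ∘ₗ J i = (J i).rTensor H ∘ₗ V.coact.ρ := LinearMap.ext (hρ i)
    have h1 : ∀ y : (V ⊗[k] H) ⊗[k] H, TensorProduct.assoc k X H H (((J i).rTensor H).rTensor H y) =
        (J i).rTensor (H ⊗[k] H) (TensorProduct.assoc k V H H y) := fun y =>
      LinearMap.congr_fun (f := (TensorProduct.assoc k X H H).toLinearMap ∘ₗ
        ((J i).rTensor H).rTensor H) (g := (J i).rTensor (H ⊗[k] H) ∘ₗ
        (TensorProduct.assoc k V H H).toLinearMap) (TensorProduct.ext_threefold fun _ _ _ => rfl) y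
    have h2 : ∀ y : V ⊗[k] H, (J i).rTensor (H ⊗[k] H) (Coalgebra.comul.lTensor V y) =
        Coalgebra.comul.lTensor X ((J i).rTensor H y) := fun y =>
      LinearMap.congr_fun ((LinearMap.rTensor_comp_lTensor ..).trans
        (LinearMap.lTensor_comp_rTensor ..).symm) y
    rw [LinearMap.comp_apply, LinearMap.comp_apply, LinearMap.comp_apply, hρ,
      ← LinearMap.rTensor_comp_apply, e, LinearMap.rTensor_comp_apply, LinearEquiv.coe_coe, h1,
      V.coact.coassoc, h2]
  counit x := by
    refine LinearMap.congr_fun (f := (TensorProduct.rid k X).toLinearMap ∘ₗ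
      Coalgebra.counit.lTensor X ∘ₗ ρ) (g := LinearMap.id) (hJ _ _ fun i v => ?_) x
    have h1 : ∀ y : V ⊗[k] k, TensorProduct.rid k X ((J i).rTensor k y) =
        J i (TensorProduct.rid k V y) := fun y =>
      LinearMap.congr_fun (f := (TensorProduct.rid k X).toLinearMap ∘ₗ (J i).rTensor k)
        (g := J i ∘ₗ (TensorProduct.rid k V).toLinearMap) (TensorProduct.ext' fun _ _ => by simp) y
    rw [LinearMap.comp_apply, LinearMap.comp_apply, hρ, ← LinearMap.comp_apply (LinearMap.lTensor _ _),
      LinearMap.lTensor_comp_rTensor, ← LinearMap.rTensor_comp_lTensor, LinearMap.comp_apply,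
      LinearEquiv.coe_coe, h1, V.coact.counit, LinearMap.id_apply]

variable [CoquasiBialgebra k H] {A : Mon (Comod k H)}

section
variable {P X : Comod k H} {I : Type u} (J : I → (P ⟶ X))

/-- A family of morphisms whose images span. -/
def JointlyEpi : Prop := ∀ {W : Type u} [AddCommGroup W] [Module k W] (f g : X →ₗ[k] W),
  (∀ i v, f ((J i).lin v) = g ((J i).lin v)) → f = g

variable {J} (hJ : JointlyEpi J)
include hJ

/-- Tensoring over k preserves joint surjectivity, so identities between morphisms out of V ⊗ X can
be pulled back to P, as the bimodule axioms require. -/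
lemma JointlyEpi.left {V W : Comod k H} {f g : V ⊗ X ⟶ W}
    (h : ∀ i, V ◁ J i ≫ f = V ◁ J i ≫ g) : f = g := by
  refine hom_ext' (TensorProduct.ext (LinearMap.ext fun v => hJ _ _ fun i p => ?_))
  exact LinearMap.congr_fun (congrArg Hom.lin (h i)) (v ⊗ₜ p)

lemma JointlyEpi.right {V W : Comod k H} {f g : X ⊗ V ⟶ W}
    (h : ∀ i, J i ▷ V ≫ f = J i ▷ V ≫ g) : f = g := by
  refine hom_ext' (TensorProduct.ext (hJ _ _ fun i p => LinearMap.ext fun v => ?_))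
  exact LinearMap.congr_fun (congrArg Hom.lin (h i)) (p ⊗ₜ v)

lemma JointlyEpi.middle {V W Y : Comod k H} {f g : (V ⊗ X) ⊗ W ⟶ Y}
    (h : ∀ i, (V ◁ J i) ▷ W ≫ f = (V ◁ J i) ▷ W ≫ g) : f = g := by
  refine hom_ext' (TensorProduct.ext (TensorProduct.ext (LinearMap.ext fun v =>
    hJ _ _ fun i p => LinearMap.ext fun w => ?_)))
  exact LinearMap.congr_fun (congrArg Hom.lin (h i)) (v ⊗ₜ p ⊗ₜ w)

end

/-- The bimodule structure on a comodule spanned by compatible images of a bimodule. -/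
@[simps X actLeft actRight]
def bimodOfFamily (P : Bimod A A) {X : Comod k H} {I : Type u} {J : I → (P.X ⟶ X)}
    (hJ : JointlyEpi J) (l : A.X ⊗ X ⟶ X) (r : X ⊗ A.X ⟶ X)
    (hl : ∀ i, A.X ◁ J i ≫ l = P.actLeft ≫ J i) (hr : ∀ i, J i ▷ A.X ≫ r = P.actRight ≫ J i) :
    Bimod A A where
  X := X
  actLeft := l
  actRight := r
  one_actLeft := hJ.left fun i => by
    rw [whisker_exchange_assoc, hl, P.one_actLeft_assoc, leftUnitor_naturality]
  actRight_one := hJ.right fun i => by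
    rw [← whisker_exchange_assoc, hr, P.actRight_one_assoc, rightUnitor_naturality]
  left_assoc := hJ.left fun i => by
    rw [whisker_exchange_assoc, hl, P.left_assoc_assoc, tensor_whiskerLeft_assoc,
      Iso.inv_hom_id_assoc, ← MonoidalCategory.whiskerLeft_comp_assoc, hl,
      MonoidalCategory.whiskerLeft_comp_assoc, hl]
  right_assoc := hJ.right fun i => by
    rw [← whisker_exchange_assoc, hr, P.right_assoc_assoc, whiskerRight_tensor_assoc,
      Iso.hom_inv_id_assoc, ← comp_whiskerRight_assoc, hr, comp_whiskerRight_assoc, hr]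
  middle_assoc := hJ.middle fun i => by
    rw [← comp_whiskerRight_assoc, hl, comp_whiskerRight_assoc, hr, P.middle_assoc_assoc,
      whisker_assoc_assoc, Iso.inv_hom_id_assoc, ← MonoidalCategory.whiskerLeft_comp_assoc, hr,
      MonoidalCategory.whiskerLeft_comp_assoc, hl]

end
end

/-! ### The coinvariants functor is full and faithful -/

noncomputable section

open Comod MonObj

section
variable {k H : Type u} [Field k] [AddCommGroup H] [Module k H] [Coalgebra k H]

/-- A linear map of comodules which is colinear on a spanning family of comodules. -/
def Comod.homOfFamily {V Y Z : Comod k H} {I : Type u} {J : I → (V ⟶ Y)} (hJ : JointlyEpi J)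
    (F : Y →ₗ[k] Z) (G : I → (V ⟶ Z)) (h : ∀ i v, F ((J i).lin v) = (G i).lin v) : Y ⟶ Z where
  lin := F
  colinear y := by
    refine LinearMap.congr_fun (f := Z.coact.ρ ∘ₗ F) (g := F.rTensor H ∘ₗ Y.coact.ρ)
      (hJ _ _ fun i v => ?_) y
    have e : F ∘ₗ (J i).lin = (G i).lin := LinearMap.ext (h i)
    rw [LinearMap.comp_apply, h, (G i).colinear, LinearMap.comp_apply, (J i).colinear,
      ← LinearMap.rTensor_comp_apply, e]

end

section
variable {k H : Type u} [Field k] [AddCommGroup H] [Module k H] [Coalgebra k H]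
  [CoquasiBialgebra k H] {A : Mon (Comod k H)}

lemma JointlyEpi.whiskerLeft {P X : Comod k H} {I : Type u} {J : I → (P ⟶ X)} (hJ : JointlyEpi J)
    (V : Comod k H) : JointlyEpi fun i => V ◁ J i := fun _ _ h =>
  TensorProduct.ext (LinearMap.ext fun v => hJ _ _ fun i p => h i (v ⊗ₜ p))

lemma JointlyEpi.whiskerRight {P X : Comod k H} {I : Type u} {J : I → (P ⟶ X)} (hJ : JointlyEpi J)
    (V : Comod k H) : JointlyEpi fun i => J i ▷ V := fun _ _ h =>
  TensorProduct.ext (hJ _ _ fun i p => LinearMap.ext fun v => h i (p ⊗ₜ v))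

/-- The reassociator disappears because its first argument is coinvariant. -/
lemma ract_coinv_left {M : Bimod A A} {m : M.X} (hm : m ∈ coinv M.X) (a b : A.X) :
    ract M (ract M (m ⊗ₜ a) ⊗ₜ b) = ract M (m ⊗ₜ mulLin A (a ⊗ₜ b)) :=
  (RMod.ofBimod M).actLin_coinv_left hm a b

lemma actLR_tgt {M : Bimod A A} (b : (CoinvAlg A)ᵐᵒᵖ) (m : M.X) :
    actLR M (LAlg.val A (tgtMap A b)) m = ract M (m ⊗ₜ CoinvAlg.val A b.unop) := by
  rw [val_tgtMap, actLR_tmul, unitElt_lact]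

lemma actLR_src {M : Bimod A A} (b : CoinvAlg A) (m : M.X) :
    actLR M (LAlg.val A (srcMap A b)) m = lact M (CoinvAlg.val A b ⊗ₜ m) := by
  rw [val_srcMap, actLR_tmul, ract_unitElt]

/-- The right B-structure of the structure theorem is the one that the L-module M^{co H} has through
t; hence L-linear maps are compatible with the balanced relations. -/
lemma coinvRight_eq_tgt_smul (M : Bimod A A) (b : (CoinvAlg A)ᵐᵒᵖ) (m : CoinvMod M) :
    (RMod.ofBimod M).coinvRight b m = tgtMap A b • m :=
  CoinvMod.val_inj M (actLR_tgt b _).symm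

lemma coinvRight_eq_tgt_mul (b : (CoinvAlg A)ᵐᵒᵖ) (l : LAlg A) :
    (RMod.ofBimod (freeBimod A)).coinvRight b l = tgtMap A b * l := LAlg.val_inj <| by
  rw [LAlg.val_mul, freeLR_eq]
  exact (actLR_tgt (M := freeBimod A) b _).symm

variable (A) in
/-- The right action on the free bimodule `A ⊗ A`. -/
def freeRact : (A.X ⊗[k] A.X) ⊗[k] A.X →ₗ[k] A.X ⊗[k] A.X := ract (freeBimod A)

variable (A) in
/-- The left action on the free bimodule `A ⊗ A`. -/
def freeLact : A.X ⊗[k] (A.X ⊗[k] A.X) →ₗ[k] A.X ⊗[k] A.X := lact (freeBimod A)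

lemma freeRact_coinv_left (l : LAlg A) (a b : A.X) :
    freeRact A (freeRact A (LAlg.val A l ⊗ₜ a) ⊗ₜ b) =
      freeRact A (LAlg.val A l ⊗ₜ mulLin A (a ⊗ₜ b)) :=
  ract_coinv_left (M := freeBimod A) l.2 a b

lemma freeRact_unitElt (x : A.X ⊗[k] A.X) : freeRact A (x ⊗ₜ unitElt A) = x :=
  ract_unitElt (M := freeBimod A) x

lemma freeLR_tmul_eq (a b : A.X) (x : A.X ⊗[k] A.X) :
    freeLR A (a ⊗ₜ b) x = freeLact A (a ⊗ₜ freeRact A (x ⊗ₜ b)) := rfl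

/-- The orbit map y ↦ y · m from A ⊗ A to M is a bimodule morphism, in particular right linear. As
the products lc span A ⊗ A, the whole action of A ⊗ A on m is determined by that of L. -/
lemma actLR_freeRact {M : Bimod A A} (l : LAlg A) (c : A.X) {m : M.X} (hm : m ∈ coinv M.X) :
    actLR M (freeRact A (LAlg.val A l ⊗ₜ c)) m = ract M (actLR M (LAlg.val A l) m ⊗ₜ c) := by
  rw [← orbit_lin m hm, ← orbit_lin m hm]
  exact (ract_hom (orbit m hm) c _).symm

lemma freeLR_freeRact (l l' : LAlg A) (c : A.X) :
    freeLR A (freeRact A (LAlg.val A l ⊗ₜ c)) (LAlg.val A l') =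
      freeRact A (LAlg.val A (l * l') ⊗ₜ c) := by
  rw [freeLR_eq, LAlg.val_mul, freeLR_eq]
  exact actLR_freeRact (M := freeBimod A) l c l'.2

/-- Used to see that the left action on N ⊗_B A respects the balanced relations. -/
lemma freeLR_tmul_tgt (a c : A.X) (b : (CoinvAlg A)ᵐᵒᵖ) :
    freeLR A (a ⊗ₜ c) (LAlg.val A (tgtMap A b)) =
      a ⊗ₜ mulLin A (CoinvAlg.val A b.unop ⊗ₜ c) := by
  rw [val_tgtMap, freeLR_tmul, as_left unitElt_mem, LinearMap.lTensor_tmul,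
    ← as_mid a unitElt_mem, LinearEquiv.symm_apply_apply, LinearMap.rTensor_tmul, mul_unitElt]

lemma CoinvMod.val_algebraMap_smul (M : Bimod A A) (c : k) (m : CoinvMod M) :
    CoinvMod.val M (algebraMap k (LAlg A) c • m) = c • CoinvMod.val M m := by
  rw [Algebra.algebraMap_eq_smul_one, CoinvMod.val_smul]
  refine (LinearMap.congr_fun (map_smul (actLR M) c (unitElt A ⊗ₜ unitElt A)) _).trans ?_
  exact congrArg (fun z : M.X => c • z) (actLR_one (CoinvMod.val M m))

lemma CoinvMod.algebraMap_smul (M : Bimod A A) (c : k) (m : CoinvMod M) :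
    algebraMap k (LAlg A) c • m = (c • (show coinv M.X from m) : coinv M.X) :=
  CoinvMod.val_inj M (CoinvMod.val_algebraMap_smul M c m)

/-- An `L`-linear map of coinvariants as a `k`-linear map. -/
def coinvLin {M N : Bimod A A} (g : CoinvMod M →ₗ[LAlg A] CoinvMod N) :
    coinv M.X →ₗ[k] coinv N.X where
  toFun := g
  map_add' := g.map_add
  map_smul' c m := by
    exact (congrArg g (CoinvMod.algebraMap_smul M c m).symm).trans
      ((g.map_smul _ _).trans (CoinvMod.algebraMap_smul N c (g m)))

end

section
variable {k H : Type u} [Field k] [AddCommGroup H] [Module k H] [Coalgebra k H]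
  [CoquasiHopfAlgebra k H] {A : Mon (Comod k H)}
  (hff : IsLeftFaithfullyFlat (leftB A)) (hGal : IsGaloisExt A)

section
include hff hGal

/-- The surjective half of the structure theorem. -/
lemma RMod.jointlyEpi_coinvHom (M : RMod A) :
    JointlyEpi fun m : coinv M.X => M.coinvHom m.2 := fun f g h =>
  (LinearMap.cancel_right (M.coinvAct_surjective hff hGal)).1 <|
    TensorProduct.ext' fun m a => by
      have := h m a
      rwa [M.coinvHom_lin] at this

/-- The injective half supplies the universal property: M is M^{co H} ⊗_B A, so a balanced map
determines a map out of M. -/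
lemma RMod.exists_of_coinvAct (M : RMod A) {X : Type*} [AddCommGroup X] [Module k X]
    (f : coinv M.X ⊗[k] A.X →ₗ[k] X)
    (hf : ∀ b m a, f (M.coinvRight (.op b) m ⊗ₜ a) = f (m ⊗ₜ leftB A b a)) :
    ∃ g : M.X →ₗ[k] X, ∀ m a, g (M.actLin (m.1 ⊗ₜ a)) = f (m ⊗ₜ a) := by
  obtain ⟨g, hg⟩ := exists_factor M.coinvAct (M.coinvAct_surjective hff hGal) f
    (by rw [M.ker_coinvAct hff hGal]; exact balRel_le_ker_iff.2 hf)
  exact ⟨g, fun m a => hg (m ⊗ₜ a)⟩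

lemma ext_ract (M : Bimod A A) {X : Type u} [AddCommGroup X] [Module k X] {f g : M.X →ₗ[k] X}
    (h : ∀ (m : coinv M.X) a, f (ract M (m.1 ⊗ₜ a)) = g (ract M (m.1 ⊗ₜ a))) : f = g :=
  (RMod.ofBimod M).jointlyEpi_coinvHom hff hGal f g fun m a => by
    rw [RMod.coinvHom_lin]; exact h m a

lemma ext_freeRact {X : Type u} [AddCommGroup X] [Module k X] {f g : A.X ⊗[k] A.X →ₗ[k] X}
    (h : ∀ (l : LAlg A) a, f (freeRact A (LAlg.val A l ⊗ₜ a)) =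
      g (freeRact A (LAlg.val A l ⊗ₜ a))) : f = g :=
  ext_ract hff hGal (freeBimod A) h

/-- A map to the coinvariants of a bimodule is bijective if it becomes so after tensoring
with `A`. -/
lemma bijective_of_ract (M : Bimod A A) {N : Type u} [AddCommGroup N] [Module k N]
    (r : (CoinvAlg A)ᵐᵒᵖ →ₐ[k] Module.End k N) (f : N →ₗ[k] coinv M.X)
    (hf : ∀ b n, (f (r b n)).1 = ract M ((f n).1 ⊗ₜ CoinvAlg.val A b.unop))
    (p : N ⊗[k] A.X →ₗ[k] M.X) (hp : ∀ n a, ract M ((f n).1 ⊗ₜ a) = p (n ⊗ₜ a))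
    (hs : Function.Surjective p)
    (hk : LinearMap.ker p ≤ balRel (fun b => r (.op b)) (leftB A)) : Function.Bijective f := by
  obtain rfl : (RMod.ofBimod M).coinvAct ∘ₗ f.rTensor A.X = p := TensorProduct.ext' hp
  exact RMod.bijective_of_coinvAct (RMod.ofBimod M) hff hGal r f
    (fun b n => Subtype.ext (hf b n)) hs hk

/-- M is generated by its coinvariants as a right A-module. -/
lemma coinvFunctor_faithful : (coinvFunctor A).Faithful where
  map_injective {M N f g} h := by
    refine Bimod.Hom.ext (hom_ext' (ext_ract hff hGal M fun m a => ?_))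
    rw [← ract_hom f, ← ract_hom g]
    have : f.hom.lin m.1 = g.hom.lin m.1 :=
      congrArg Subtype.val (LinearMap.congr_fun (congrArg ModuleCat.Hom.hom h) m)
    rw [this]

/-- An L-linear g extends to F(ma) = g(m)a, which is well defined because g commutes with t(B). Left
linearity comes from the compatibility of F with all of A ⊗ A, which follows from L-linearity since
A ⊗ A is spanned by the products lc. -/
lemma coinvFunctor_full : (coinvFunctor A).Full where
  map_surjective {M N} g := by
    let g' : coinv M.X →ₗ[k] coinv N.X := coinvLin g.hom
    obtain ⟨F, hF⟩ : ∃ F : M.X →ₗ[k] N.X, _ := (RMod.ofBimod M).exists_of_coinvAct hff hGal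
      (ract N ∘ₗ ((coinv N.X).subtype ∘ₗ g').rTensor A.X) fun b m a => by
        have h1 : g' ((RMod.ofBimod M).coinvRight (.op b) m) =
            (RMod.ofBimod N).coinvRight (.op b) (g' m) := by
          refine (congrArg g' (coinvRight_eq_tgt_smul M _ m)).trans ?_
          refine Eq.trans ?_ (coinvRight_eq_tgt_smul N _ _).symm
          exact g.hom.map_smul _ _
        change ract N ((g' _).1 ⊗ₜ a) = ract N ((g' m).1 ⊗ₜ _)
        rw [h1]
        exact ract_coinv_left (g' m).2 _ _
    replace hF : ∀ (m : coinv M.X) a, F (ract M (m.1 ⊗ₜ a)) = ract N ((g' m).1 ⊗ₜ a) := hF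
    have hLR : ∀ (m : coinv M.X) (y : A.X ⊗[k] A.X),
        F (actLR M y m.1) = actLR N y (g' m).1 := by
      intro m
      -- On y = lc both sides are g(lm)c, using (lc)m = (lm)c and the linearity of g.
      refine fun y => LinearMap.congr_fun (f := F ∘ₗ (actLR M).flip m.1)
        (g := (actLR N).flip (g' m).1) (ext_freeRact hff hGal fun l c => ?_) y
      change F (actLR M _ _) = actLR N _ _
      refine (congrArg F (actLR_freeRact l c m.2)).trans
        (Eq.trans ?_ (actLR_freeRact l c (g' m).2).symm)
      refine (hF (l • (show CoinvMod M from m)) c).trans ?_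
      exact congrArg (fun z : CoinvMod N => ract N (CoinvMod.val N z ⊗ₜ c)) (g.hom.map_smul l m)
    let Fh : M.X ⟶ N.X := homOfFamily ((RMod.ofBimod M).jointlyEpi_coinvHom hff hGal) F
      (fun m => (RMod.ofBimod N).coinvHom (g' m).2) fun m a => by
        refine (congrArg F (RMod.coinvHom_lin ..)).trans (Eq.trans ?_
          (RMod.coinvHom_lin (RMod.ofBimod N) (g' m).2 a).symm)
        exact hF m a
    refine ⟨{ hom := Fh, left_act_hom := ?_, right_act_hom := ?_ }, ?_⟩
    · refine hom_ext' (TensorProduct.ext (LinearMap.ext fun a => ?_))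
      refine ext_ract hff hGal M fun m b => ?_
      -- Since a(mb) is (a ⊗ b) · m, the preceding identity becomes left linearity on the spanning
      -- elements mb.
      change F (actLR M (a ⊗ₜ b) m.1) = lact N (a ⊗ₜ F (ract M (m.1 ⊗ₜ b)))
      rw [hLR, hF]; rfl
    · refine hom_ext' (TensorProduct.ext (ext_ract hff hGal M fun m a =>
        LinearMap.ext fun b => ?_))
      change F (ract M (ract M (m.1 ⊗ₜ a) ⊗ₜ b)) = ract N (F (ract M (m.1 ⊗ₜ a)) ⊗ₜ b)
      rw [ract_coinv_left m.2, hF, hF, ract_coinv_left (g' m).2]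
    · refine ModuleCat.hom_ext (LinearMap.ext fun m => CoinvMod.val_inj N ?_)
      exact (congrArg F (ract_unitElt (M := M) m.1).symm).trans
        ((hF m _).trans (ract_unitElt (M := N) _))

end

/-! ### The bimodule N ⊗_B A of an L-module N, and essential surjectivity -/

section Induced
variable {N : Type u} [AddCommGroup N] [Module k N] (φ : LAlg A →ₐ[k] Module.End k N)

/-- The space `N ⊗_B A` for a left `L`-module `N`. -/
abbrev IndSpace : Type u := BTensor (fun b => φ (tgtMap A (.op b))) (leftB A)

/-- The map `a ↦ n ⊗ a` to `N ⊗_B A`. -/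
def indMk : N →ₗ[k] A.X →ₗ[k] IndSpace φ := TensorProduct.curry (balRel _ _).mkQ

lemma indMk_tgt (b : CoinvAlg A) (n : N) (a : A.X) :
    indMk φ (φ (tgtMap A (.op b)) n) a = indMk φ n (leftB A b a) :=
  (Submodule.Quotient.eq _).2 (sub_mem_balRel b n a)

lemma indMk_ext {W : Type*} [AddCommGroup W] [Module k W] {f g : IndSpace φ →ₗ[k] W}
    (h : ∀ n a, f (indMk φ n a) = g (indMk φ n a)) : f = g :=
  Submodule.linearMap_qext _ (TensorProduct.ext' h)

/-- Linear maps out of `N ⊗_B A`. -/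
def indLift {W : Type*} [AddCommGroup W] [Module k W] (f : N →ₗ[k] A.X →ₗ[k] W)
    (hf : ∀ b n a, f (φ (tgtMap A (.op b)) n) a = f n (leftB A b a)) : IndSpace φ →ₗ[k] W :=
  (balRel _ _).liftQ (TensorProduct.lift f) (balRel_le_ker_iff.2 hf)

/-- The coaction `n ⊗ a ↦ n ⊗ a₀ ⊗ a₁` on `N ⊗_B A`. -/
def indρ : IndSpace φ →ₗ[k] IndSpace φ ⊗[k] H :=
  indLift φ (LinearMap.lcomp k _ A.X.coact.ρ ∘ₗ LinearMap.rTensorHom H ∘ₗ indMk φ) fun b n a => by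
    -- Left multiplication by a coinvariant is colinear, so the coaction of A respects the balanced
    -- relations.
    have e : indMk φ (φ (tgtMap A (.op b)) n) = indMk φ n ∘ₗ (mulL b).lin :=
      LinearMap.ext fun a => by rw [LinearMap.comp_apply, mulL_lin]; exact indMk_tgt φ b n a
    have e2 : leftB A b a = (mulL b).lin a := (mulL_lin b a).symm
    change (indMk φ (φ (tgtMap A (.op b)) n)).rTensor H (A.X.coact.ρ a) =
      (indMk φ n).rTensor H (A.X.coact.ρ (leftB A b a))
    rw [e2, (mulL b).colinear, e, LinearMap.rTensor_comp_apply]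

/-- The comodule `N ⊗_B A`. -/
def indComod : Comod k H :=
  .of (IndSpace φ) (coactionOfFamily A.X (indMk φ) (fun _ _ h => indMk_ext φ h) (indρ φ)
    fun _ _ => rfl)

/-- The map `a ↦ n ⊗ a` as a morphism of comodules. -/
def indHom (n : N) : A.X ⟶ indComod φ where
  lin := indMk φ n
  colinear _ := rfl

lemma jointlyEpi_indHom : JointlyEpi (indHom φ) := fun _ _ h => indMk_ext φ h

/-- The right action on `N ⊗_B A` as a linear map. -/
def indRactLin : IndSpace φ ⊗[k] A.X →ₗ[k] IndSpace φ :=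
  TensorProduct.lift (indLift φ
      (TensorProduct.curry (TensorProduct.curry ((balRel _ _).mkQ ∘ₗ (mulLin A).lTensor N ∘ₗ
        (TensorProduct.assoc k N A.X A.X).toLinearMap)))
      fun b n a => LinearMap.ext fun c => by
        change indMk φ (φ (tgtMap A (.op b)) n) (mulLin A (a ⊗ₜ c)) =
          indMk φ n (mulLin A (mulLin A (CoinvAlg.val A b ⊗ₜ a) ⊗ₜ c))
        -- The first factor is coinvariant, so (ba)c = b(ac) holds without reassociator.
        have h := mulLin_assoc (CoinvAlg.val A b ⊗ₜ a ⊗ₜ c)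
        rw [as_left b.val_mem, LinearMap.rTensor_tmul, LinearMap.lTensor_tmul] at h
        rw [indMk_tgt, h]; rfl)

/-- The right action on `N ⊗_B A`. -/
def indRact : indComod φ ⊗ A.X ⟶ indComod φ :=
  homOfFamily (JointlyEpi.whiskerRight (jointlyEpi_indHom φ) A.X) (indRactLin φ)
    (fun n => μ ≫ indHom φ n) fun n =>
      LinearMap.congr_fun (f := indRactLin φ ∘ₗ (indMk φ n).rTensor A.X)
        (g := indMk φ n ∘ₗ mulLin A) (TensorProduct.ext' fun _ _ => rfl)

lemma indRactLin_mk (n : N) (a c : A.X) :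
    indRactLin φ (indMk φ n a ⊗ₜ[k] c) = indMk φ n (mulLin A (a ⊗ₜ c)) := rfl

/-- The map `l ↦ c ↦ n ↦ l n ⊗ c`. -/
def indPair : LAlg A →ₗ[k] A.X →ₗ[k] N →ₗ[k] IndSpace φ :=
  LinearMap.lflip.toLinearMap ∘ₗ LinearMap.llcomp k N N _ (indMk φ) ∘ₗ φ.toLinearMap

include hff hGal in
-- By the structure theorem A ⊗ A is L ⊗_B A, so a map out of it may be prescribed on the products
-- lc.
lemma exists_indOrbit : ∃ f : A.X ⊗[k] A.X →ₗ[k] N →ₗ[k] IndSpace φ, ∀ (l : LAlg A) c n,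
    f (freeRact A (LAlg.val A l ⊗ₜ c)) n = indMk φ (φ l n) c := by
  obtain ⟨g, hg⟩ := (RMod.ofBimod (freeBimod A)).exists_of_coinvAct hff hGal
    (TensorProduct.lift (indPair φ)) fun b l c => LinearMap.ext fun n => by
      refine Eq.trans (b := indMk φ (φ (tgtMap A (.op b) * (show LAlg A from l)) n) c) ?_ ?_
      · exact congrArg (fun l => indMk φ (φ l n) c) (coinvRight_eq_tgt_mul _ l)
      · rw [map_mul]; exact indMk_tgt φ b _ c
  exact ⟨g, fun l c n => LinearMap.congr_fun (hg l c) n⟩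

/-- The map `l c ↦ (n ↦ l n ⊗ c)` from `A ⊗ A` to linear maps `N → N ⊗_B A`. -/
def indOrbit : A.X ⊗[k] A.X →ₗ[k] N →ₗ[k] IndSpace φ := (exists_indOrbit hff hGal φ).choose

lemma indOrbit_ract (l : LAlg A) (c : A.X) (n : N) :
    indOrbit hff hGal φ (freeRact A (LAlg.val A l ⊗ₜ c)) n = indMk φ (φ l n) c :=
  (exists_indOrbit hff hGal φ).choose_spec l c n

lemma indOrbit_one (n : N) (c : A.X) :
    indOrbit hff hGal φ (freeRact A ((unitElt A ⊗ₜ[k] unitElt A) ⊗ₜ c)) n =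
      indMk φ n c := by
  have := indOrbit_ract hff hGal φ 1 c n
  rw [map_one φ] at this
  exact this

lemma indOrbit_val (l : LAlg A) (n : N) :
    indOrbit hff hGal φ (LAlg.val A l) n = indMk φ (φ l n) (unitElt A) := by
  rw [← indOrbit_ract hff hGal]
  exact congrArg (indOrbit hff hGal φ · n) (freeRact_unitElt (LAlg.val A l)).symm

/-- It suffices to take y = l'c, where (l'c) · l = (l'l)c, so that both sides are l'ln ⊗ c. -/
lemma indOrbit_freeLR (y : A.X ⊗[k] A.X) (l : LAlg A) (n : N) :
    indOrbit hff hGal φ (freeLR A y (LAlg.val A l)) n = indOrbit hff hGal φ y (φ l n) := by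
  refine LinearMap.congr_fun (f := (indOrbit hff hGal φ).flip n ∘ₗ (freeLR A).flip (LAlg.val A l))
    (g := (indOrbit hff hGal φ).flip (φ l n)) (ext_freeRact hff hGal fun l' c => ?_) y
  change indOrbit hff hGal φ (freeLR A (freeRact A (LAlg.val A l' ⊗ₜ c)) _) n = indOrbit hff hGal φ
    (freeRact A (LAlg.val A l' ⊗ₜ c)) _
  rw [freeLR_freeRact, indOrbit_ract, indOrbit_ract, map_mul]
  rfl

/-- The map `indOrbit` as a family of morphisms of comodules. -/
def indOrbitHom (n : N) : (freeBimod A).X ⟶ indComod φ :=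
  homOfFamily ((RMod.ofBimod (freeBimod A)).jointlyEpi_coinvHom hff hGal)
    ((indOrbit hff hGal φ).flip n) (fun l : LAlg A => indHom φ (φ l n)) fun l c => by
      refine (congrArg ((indOrbit hff hGal φ).flip n)
        ((RMod.ofBimod (freeBimod A)).coinvHom_lin l.2 c)).trans ?_
      exact indOrbit_ract hff hGal φ l c n

/-- Already the elements (1 ⊗ 1)c of A ⊗ A reach every n ⊗ c. Thus N ⊗_B A is spanned by images of
the free bimodule and inherits its axioms. -/
lemma jointlyEpi_indOrbitHom : JointlyEpi (indOrbitHom hff hGal φ) := fun f g h =>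
  indMk_ext φ fun n c => by
    rw [← indOrbit_one hff hGal φ n c]
    exact h n _

/-- The left action on `N ⊗_B A` as a linear map. -/
def indLactLin : A.X ⊗[k] IndSpace φ →ₗ[k] IndSpace φ :=
  TensorProduct.lift (indLift φ
      (TensorProduct.curry (TensorProduct.curry (TensorProduct.lift (indOrbit hff hGal φ).flip ∘ₗ
        (TensorProduct.comm k A.X A.X).toLinearMap.lTensor N ∘ₗ
        (TensorProduct.assoc k N A.X A.X).toLinearMap)))
      fun b n a => LinearMap.ext fun c => by
        change indOrbit hff hGal φ (c ⊗ₜ a) (φ (tgtMap A (.op b)) n) =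
          indOrbit hff hGal φ (c ⊗ₜ (mulLin A (CoinvAlg.val A b ⊗ₜ a))) n
        -- The balanced relation holds because (c ⊗ a) · t(b) = c ⊗ ba.
        rw [← indOrbit_freeLR, freeLR_tmul_tgt]; rfl).flip

/-- The left action on `N ⊗_B A`. -/
def indLact : A.X ⊗ indComod φ ⟶ indComod φ :=
  homOfFamily (JointlyEpi.whiskerLeft (jointlyEpi_indHom φ) A.X) (indLactLin hff hGal φ)
    (indOrbitHom hff hGal φ) fun n =>
      LinearMap.congr_fun (f := indLactLin hff hGal φ ∘ₗ (indMk φ n).lTensor A.X)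
        (g := (indOrbit hff hGal φ).flip n) (TensorProduct.ext' fun _ _ => rfl)

lemma indLactLin_mk (n : N) (a c : A.X) :
    indLactLin hff hGal φ (a ⊗ₜ[k] indMk φ n c) = indOrbit hff hGal φ (a ⊗ₜ c) n := rfl

/-- The bimodule `N ⊗_B A`. -/
def indBimod : Bimod A A :=
  bimodOfFamily (freeBimod A) (jointlyEpi_indOrbitHom hff hGal φ) (indLact hff hGal φ) (indRact φ)
    (fun n => hom_ext' (TensorProduct.ext (LinearMap.ext fun a =>
      ext_freeRact hff hGal fun l c => by
        change indLactLin hff hGal φ (a ⊗ₜ[k] indOrbit hff hGal φ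
            (freeRact A (LAlg.val A l ⊗ₜ c)) n) =
          indOrbit hff hGal φ (freeLact A (a ⊗ₜ freeRact A (LAlg.val A l ⊗ₜ c))) n
        -- The element a(ln ⊗ c) is the orbit of a ⊗ c at ln, hence the orbit of (a ⊗ c) · l = a(lc)
        -- at n.
        rw [indOrbit_ract, indLactLin_mk, ← indOrbit_freeLR, freeLR_tmul_eq])))
    (fun n => hom_ext' (TensorProduct.ext (ext_freeRact hff hGal fun l c =>
      LinearMap.ext fun c' => by
        change indRactLin φ (indOrbit hff hGal φ
            (freeRact A (LAlg.val A l ⊗ₜ c)) n ⊗ₜ[k] c') =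
          indOrbit hff hGal φ (freeRact A (freeRact A (LAlg.val A l ⊗ₜ c) ⊗ₜ c')) n
        rw [indOrbit_ract, indRactLin_mk, ← indOrbit_ract hff hGal]
        exact congrArg (indOrbit hff hGal φ · n)
          (freeRact_coinv_left l c c').symm)))

/-- The bimodule map `l c ↦ l n ⊗ c`. -/
def indOrbitBimodHom (n : N) : freeBimod A ⟶ indBimod hff hGal φ where
  hom := indOrbitHom hff hGal φ n
  left_act_hom := hom_ext' (TensorProduct.ext (LinearMap.ext fun a =>
      ext_freeRact hff hGal fun l c => by
        change indOrbit hff hGal φ (freeLact A (a ⊗ₜ freeRact A (LAlg.val A l ⊗ₜ c))) n =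
          indLactLin hff hGal φ (a ⊗ₜ[k] indOrbit hff hGal φ
            (freeRact A (LAlg.val A l ⊗ₜ c)) n)
        rw [indOrbit_ract, indLactLin_mk, ← indOrbit_freeLR, freeLR_tmul_eq]))
  right_act_hom := hom_ext' (TensorProduct.ext (ext_freeRact hff hGal fun l c =>
      LinearMap.ext fun c' => by
        change indOrbit hff hGal φ
          (freeRact A (freeRact A (LAlg.val A l ⊗ₜ c) ⊗ₜ c')) n =
          indRactLin φ (indOrbit hff hGal φ
            (freeRact A (LAlg.val A l ⊗ₜ c)) n ⊗ₜ[k] c')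
        rw [indOrbit_ract, indRactLin_mk, ← indOrbit_ract hff hGal]
        exact congrArg (indOrbit hff hGal φ · n)
          (freeRact_coinv_left l c c')))

/-- The map `n ↦ n ⊗ 1` from `N` to the coinvariants of `N ⊗_B A`. -/
def indUnit : N →ₗ[k] coinv (indBimod hff hGal φ).X where
  toFun n := ⟨indMk φ n (unitElt A), map_mem_coinv (indHom φ n) unitElt_mem⟩
  map_add' n n' := Subtype.ext (LinearMap.congr_fun (map_add (indMk φ) n n') (unitElt A))
  map_smul' c n := Subtype.ext (LinearMap.congr_fun (map_smul (indMk φ) c n) (unitElt A))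

/-- By the faithful flatness criterion: the induced map N ⊗ A → N ⊗_B A is the quotient map itself,
so both hypotheses are immediate. -/
lemma indUnit_bijective : Function.Bijective (indUnit hff hGal φ) := by
  refine bijective_of_ract hff hGal (indBimod hff hGal φ) (φ.comp (tgtMap A)) (indUnit hff hGal φ)
    (fun b n => ?_) (balRel _ _).mkQ (fun n a => ?_) (Submodule.mkQ_surjective _) ?_
  · change indMk φ (φ (tgtMap A (.op b.unop)) n) (unitElt A) =
      indRactLin φ (indMk φ n (unitElt A) ⊗ₜ[k] CoinvAlg.val A b.unop)
    rw [indRactLin_mk, unitElt_mul, indMk_tgt]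
    exact congrArg (indMk φ n) (mul_unitElt _)
  · change indRactLin φ (indMk φ n (unitElt A) ⊗ₜ[k] a) = indMk φ n a
    rw [indRactLin_mk, unitElt_mul]
  · exact (Submodule.ker_mkQ (balRel (fun b => φ (tgtMap A (.op b))) (leftB A))).le

/-- The orbit map at n is a bimodule morphism from A ⊗ A that sends y in L to yn ⊗ 1. Such a
morphism commutes with the action of x, and x · (1 ⊗ 1) = x in A ⊗ A. -/
lemma indUnit_smul (x : LAlg A) (n : N) :
    indUnit hff hGal φ (φ x n) =
      (x • (show CoinvMod (indBimod hff hGal φ) from indUnit hff hGal φ n) :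
        CoinvMod (indBimod hff hGal φ)) := by
  refine CoinvMod.val_inj (indBimod hff hGal φ) ?_
  have h1 : ∀ y, indMk φ (φ y n) (unitElt A) =
      (indOrbitBimodHom hff hGal φ n).hom.lin (LAlg.val A y) := fun y =>
    (indOrbit_val hff hGal φ y n).symm
  have h2 : indMk φ n (unitElt A) = (indOrbitBimodHom hff hGal φ n).hom.lin (LAlg.val A 1) := by
    rw [← h1, map_one]; rfl
  refine (h1 x).trans (Eq.trans ?_
    (congrArg (actLR (indBimod hff hGal φ) (LAlg.val A x)) h2).symm)
  refine Eq.trans ?_ (actLR_hom (indOrbitBimodHom hff hGal φ n) _ _).symm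
  refine congrArg (indOrbit hff hGal φ · n) ?_
  exact (freeLR_one (LAlg.val A x)).symm.trans (freeLR_eq _ _)

end Induced

include hff hGal in
lemma coinvFunctor_essSurj : (coinvFunctor A).EssSurj where
  mem_essImage N := by
    let φ : LAlg A →ₐ[k] _ := smulHom N
    refine ⟨indBimod hff hGal φ, ⟨?_⟩⟩
    let f : N →ₗ[LAlg A] CoinvMod (indBimod hff hGal φ) :=
      { toFun := indUnit hff hGal φ
        map_add' := (indUnit hff hGal φ).map_add
        map_smul' := indUnit_smul hff hGal φ }
    exact (LinearEquiv.ofBijective f (indUnit_bijective hff hGal φ)).symm.toModuleIso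

include hff hGal in
theorem coinvFunctor_isEquivalence : (coinvFunctor A).IsEquivalence where
  faithful := coinvFunctor_faithful hff hGal
  full := coinvFunctor_full hff hGal
  essSurj := coinvFunctor_essSurj hff hGal

end
end

/-! ### The tensor product of bimodules through its canonical projection -/

noncomputable section

section
open CategoryTheory.Limits
variable {C : Type*} [Category C] [MonoidalCategory C] [HasCoequalizers C]
  [∀ X : C, PreservesColimitsOfSize.{0, 0} (tensorLeft X)]
  [∀ X : C, PreservesColimitsOfSize.{0, 0} (tensorRight X)]
  {A : Mon C} (M N P : Bimod A A)

lemma tensorProj_condition : M.actRight ▷ N.X ≫ tensorProj M N =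
    (α_ M.X A.X N.X).hom ≫ M.X ◁ N.actLeft ≫ tensorProj M N :=
  (coequalizer.condition _ _).trans (Category.assoc _ _ _)

variable {M N} in
lemma exists_tensorProj_desc {X : C} (f : M.X ⊗ N.X ⟶ X)
    (h : M.actRight ▷ N.X ≫ f = (α_ M.X A.X N.X).hom ≫ M.X ◁ N.actLeft ≫ f) :
    ∃ g : (M ⊗ N).X ⟶ X, tensorProj M N ≫ g = f :=
  ⟨coequalizer.desc f (h.trans (Category.assoc _ _ _).symm), coequalizer.π_desc _ _⟩

lemma tensorProj_actLeft : A.X ◁ tensorProj M N ≫ (M ⊗ N).actLeft =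
    (α_ A.X M.X N.X).inv ≫ M.actLeft ▷ N.X ≫ tensorProj M N :=
  Bimod.TensorBimod.whiskerLeft_π_actLeft M N

lemma tensorProj_actRight : tensorProj M N ▷ A.X ≫ (M ⊗ N).actRight =
    (α_ M.X N.X A.X).hom ≫ M.X ◁ N.actRight ≫ tensorProj M N :=
  Bimod.TensorBimod.π_tensor_id_actRight M N

lemma tensorProj_whiskerLeft {N' : Bimod A A} (f : N ⟶ N') :
    tensorProj M N ≫ (M ◁ f).hom = M.X ◁ f.hom ≫ tensorProj M N' :=
  ι_colimMap _ WalkingParallelPair.one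

lemma tensorProj_whiskerRight {M M' : Bimod A A} (f : M ⟶ M') :
    tensorProj M N ≫ (f ▷ N).hom = f.hom ▷ N.X ≫ tensorProj M' N :=
  ι_colimMap _ WalkingParallelPair.one

lemma tensorProj_leftUnitor : tensorProj (𝟙_ (Bimod A A)) M ≫ (λ_ M).hom.hom = M.actLeft :=
  coequalizer.π_desc _ _

lemma tensorProj_rightUnitor : tensorProj M (𝟙_ (Bimod A A)) ≫ (ρ_ M).hom.hom = M.actRight :=
  coequalizer.π_desc _ _

/-- The associator of bimodules is induced by that of the ambient category; this lets coherence be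
checked on representatives. -/
lemma tensorProj_associator :
    tensorProj M N ▷ P.X ≫ tensorProj (M ⊗ N) P ≫ (α_ M N P).hom.hom =
      (α_ M.X N.X P.X).hom ≫ M.X ◁ tensorProj N P ≫ tensorProj M (N ⊗ P) := by
  have h : tensorProj (M ⊗ N) P ≫ (α_ M N P).hom.hom =
    Bimod.AssociatorBimod.homAux M N P := coequalizer.π_desc _ _
  rw [h]
  exact π_tensor_id_preserves_coequalizer_inv_desc _ _ _ _

end
end

/-! ### Tensor products over B and over A on elements -/

noncomputable section

section
open CategoryTheory.Limits
variable {k B : Type u} [Field k] [Ring B] [Algebra k B]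

namespace AlgBimod

/-- The left action of an element on a bimodule over an algebra. -/
def actL (M : Bimod (monOf k B) (monOf k B)) (b : B) : Module.End k M.X :=
  M.actLeft.hom ∘ₗ TensorProduct.mk k B M.X b

/-- The right action of an element on a bimodule over an algebra. -/
def actR (M : Bimod (monOf k B) (monOf k B)) (b : B) : Module.End k M.X :=
  M.actRight.hom ∘ₗ (TensorProduct.mk k M.X B).flip b

/-- The projection `M ⊗ N → M ⊗_B N` as a linear map. -/
def proj (M N : Bimod (monOf k B) (monOf k B)) : M.X ⊗[k] N.X →ₗ[k] (M ⊗ N).X :=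
  (tensorProj M N).hom

/-- A bilinear map as a morphism of bimodules. -/
def homMk {M N : Bimod (monOf k B) (monOf k B)} (f : M.X →ₗ[k] N.X)
    (hl : ∀ b m, f (actL M b m) = actL N b (f m)) (hr : ∀ b m, f (actR M b m) = actR N b (f m)) :
    M ⟶ N where
  hom := ModuleCat.ofHom f
  left_act_hom := ModuleCat.hom_ext (TensorProduct.ext' hl)
  right_act_hom := ModuleCat.hom_ext (TensorProduct.ext' fun m b => hr b m)

/-- A bijective bilinear map as an isomorphism of bimodules. -/
def isoMk {M N : Bimod (monOf k B) (monOf k B)} (f : M ⟶ N) (hf : Function.Bijective f.hom.hom) :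
    M ≅ N :=
  Bimod.isoOfIso (LinearEquiv.ofBijective f.hom.hom hf).toModuleIso f.left_act_hom f.right_act_hom

variable {M N P : Bimod (monOf k B) (monOf k B)}

lemma hom_actL (f : M ⟶ N) (b : B) (m : M.X) :
    f.hom.hom (actL M b m) = actL N b (f.hom.hom m) :=
  LinearMap.congr_fun (congrArg ModuleCat.Hom.hom f.left_act_hom) (b ⊗ₜ m)

lemma hom_actR (f : M ⟶ N) (b : B) (m : M.X) :
    f.hom.hom (actR M b m) = actR N b (f.hom.hom m) :=
  LinearMap.congr_fun (congrArg ModuleCat.Hom.hom f.right_act_hom) (m ⊗ₜ b)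

variable (M N) in
lemma proj_surjective : Function.Surjective (proj M N) :=
  (ModuleCat.epi_iff_surjective (tensorProj M N)).1 (coequalizer.π_epi)

lemma proj_balanced (b : B) (m : M.X) (n : N.X) :
    proj M N (actR M b m ⊗ₜ n) = proj M N (m ⊗ₜ actL N b n) :=
  LinearMap.congr_fun (congrArg ModuleCat.Hom.hom (tensorProj_condition M N)) (m ⊗ₜ b ⊗ₜ n)

variable (M N) in
-- The quotient by the balanced relations also coequalizes the two actions, so its projection
-- factors through the categorical tensor product; this bounds the kernel.
lemma ker_proj : LinearMap.ker (proj M N) = balRel (actR M) (actL N) := by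
  refine le_antisymm ?_ (balRel_le_ker_iff.2 proj_balanced)
  obtain ⟨g, hg⟩ := exists_tensorProj_desc (M := M) (N := N)
    (X := ModuleCat.of k (BTensor (actR M) (actL N)))
    (ModuleCat.ofHom (balRel (actR M) (actL N)).mkQ) (ModuleCat.hom_ext <|
      TensorProduct.ext_threefold fun m b n =>
        (Submodule.Quotient.eq _).2 (sub_mem_balRel (B := B) b m n))
  intro x hx
  have h := LinearMap.congr_fun (congrArg ModuleCat.Hom.hom hg) x
  refine (Submodule.Quotient.mk_eq_zero _).1 (h.symm.trans ?_)
  exact (congrArg g.hom hx).trans (map_zero _)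

lemma hom_ext_proj {f g : M ⊗ N ⟶ P}
    (h : ∀ m n, f.hom.hom (proj M N (m ⊗ₜ n)) = g.hom.hom (proj M N (m ⊗ₜ n))) : f = g :=
  Bimod.Hom.ext <| ModuleCat.hom_ext <| (LinearMap.cancel_right (proj_surjective M N)).1 <|
    TensorProduct.ext' h

lemma hom_ext_proj₃ {Q : Bimod (monOf k B) (monOf k B)} {f g : (M ⊗ N) ⊗ P ⟶ Q}
    (h : ∀ m n p, f.hom.hom (proj _ _ (proj M N (m ⊗ₜ n) ⊗ₜ p)) =
      g.hom.hom (proj _ _ (proj M N (m ⊗ₜ n) ⊗ₜ p))) : f = g :=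
  hom_ext_proj fun x p => by
    obtain ⟨x, rfl⟩ := proj_surjective M N x
    exact LinearMap.congr_fun (f := f.hom.hom ∘ₗ proj _ _ ∘ₗ
        (TensorProduct.mk k _ _).flip p ∘ₗ proj M N)
      (g := g.hom.hom ∘ₗ proj _ _ ∘ₗ (TensorProduct.mk k _ _).flip p ∘ₗ proj M N)
      (TensorProduct.ext' fun m n => h m n p) x

lemma actL_proj (b : B) (m : M.X) (n : N.X) :
    actL (M ⊗ N) b (proj M N (m ⊗ₜ n)) = proj M N (actL M b m ⊗ₜ n) :=
  LinearMap.congr_fun (congrArg ModuleCat.Hom.hom (tensorProj_actLeft M N)) (b ⊗ₜ (m ⊗ₜ n))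

lemma actR_proj (b : B) (m : M.X) (n : N.X) :
    actR (M ⊗ N) b (proj M N (m ⊗ₜ n)) = proj M N (m ⊗ₜ actR N b n) :=
  LinearMap.congr_fun (congrArg ModuleCat.Hom.hom (tensorProj_actRight M N)) (m ⊗ₜ n ⊗ₜ b)

lemma whiskerLeft_proj (f : N ⟶ P) (m : M.X) (n : N.X) :
    (M ◁ f).hom.hom (proj M N (m ⊗ₜ n)) = proj M P (m ⊗ₜ f.hom.hom n) :=
  LinearMap.congr_fun (congrArg ModuleCat.Hom.hom (tensorProj_whiskerLeft M N f)) (m ⊗ₜ n)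

lemma whiskerRight_proj (f : M ⟶ P) (m : M.X) (n : N.X) :
    (f ▷ N).hom.hom (proj M N (m ⊗ₜ n)) = proj P N (f.hom.hom m ⊗ₜ n) :=
  LinearMap.congr_fun (congrArg ModuleCat.Hom.hom (tensorProj_whiskerRight N f)) (m ⊗ₜ n)

lemma associator_proj (m : M.X) (n : N.X) (p : P.X) :
    (α_ M N P).hom.hom.hom (proj _ _ (proj M N (m ⊗ₜ n) ⊗ₜ p)) =
      proj _ _ (m ⊗ₜ proj N P (n ⊗ₜ p)) :=
  LinearMap.congr_fun (congrArg ModuleCat.Hom.hom (tensorProj_associator M N P)) (m ⊗ₜ n ⊗ₜ p)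

lemma leftUnitor_proj (b : B) (m : M.X) :
    (λ_ M).hom.hom.hom (proj (𝟙_ (Bimod (monOf k B) (monOf k B))) M (b ⊗ₜ[k] m)) = actL M b m :=
  LinearMap.congr_fun (congrArg ModuleCat.Hom.hom (tensorProj_leftUnitor M)) (b ⊗ₜ m)

lemma rightUnitor_proj (b : B) (m : M.X) :
    (ρ_ M).hom.hom.hom (proj M (𝟙_ _) (m ⊗ₜ[k] b)) = actR M b m :=
  LinearMap.congr_fun (congrArg ModuleCat.Hom.hom (tensorProj_rightUnitor M)) (m ⊗ₜ b)

lemma exists_hom_proj (f : M.X ⊗[k] N.X →ₗ[k] P.X)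
    (hb : ∀ b m n, f (actR M b m ⊗ₜ n) = f (m ⊗ₜ actL N b n))
    (hl : ∀ b m n, f (actL M b m ⊗ₜ n) = actL P b (f (m ⊗ₜ n)))
    (hr : ∀ b m n, f (m ⊗ₜ actR N b n) = actR P b (f (m ⊗ₜ n))) :
    ∃ g : M ⊗ N ⟶ P, ∀ x, g.hom.hom (proj M N x) = f x := by
  obtain ⟨g, hg⟩ := exists_factor (proj M N) (proj_surjective M N) f
    (by rw [ker_proj]; exact balRel_le_ker_iff.2 hb)
  refine ⟨homMk g (fun b => ?_) (fun b => ?_), hg⟩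
  · refine LinearMap.congr_fun (f := g ∘ₗ actL (M ⊗ N) b) (g := actL P b ∘ₗ g)
      ((LinearMap.cancel_right (proj_surjective M N)).1 (TensorProduct.ext' fun m n => ?_))
    change g (actL (M ⊗ N) b (proj M N (m ⊗ₜ n))) = actL P b (g (proj M N (m ⊗ₜ n)))
    rw [actL_proj, hg, hg, hl]
  · refine LinearMap.congr_fun (f := g ∘ₗ actR (M ⊗ N) b) (g := actR P b ∘ₗ g)
      ((LinearMap.cancel_right (proj_surjective M N)).1 (TensorProduct.ext' fun m n => ?_))
    change g (actR (M ⊗ N) b (proj M N (m ⊗ₜ n))) = actR P b (g (proj M N (m ⊗ₜ n)))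
    rw [actR_proj, hg, hg, hr]

end AlgBimod
end

open Comod MonObj

section
open CategoryTheory.Limits
variable {k H : Type u} [Field k] [AddCommGroup H] [Module k H] [Coalgebra k H]
  [CoquasiBialgebra k H] {A : Mon (Comod k H)} {M N P : Bimod A A}

variable (M N) in
/-- The projection `M ⊗ N → M ⊗_A N` as a linear map. -/
def comodProj : M.X ⊗[k] N.X →ₗ[k] (M ⊗ N).X := (tensorProj M N).lin

variable (M N) in
-- The forgetful functor to vector spaces preserves colimits, hence epimorphisms.
lemma comodProj_surjective : Function.Surjective (comodProj M N) := by
  have : Epi (tensorProj M N) := coequalizer.π_epi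
  exact (ModuleCat.epi_iff_surjective ((Comod.forget k H).map (tensorProj M N))).1 inferInstance

lemma comodProj_condition (x : (M.X ⊗[k] A.X) ⊗[k] N.X) :
    comodProj M N ((ract M).rTensor N.X x) =
      comodProj M N ((lact N).lTensor M.X (as M.X A.X N.X x)) :=
  LinearMap.congr_fun (congrArg Hom.lin (tensorProj_condition M N)) x

/-- No colinearity of f is needed: the coequalizer of comodules is also one of vector spaces. -/
lemma exists_comodProj_desc {X : Type u} [AddCommGroup X] [Module k X]
    (f : M.X ⊗[k] N.X →ₗ[k] X) (h : ∀ x : (M.X ⊗[k] A.X) ⊗[k] N.X,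
      f ((ract M).rTensor N.X x) = f ((lact N).lTensor M.X (as M.X A.X N.X x))) :
    ∃ g : (M ⊗ N).X →ₗ[k] X, ∀ x, g (comodProj M N x) = f x := by
  let G := Comod.forget k H
  have hc := isColimitCoforkMapOfIsColimit G
    (coequalizer.condition (M.actRight ▷ N.X) ((α_ M.X A.X N.X).hom ≫ M.X ◁ N.actLeft))
    (coequalizerIsCoequalizer _ _)
  obtain ⟨g, hg⟩ := Cofork.IsColimit.desc' hc
    (ModuleCat.ofHom f : ModuleCat.of k (M.X ⊗[k] N.X) ⟶ ModuleCat.of k X)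
    (ModuleCat.hom_ext (LinearMap.ext h))
  exact ⟨g.hom, fun x => LinearMap.congr_fun (congrArg ModuleCat.Hom.hom hg) x⟩

lemma lact_comodProj (a : A.X) (m : M.X) (n : N.X) :
    lact (M ⊗ N) (a ⊗ₜ comodProj M N (m ⊗ₜ n)) =
      comodProj M N ((lact M).rTensor N.X ((as A.X M.X N.X).symm (a ⊗ₜ (m ⊗ₜ n)))) :=
  LinearMap.congr_fun (congrArg Hom.lin (tensorProj_actLeft M N)) (a ⊗ₜ (m ⊗ₜ n))

lemma ract_comodProj (m : M.X) (n : N.X) (a : A.X) :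
    ract (M ⊗ N) (comodProj M N (m ⊗ₜ n) ⊗ₜ a) =
      comodProj M N ((ract N).lTensor M.X (as M.X N.X A.X (m ⊗ₜ n ⊗ₜ a))) :=
  LinearMap.congr_fun (congrArg Hom.lin (tensorProj_actRight M N)) (m ⊗ₜ n ⊗ₜ a)

lemma whiskerLeft_comodProj (f : N ⟶ P) (m : M.X) (n : N.X) :
    (M ◁ f).hom.lin (comodProj M N (m ⊗ₜ n)) = comodProj M P (m ⊗ₜ f.hom.lin n) :=
  LinearMap.congr_fun (congrArg Hom.lin (tensorProj_whiskerLeft M N f)) (m ⊗ₜ n)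

lemma whiskerRight_comodProj (f : M ⟶ P) (m : M.X) (n : N.X) :
    (f ▷ N).hom.lin (comodProj M N (m ⊗ₜ n)) = comodProj P N (f.hom.lin m ⊗ₜ n) :=
  LinearMap.congr_fun (congrArg Hom.lin (tensorProj_whiskerRight N f)) (m ⊗ₜ n)

/-- Coinvariance of m removes the reassociator, which is why the coherence of the coinvariants
functor takes the same form as for B-bimodules. -/
lemma associator_comodProj {m : M.X} (hm : m ∈ coinv M.X) (n : N.X) (p : P.X) :
    (α_ M N P).hom.hom.lin (comodProj _ _ (comodProj M N (m ⊗ₜ n) ⊗ₜ p)) =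
      comodProj _ _ (m ⊗ₜ comodProj N P (n ⊗ₜ p)) := by
  have h : (α_ M N P).hom.hom.lin (comodProj _ _ (comodProj M N (m ⊗ₜ n) ⊗ₜ p)) =
      comodProj _ _ ((comodProj N P).lTensor M.X (as M.X N.X P.X (m ⊗ₜ n ⊗ₜ p))) :=
    LinearMap.congr_fun (congrArg Hom.lin (tensorProj_associator M N P)) (m ⊗ₜ n ⊗ₜ p)
  rw [h, as_left hm, LinearMap.lTensor_tmul]

lemma leftUnitor_comodProj (a : A.X) (m : M.X) :
    (λ_ M).hom.hom.lin (comodProj (𝟙_ (Bimod A A)) M (a ⊗ₜ[k] m)) = lact M (a ⊗ₜ m) :=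
  LinearMap.congr_fun (congrArg Hom.lin (tensorProj_leftUnitor M)) (a ⊗ₜ m)

lemma rightUnitor_comodProj (m : M.X) (a : A.X) :
    (ρ_ M).hom.hom.lin (comodProj M (𝟙_ _) (m ⊗ₜ[k] a)) = ract M (m ⊗ₜ a) :=
  LinearMap.congr_fun (congrArg Hom.lin (tensorProj_rightUnitor M)) (m ⊗ₜ a)

lemma comodProj_mem {m : M.X} (hm : m ∈ coinv M.X) {n : N.X} (hn : n ∈ coinv N.X) :
    comodProj M N (m ⊗ₜ n) ∈ coinv (M ⊗ N).X :=
  map_mem_coinv (tensorProj M N) (tmul_mem_coinv hm hn)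

lemma comodProj_coinv_left {m : M.X} (hm : m ∈ coinv M.X) (a : A.X) (n : N.X) :
    comodProj M N (ract M (m ⊗ₜ a) ⊗ₜ n) = comodProj M N (m ⊗ₜ lact N (a ⊗ₜ n)) := by
  have := comodProj_condition (m ⊗ₜ a ⊗ₜ n)
  rwa [as_left hm, LinearMap.lTensor_tmul, LinearMap.rTensor_tmul] at this

lemma ract_comodProj_coinv_left {m : M.X} (hm : m ∈ coinv M.X) (n : N.X) (a : A.X) :
    ract (M ⊗ N) (comodProj M N (m ⊗ₜ n) ⊗ₜ a) = comodProj M N (m ⊗ₜ ract N (n ⊗ₜ a)) := by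
  rw [ract_comodProj, as_left hm, LinearMap.lTensor_tmul]

end
end

/-! ### Transport of monoidal structures along an equivalence -/

section
open Functor.LaxMonoidal
variable {C D E : Type*} [Category C] [Category D] [Category E] [MonoidalCategory C]
  [MonoidalCategory E]

/-- A functor `U` is monoidal if its composition with a monoidal equivalence is. -/
lemma exists_monoidal_of_precomp [MonoidalCategory D] (e : C ≌ D) [e.functor.Monoidal]
    [e.inverse.Monoidal] [NatTrans.IsMonoidal e.unit] (U : D ⥤ E) {K : C ⥤ E} [K.Monoidal]
    (i : e.functor ⋙ U ≅ K) : ∃ (_ : U.Monoidal),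
      (∀ X Y, μ U (e.functor.obj X) (e.functor.obj Y) ≫ U.map (μ e.functor X Y) ≫
          i.hom.app (X ⊗ Y) = (i.hom.app X ⊗ₘ i.hom.app Y) ≫ μ K X Y) ∧
      ε U ≫ U.map (ε e.functor) ≫ i.hom.app (𝟙_ C) = ε K := by
  -- U is isomorphic to the composite of the monoidal functors e⁻¹ and K, so it receives a monoidal
  -- structure along j. That this structure is compatible with i rests on the monoidality of the
  -- unit of e.
  let j : e.inverse ⋙ K ≅ U := Functor.isoWhiskerLeft e.inverse i.symm ≪≫ e.invFunIdAssoc U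
  have hj : ∀ X, j.inv.app (e.functor.obj X) = i.hom.app X ≫ K.map (e.unit.app X) := fun X => by
    have : j.inv.app (e.functor.obj X) =
      (e.invFunIdAssoc U).inv.app (e.functor.obj X) ≫ i.hom.app _ := rfl
    rw [this, ← i.hom.naturality]
    simp [Equivalence.counitInv_app_functor]
  -- A triangle identity: on an object e(X), the isomorphism j is inverse to i followed by K of the
  -- unit.
  have hi : ∀ X, K.map (e.unit.app X) ≫ j.hom.app (e.functor.obj X) ≫ i.hom.app X = 𝟙 (K.obj X) := by
    intro X
    rw [← cancel_epi (i.hom.app X), ← Category.assoc, ← hj, Iso.inv_hom_id_app_assoc,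
      Category.comp_id]
  refine ⟨.transport j, fun X Y => ?_, ?_⟩
  · have hunit : (e.unit.app X ⊗ₘ e.unit.app Y) ≫ μ e.inverse (e.functor.obj X) (e.functor.obj Y) ≫
        e.inverse.map (μ e.functor X Y) = e.unit.app (X ⊗ Y) := by
      have := NatTrans.IsMonoidal.tensor (τ := e.unit) X Y
      rw [comp_μ, id_μ, Category.id_comp] at this
      exact this.symm
    have hn : j.hom.app (e.functor.obj X ⊗ e.functor.obj Y) ≫ U.map (μ e.functor X Y) =
        K.map (e.inverse.map (μ e.functor X Y)) ≫ j.hom.app (e.functor.obj (X ⊗ Y)) :=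
      (j.hom.naturality (μ e.functor X Y)).symm
    have h2 : ((i.hom.app X ≫ K.map (e.unit.app X)) ⊗ₘ (i.hom.app Y ≫ K.map (e.unit.app Y))) ≫
        (μ K _ _ ≫ K.map (μ e.inverse _ _)) ≫ j.hom.app (e.functor.obj X ⊗ e.functor.obj Y) ≫
          U.map (μ e.functor X Y) ≫ i.hom.app (X ⊗ Y) =
        (i.hom.app X ⊗ₘ i.hom.app Y) ≫ μ K X Y := by
      rw [reassoc_of% hn, ← tensorHom_comp_tensorHom]
      simp only [Category.assoc]
      rw [μ_natural_assoc, ← K.map_comp_assoc, ← K.map_comp_assoc, Category.assoc, hunit, hi,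
        Category.comp_id]
    rw [← hj, ← hj] at h2
    refine Eq.trans ?_ h2
    rw [Functor.Monoidal.transport_μ, comp_μ]
    simp only [Category.assoc]
    rfl
  · have hunit : ε e.inverse ≫ e.inverse.map (ε e.functor) = e.unit.app (𝟙_ C) := by
      have := NatTrans.IsMonoidal.unit (τ := e.unit)
      rw [comp_ε, id_ε, Category.id_comp] at this
      exact this.symm
    have hn : j.hom.app (𝟙_ D) ≫ U.map (ε e.functor) =
        K.map (e.inverse.map (ε e.functor)) ≫ j.hom.app (e.functor.obj (𝟙_ C)) :=
      (j.hom.naturality (ε e.functor)).symm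
    have h2 : (ε K ≫ K.map (ε e.inverse)) ≫ j.hom.app (𝟙_ D) ≫ U.map (ε e.functor) ≫
        i.hom.app (𝟙_ C) = ε K := by
      rw [reassoc_of% hn]
      simp only [Category.assoc]
      rw [← K.map_comp_assoc, hunit, hi, Category.comp_id]
    refine Eq.trans ?_ h2
    rw [Functor.Monoidal.transport_ε, comp_ε]
    simp only [Category.assoc]

/-- A monoidal structure can be transported along an equivalence of categories over a monoidal
category. -/
theorem exists_transport (F : C ⥤ D) [F.IsEquivalence] (U : D ⥤ E) {K : C ⥤ E} [K.Monoidal]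
    (i : F ⋙ U ≅ K) : ∃ (_ : MonoidalCategory D) (_ : F.Monoidal) (_ : U.Monoidal),
      (∀ X Y, μ U (F.obj X) (F.obj Y) ≫ U.map (μ F X Y) ≫ i.hom.app (X ⊗ Y) =
        (i.hom.app X ⊗ₘ i.hom.app Y) ≫ μ K X Y) ∧
      ε U ≫ U.map (ε F) ≫ i.hom.app (𝟙_ C) = ε K := by
  let e := F.asEquivalence
  exact ⟨Monoidal.transport e,
    (inferInstance : (Monoidal.equivalenceTransported e).functor.Monoidal),
    exists_monoidal_of_precomp (Monoidal.equivalenceTransported e) U i⟩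

/-- A monoidal structure on a composition `F ⋙ U`, where `F` is an equivalence of categories,
comes from monoidal structures on the middle category and on both functors. -/
theorem exists_monoidal_of_comp (F : C ⥤ D) [F.IsEquivalence] (U : D ⥤ E)
    (K : (F ⋙ U).CoreMonoidal) :
    ∃ (_ : MonoidalCategory D) (_ : F.Monoidal) (_ : U.Monoidal),
      (∀ X Y, μ U (F.obj X) (F.obj Y) ≫ U.map (μ F X Y) = (K.μIso X Y).hom) ∧
      ε U ≫ U.map (ε F) = K.εIso.hom := by
  let _ : (F ⋙ U).Monoidal := K.toMonoidal
  obtain ⟨i₁, i₂, i₃, hμ, hε⟩ := exists_transport F U (Iso.refl (F ⋙ U))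
  refine ⟨i₁, i₂, i₃, fun X Y => ?_, ?_⟩
  -- The comparison isomorphism is the identity, so it drops out of the compatibility.
  · have h := hμ X Y
    simp only [Iso.refl_hom, NatTrans.id_app, Functor.comp_obj, Category.comp_id,
      id_tensorHom_id, Category.id_comp] at h
    exact h
  · have h := hε
    simp only [Iso.refl_hom, NatTrans.id_app, Functor.comp_obj, Category.comp_id] at h
    exact h

end

/-! ### The canonical constraint M^{co H} ⊗_B N^{co H} → (M ○_A N)^{co H} -/

noncomputable section

section
variable {k B : Type u} [Field k] [Ring B] [Algebra k B]

/-- The right action on a bimodule over an algebra as an algebra map. -/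
def AlgBimod.actRHom (M : Bimod (monOf k B) (monOf k B)) : Bᵐᵒᵖ →ₐ[k] Module.End k M.X :=
  AlgHom.ofLinearMap
    { toFun := fun b => actR M b.unop
      map_add' := fun a b => map_add (TensorProduct.curry M.actRight.hom).flip a.unop b.unop
      map_smul' := fun c b => map_smul (TensorProduct.curry M.actRight.hom).flip c b.unop }
    (LinearMap.ext fun m => by
      have h : M.actRight.hom (m ⊗ₜ algebraMap k B 1) = (1 : k) • m :=
        LinearMap.congr_fun (congrArg ModuleCat.Hom.hom M.actRight_one) (m ⊗ₜ (1 : k))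
      rw [map_one, one_smul] at h
      exact h)
    fun a b => LinearMap.ext fun m =>
      LinearMap.congr_fun (congrArg ModuleCat.Hom.hom M.right_assoc) (m ⊗ₜ (b.unop ⊗ₜ a.unop))

end

open Comod MonObj AlgBimod

section
variable {k H : Type u} [Field k] [AddCommGroup H] [Module k H] [Coalgebra k H]

section
variable [CoquasiBialgebra k H] {A : Mon (Comod k H)}

variable (A) in
/-- The functor of coinvariants from bimodules in the category of comodules to bimodules over the
algebra of coinvariants. -/
abbrev coinvBimod : Bimod A A ⥤ Bimod (monOf k (CoinvAlg A)) (monOf k (CoinvAlg A)) :=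
  coinvFunctor A ⋙ forgetL A

variable (M N P : Bimod A A)

/-- The inclusion of the coinvariants. -/
def coinvVal : ((coinvBimod A).obj M).X →ₗ[k] M.X where
  toFun := CoinvMod.val M
  map_add' := (CoinvMod.val M).map_add
  map_smul' := CoinvMod.val_algebraMap_smul M

variable {M N P}

lemma coinvVal_mem (m : ((coinvBimod A).obj M).X) : coinvVal M m ∈ coinv M.X := m.2

lemma coinvVal_inj {m n : ((coinvBimod A).obj M).X} (h : coinvVal M m = coinvVal M n) : m = n :=
  Subtype.ext h

/-- A linear map with values in the coinvariants. -/
def coinvCod {V : Type*} [AddCommGroup V] [Module k V] (f : V →ₗ[k] M.X)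
    (hf : ∀ v, f v ∈ coinv M.X) : V →ₗ[k] ((coinvBimod A).obj M).X where
  toFun v := ⟨f v, hf v⟩
  map_add' v w := coinvVal_inj (f.map_add v w)
  map_smul' c v := coinvVal_inj ((f.map_smul c v).trans
    (LinearMap.map_smul (coinvVal M) c ⟨f v, hf v⟩).symm)

lemma coinvVal_map (f : M ⟶ N) (m : ((coinvBimod A).obj M).X) :
    coinvVal N (((coinvBimod A).map f).hom.hom m) = f.hom.lin (coinvVal M m) := rfl

lemma coinvVal_actL (b : CoinvAlg A) (m : ((coinvBimod A).obj M).X) :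
    coinvVal M (actL _ b m) = lact M (CoinvAlg.val A b ⊗ₜ coinvVal M m) :=
  actLR_src b (coinvVal M m)

lemma coinvVal_actR (b : CoinvAlg A) (m : ((coinvBimod A).obj M).X) :
    coinvVal M (actR _ b m) = ract M (coinvVal M m ⊗ₜ CoinvAlg.val A b) :=
  actLR_tgt (.op b) (coinvVal M m)

lemma lact_ract_coinv {a : A.X} (ha : a ∈ coinv A.X) (m : M.X) (c : A.X) :
    lact M (a ⊗ₜ ract M (m ⊗ₜ c)) = ract M (lact M (a ⊗ₜ m) ⊗ₜ c) := by
  have h := middle_assoc (M := M) (a ⊗ₜ m ⊗ₜ c)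
  rw [as_left ha, LinearMap.lTensor_tmul, LinearMap.rTensor_tmul] at h
  exact h.symm

lemma lact_lact_coinv {a : A.X} (ha : a ∈ coinv A.X) (c : A.X) (m : M.X) :
    lact M (a ⊗ₜ lact M (c ⊗ₜ m)) = lact M (mulLin A (a ⊗ₜ c) ⊗ₜ m) := by
  have h := lact_assoc (M := M) (a ⊗ₜ c ⊗ₜ m)
  rw [as_left ha, LinearMap.lTensor_tmul, LinearMap.rTensor_tmul] at h
  exact h.symm

variable (M N) in
-- Balancedness and bilinearity over B are the strict identities for coinvariant elements.
lemma exists_coinvMu : ∃ f : (coinvBimod A).obj M ⊗ (coinvBimod A).obj N ⟶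
    (coinvBimod A).obj (M ⊗ N), ∀ m n, coinvVal _ (f.hom.hom (proj _ _ (m ⊗ₜ n))) =
      comodProj M N (coinvVal M m ⊗ₜ coinvVal N n) := by
  have hmem : ∀ x, (comodProj M N ∘ₗ TensorProduct.map (coinvVal M) (coinvVal N)) x ∈
      coinv (M ⊗ N).X := fun x => by
    induction x with
    | zero => rw [map_zero]; exact zero_mem _
    | add x y hx hy => rw [map_add]; exact add_mem hx hy
    | tmul m n => exact comodProj_mem (coinvVal_mem m) (coinvVal_mem n)
  refine Exists.imp (fun g hg m n => congrArg (coinvVal (M ⊗ N)) (hg (m ⊗ₜ n)))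
    (exists_hom_proj (M := (coinvBimod A).obj M) (N := (coinvBimod A).obj N)
    (P := (coinvBimod A).obj (M ⊗ N)) (coinvCod (M := M ⊗ N)
      (comodProj M N ∘ₗ TensorProduct.map (coinvVal M) (coinvVal N)) hmem)
    (fun b m n => coinvVal_inj ?_) (fun b m n => coinvVal_inj ?_) fun b m n => coinvVal_inj ?_)
  · change comodProj M N (coinvVal M (actR _ b m) ⊗ₜ coinvVal N n) =
      comodProj M N (coinvVal M m ⊗ₜ coinvVal N (actL _ b n))
    rw [coinvVal_actL, coinvVal_actR, comodProj_coinv_left (coinvVal_mem m)]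
  · rw [coinvVal_actL]
    change comodProj M N (coinvVal M (actL _ b m) ⊗ₜ coinvVal N n) =
      lact (M ⊗ N) (CoinvAlg.val A b ⊗ₜ comodProj M N (coinvVal M m ⊗ₜ coinvVal N n))
    rw [lact_comodProj, coinvVal_actL, ← as_left b.val_mem, LinearEquiv.symm_apply_apply,
      LinearMap.rTensor_tmul]
  · rw [coinvVal_actR]
    change comodProj M N (coinvVal M m ⊗ₜ coinvVal N (actR _ b n)) =
      ract (M ⊗ N) (comodProj M N (coinvVal M m ⊗ₜ coinvVal N n) ⊗ₜ CoinvAlg.val A b)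
    rw [ract_comodProj_coinv_left (coinvVal_mem m), coinvVal_actR]

variable (M N) in
/-- The canonical map `M^{co H} ⊗_B N^{co H} → (M ⊗_A N)^{co H}`. -/
def coinvMu : (coinvBimod A).obj M ⊗ (coinvBimod A).obj N ⟶ (coinvBimod A).obj (M ⊗ N) :=
  (exists_coinvMu M N).choose

lemma coinvVal_coinvMu (m : ((coinvBimod A).obj M).X) (n : ((coinvBimod A).obj N).X) :
    coinvVal (M ⊗ N) ((coinvMu M N).hom.hom (proj _ _ (m ⊗ₜ n))) =
      comodProj M N (coinvVal M m ⊗ₜ coinvVal N n) :=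
  (exists_coinvMu M N).choose_spec m n

end

section Bijective
variable [CoquasiHopfAlgebra k H] {A : Mon (Comod k H)}
  (hff : IsLeftFaithfullyFlat (leftB A)) (hGal : IsGaloisExt A) (M N : Bimod A A)
include hff hGal

lemma exists_of_ract {X : Type u} [AddCommGroup X] [Module k X]
    (f : ((coinvBimod A).obj M).X →ₗ[k] A.X →ₗ[k] X)
    (hf : ∀ b m a, f (actR _ b m) a = f m (leftB A b a)) :
    ∃ g : M.X →ₗ[k] X, ∀ m a, g (ract M (coinvVal M m ⊗ₜ a)) = f m a := by
  obtain ⟨g, hg⟩ := (RMod.ofBimod M).exists_of_coinvAct hff hGal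
    (TensorProduct.lift (f ∘ₗ coinvCod (M := M) (coinv M.X).subtype fun v => v.2)) fun b m a => by
      refine Eq.trans ?_ (hf b m a)
      exact congrArg (fun m => f m a) (coinvRight_eq_tgt_smul M (.op b) m)
  exact ⟨g, hg⟩

lemma ext_coinvVal {X : Type u} [AddCommGroup X] [Module k X] {f g : M.X →ₗ[k] X}
    (h : ∀ m a, f (ract M (coinvVal M m ⊗ₜ a)) = g (ract M (coinvVal M m ⊗ₜ a))) : f = g :=
  ext_ract hff hGal M h

/-- This is the injective half of (M^{co H} ⊗_B N^{co H}) ⊗_B A ≅ M ○_A N, as a universal property.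
The structure theorem for N, then for M, extends q to M and N; the result must then be shown to be
A-balanced. -/
lemma exists_comodProj_of_ract {Z : Type u} [AddCommGroup Z] [Module k Z]
    (q : ((coinvBimod A).obj M).X →ₗ[k] ((coinvBimod A).obj N).X →ₗ[k] A.X →ₗ[k] Z)
    (hq : ∀ b m n, q (actR _ b m) n = q m (actL _ b n))
    (hq' : ∀ b m n a, q m (actR _ b n) a = q m n (leftB A b a)) :
    ∃ s : (M ⊗ N).X →ₗ[k] Z, ∀ m n a,
      s (comodProj M N (coinvVal M m ⊗ₜ ract N (coinvVal N n ⊗ₜ a))) = q m n a := by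
  -- G extends q in its N-argument: G(na)(m) = q(m, n, a).
  obtain ⟨G, hG⟩ := exists_of_ract hff hGal N
    (X := ((coinvBimod A).obj M).X →ₗ[k] Z) (LinearMap.lflip.toLinearMap ∘ₗ q.flip)
    fun b n a => LinearMap.ext fun m => hq' b m n a
  have hG1 : ∀ m n a, G (ract N (coinvVal N n ⊗ₜ a)) m = q m n a := fun m n a =>
    LinearMap.congr_fun (hG n a) m
  have hG2 : ∀ b m x, G (lact N (CoinvAlg.val A b ⊗ₜ x)) m = G x (actR _ b m) := fun b m x => by
    refine LinearMap.congr_fun (f := LinearMap.applyₗ m ∘ₗ G ∘ₗ lact N ∘ₗ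
      TensorProduct.mk k _ _ (CoinvAlg.val A b)) (g := LinearMap.applyₗ (actR _ b m) ∘ₗ G)
      (ext_coinvVal hff hGal N fun n a => ?_) x
    change G (lact N (CoinvAlg.val A b ⊗ₜ ract N (coinvVal N n ⊗ₜ a))) m =
      G (ract N (coinvVal N n ⊗ₜ a)) (actR _ b m)
    rw [lact_ract_coinv b.val_mem, ← coinvVal_actL, hG1, hG1, hq]
  -- S extends in the M-argument by S(ma)(x) = G(ax)(m), as forced by (ma) ○ x = m ○ ax.
  obtain ⟨S, hS⟩ := exists_of_ract hff hGal M (X := N.X →ₗ[k] Z)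
    ((LinearMap.llcomp k N.X N.X Z).compl₁₂ G.flip (TensorProduct.curry (lact N)))
    fun b m a => LinearMap.ext fun x => by
      change G (lact N (a ⊗ₜ x)) (actR _ b m) = G (lact N (mulLin A (_ ⊗ₜ a) ⊗ₜ x)) m
      rw [← hG2, lact_lact_coinv b.val_mem]
  replace hS : ∀ m a x, S (ract M (coinvVal M m ⊗ₜ a)) x = G (lact N (a ⊗ₜ x)) m :=
    fun m a x => LinearMap.congr_fun (hS m a) x
  obtain ⟨s, hs⟩ := exists_comodProj_desc (M := M) (N := N) (TensorProduct.lift S) fun x => by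
    refine LinearMap.congr_fun (f := TensorProduct.lift S ∘ₗ (ract M).rTensor N.X)
      (g := TensorProduct.lift S ∘ₗ (lact N).lTensor M.X ∘ₗ (as M.X A.X N.X).toLinearMap) ?_ x
    refine TensorProduct.ext (TensorProduct.ext (ext_coinvVal hff hGal M fun m c =>
      LinearMap.ext fun a => LinearMap.ext fun n => ?_))
    change S (ract M (ract M (coinvVal M m ⊗ₜ c) ⊗ₜ a)) n =
      TensorProduct.lift S ((lact N).lTensor M.X
        (as M.X A.X N.X (ract M (coinvVal M m ⊗ₜ c) ⊗ₜ a ⊗ₜ n)))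
    -- Since c ↦ mc is colinear, the reassociator on mc ⊗ a ⊗ n is carried over from that on c ⊗ a ⊗
    -- n; A-balancedness then becomes associativity of the left action on N.
    obtain ⟨J, hJ⟩ : ∃ J : A.X ⟶ M.X, ∀ c, J.lin c = ract M (coinvVal M m ⊗ₜ c) :=
      ⟨_, (RMod.ofBimod M).coinvHom_lin (coinvVal_mem m)⟩
    have hn : as M.X A.X N.X (ract M (coinvVal M m ⊗ₜ c) ⊗ₜ a ⊗ₜ n) =
        J.lin.rTensor _ (as A.X A.X N.X (c ⊗ₜ a ⊗ₜ n)) := by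
      rw [← hJ]
      have := as_natural J (𝟙 A.X) (𝟙 N.X) c a n
      refine this.trans ?_
      congr 1
      exact congrArg _ TensorProduct.map_id
    have hk : ∀ w : A.X ⊗[k] (A.X ⊗[k] N.X), TensorProduct.lift S ((lact N).lTensor M.X
        (J.lin.rTensor _ w)) = G (lact N ((lact N).lTensor A.X w)) m := fun w => by
      induction w with
      | zero => simp
      | add x y hx hy => simp only [map_add, LinearMap.add_apply, hx, hy]
      | tmul c x =>
        rw [LinearMap.rTensor_tmul, LinearMap.lTensor_tmul, LinearMap.lTensor_tmul, hJ]
        exact hS m c _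
    rw [hn, hk, ← lact_assoc, ract_coinv_left (coinvVal_mem m), hS]
    rfl
  refine ⟨s, fun m n a => ?_⟩
  rw [hs, ← hG1]
  have h := hS m (unitElt A) (ract N (coinvVal N n ⊗ₜ a))
  rw [unitElt_lact, ract_unitElt] at h
  exact h

/-- Because (ma) ○ n = m ○ an and N is spanned by the products na, the elements m ○ na span M ○_A N.
-/
lemma comodProj_induction {X : Type u} [AddCommGroup X] [Module k X]
    {f g : (M ⊗ N).X →ₗ[k] X}
    (h : ∀ m n a, f (comodProj M N (coinvVal M m ⊗ₜ ract N (coinvVal N n ⊗ₜ a))) =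
      g (comodProj M N (coinvVal M m ⊗ₜ ract N (coinvVal N n ⊗ₜ a)))) : f = g := by
  have h1 : ∀ m, f ∘ₗ comodProj M N ∘ₗ TensorProduct.mk k M.X N.X (coinvVal M m) =
      g ∘ₗ comodProj M N ∘ₗ TensorProduct.mk k M.X N.X (coinvVal M m) := fun m =>
    ext_coinvVal hff hGal N fun n a => h m n a
  refine (LinearMap.cancel_right (comodProj_surjective M N)).1 (TensorProduct.ext ?_)
  refine ext_coinvVal hff hGal M fun m a => LinearMap.ext fun n => ?_
  change f (comodProj M N (ract M (coinvVal M m ⊗ₜ a) ⊗ₜ n)) =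
    g (comodProj M N (ract M (coinvVal M m ⊗ₜ a) ⊗ₜ n))
  rw [comodProj_coinv_left (coinvVal_mem m)]
  exact LinearMap.congr_fun (h1 m) (lact N (a ⊗ₜ n))

/-- By the faithful flatness criterion it suffices that (m ⊗ n) ⊗ a ↦ m ○ na is onto M ○_A N with
kernel inside the balanced relations. -/
lemma coinvMu_bijective : Function.Bijective (coinvMu M N).hom.hom := by
  let K := coinvBimod A
  let Y : Type u := (K.obj M ⊗ K.obj N).X
  let f : Y →ₗ[k] coinv (M ⊗ N).X :=
    { toFun := (coinvMu M N).hom.hom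
      map_add' := (coinvMu M N).hom.hom.map_add
      map_smul' := fun c y => coinvVal_inj (M := M ⊗ N) <|
        (congrArg (coinvVal (M ⊗ N)) ((coinvMu M N).hom.hom.map_smul c y)).trans
          ((coinvVal (M ⊗ N)).map_smul c _) }
  let p : Y ⊗[k] A.X →ₗ[k] (M ⊗ N).X := ract (M ⊗ N) ∘ₗ
    ((coinvVal (M ⊗ N) ∘ₗ (coinvMu M N).hom.hom).rTensor A.X)
  have hp : ∀ m n a, p (proj (K.obj M) (K.obj N) (m ⊗ₜ n) ⊗ₜ a) =
      comodProj M N (coinvVal M m ⊗ₜ ract N (coinvVal N n ⊗ₜ a)) := fun m n a => by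
    rw [← ract_comodProj_coinv_left (coinvVal_mem m), ← coinvVal_coinvMu]
    rfl
  refine bijective_of_ract hff hGal (M ⊗ N) (actRHom (K.obj M ⊗ K.obj N)) f (fun b y => ?_) p
    (fun y a => rfl) ?_ ?_
  · exact (congrArg (coinvVal (M ⊗ N)) (hom_actR (coinvMu M N) b.unop y)).trans
      (coinvVal_actR _ _)
  -- Surjectivity: the quotient of M ○_A N by the range vanishes on the spanning elements m ○ na.
  · rw [← LinearMap.range_eq_top, ← Submodule.ker_mkQ (LinearMap.range p)]
    refine LinearMap.ker_eq_top.2 (comodProj_induction hff hGal M N fun m n a => ?_)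
    rw [← hp]
    exact (Submodule.Quotient.mk_eq_zero _).2 (LinearMap.mem_range_self _ _)
  · let R : Submodule k (Y ⊗[k] A.X) :=
      balRel (fun b => actRHom (K.obj M ⊗ K.obj N) (.op b)) (leftB A)
    let q : (K.obj M).X →ₗ[k] (K.obj N).X →ₗ[k] A.X →ₗ[k] (Y ⊗[k] A.X) ⧸ R :=
      TensorProduct.curry (TensorProduct.curry R.mkQ ∘ₗ proj (K.obj M) (K.obj N))
    -- The left inverse of p modulo balanced relations sends m ○ na to the class of (m ⊗ n) ⊗ a.
    obtain ⟨s, hs⟩ := exists_comodProj_of_ract hff hGal M N q (fun b m n => by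
        exact congrArg (TensorProduct.curry R.mkQ) (proj_balanced b m n))
      fun b m n a => by
        have h1 : q m (actR _ b n) a =
            R.mkQ (actR (K.obj M ⊗ K.obj N) b (proj (K.obj M) (K.obj N) (m ⊗ₜ n)) ⊗ₜ a) := by
          rw [actR_proj]; rfl
        rw [h1]
        exact (Submodule.Quotient.eq _).2 (sub_mem_balRel _ _ _)
    have h2 : s ∘ₗ p = R.mkQ := by
      refine TensorProduct.ext ((LinearMap.cancel_right
        (proj_surjective (K.obj M) (K.obj N))).1 (TensorProduct.ext' fun m n =>
          LinearMap.ext fun a => ?_))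
      exact (congrArg s (hp m n a)).trans (hs m n a)
    intro x hx
    have h3 := LinearMap.congr_fun h2 x
    rw [LinearMap.comp_apply, LinearMap.mem_ker.1 hx, map_zero] at h3
    exact (Submodule.Quotient.mk_eq_zero _).1 h3.symm

end Bijective
end
end

/-! ### The coinvariants functor is strong monoidal -/

noncomputable section

open Comod MonObj AlgBimod

section
variable {k H : Type u} [Field k] [AddCommGroup H] [Module k H] [Coalgebra k H]

section
variable [CoquasiBialgebra k H] {A : Mon (Comod k H)}

variable (A) in
/-- The map `B → A^{co H}`, `b ↦ b`. -/
def coinvEps : 𝟙_ (Bimod (monOf k (CoinvAlg A)) (monOf k (CoinvAlg A))) ⟶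
    (coinvBimod A).obj (𝟙_ (Bimod A A)) :=
  homMk (M := 𝟙_ (Bimod (monOf k (CoinvAlg A)) (monOf k (CoinvAlg A))))
    (N := (coinvBimod A).obj (𝟙_ (Bimod A A)))
    (coinvCod (M := 𝟙_ (Bimod A A)) (CoinvAlg.val A) fun b => b.val_mem)
    (fun b c => coinvVal_inj (M := 𝟙_ (Bimod A A)) (by
      refine Eq.trans ?_ (coinvVal_actL (M := 𝟙_ (Bimod A A)) b _).symm
      rfl))
    fun b c => coinvVal_inj (M := 𝟙_ (Bimod A A)) (by
      refine Eq.trans ?_ (coinvVal_actR (M := 𝟙_ (Bimod A A)) b _).symm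
      rfl)

lemma coinvEps_bijective : Function.Bijective (coinvEps A).hom.hom :=
  ⟨fun _ _ h => CoinvAlg.val_inj (congrArg (coinvVal (𝟙_ (Bimod A A))) h),
    fun b => ⟨⟨b.1, b.2⟩, rfl⟩⟩

end

variable [CoquasiHopfAlgebra k H] {A : Mon (Comod k H)}
  (hff : IsLeftFaithfullyFlat (leftB A)) (hGal : IsGaloisExt A)

/-- The monoidal structure on the functor of coinvariants. -/
def coinvCoreMonoidal : (coinvBimod A).CoreMonoidal where
  εIso := isoMk (coinvEps A) coinvEps_bijective
  μIso M N := isoMk (coinvMu M N) (coinvMu_bijective hff hGal M N)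
  μIso_hom_natural_left {M N} f P := hom_ext_proj fun m p => by
    refine coinvVal_inj (M := N ⊗ P) ?_
    change coinvVal (N ⊗ P) ((coinvMu N P).hom.hom (((coinvBimod A).map f ▷ _).hom.hom
      (proj _ _ (m ⊗ₜ p)))) = (f ▷ P).hom.lin (coinvVal (M ⊗ P) ((coinvMu M P).hom.hom
        (proj _ _ (m ⊗ₜ p))))
    rw [whiskerRight_proj, coinvVal_coinvMu, coinvVal_coinvMu, coinvVal_map, whiskerRight_comodProj]
  μIso_hom_natural_right {M N} P f := hom_ext_proj fun p m => by
    refine coinvVal_inj (M := P ⊗ N) ?_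
    change coinvVal (P ⊗ N) ((coinvMu P N).hom.hom ((_ ◁ (coinvBimod A).map f).hom.hom
      (proj _ _ (p ⊗ₜ m)))) = (P ◁ f).hom.lin (coinvVal (P ⊗ M) ((coinvMu P M).hom.hom
        (proj _ _ (p ⊗ₜ m))))
    rw [whiskerLeft_proj, coinvVal_coinvMu, coinvVal_coinvMu, coinvVal_map, whiskerLeft_comodProj]
  associativity M N P := hom_ext_proj₃ fun m n p => by
    refine coinvVal_inj (M := M ⊗ (N ⊗ P)) ?_
    change (α_ M N P).hom.hom.lin (coinvVal ((M ⊗ N) ⊗ P) ((coinvMu (M ⊗ N) P).hom.hom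
        ((coinvMu M N ▷ _).hom.hom
          (proj _ _ (proj _ _ (m ⊗ₜ n) ⊗ₜ p))))) =
      coinvVal (M ⊗ (N ⊗ P)) ((coinvMu M (N ⊗ P)).hom.hom ((_ ◁ coinvMu N P).hom.hom
        ((α_ ((coinvBimod A).obj M) ((coinvBimod A).obj N) ((coinvBimod A).obj P)).hom.hom.hom
          (proj _ _ (proj _ _ (m ⊗ₜ n) ⊗ₜ p)))))
    rw [associator_proj, whiskerLeft_proj, whiskerRight_proj, coinvVal_coinvMu, coinvVal_coinvMu,
      coinvVal_coinvMu, coinvVal_coinvMu, associator_comodProj (coinvVal_mem m)]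
  left_unitality M := hom_ext_proj fun b m => by
    refine coinvVal_inj (M := M) ?_
    have h := (congrArg (coinvVal (𝟙_ (Bimod A A) ⊗ M) ∘ (coinvMu (𝟙_ (Bimod A A)) M).hom.hom)
      (whiskerRight_proj (coinvEps A) b m)).trans (coinvVal_coinvMu _ m)
    refine Eq.trans ?_ (congrArg (λ_ M).hom.hom.lin h).symm
    refine Eq.trans ?_ (leftUnitor_comodProj (CoinvAlg.val A b) (coinvVal M m)).symm
    exact (congrArg (coinvVal M) (leftUnitor_proj (B := CoinvAlg A) b m)).trans (coinvVal_actL b m)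
  right_unitality M := hom_ext_proj fun m b => by
    refine coinvVal_inj (M := M) ?_
    have h := (congrArg (coinvVal (M ⊗ 𝟙_ (Bimod A A)) ∘ (coinvMu M (𝟙_ (Bimod A A))).hom.hom)
      (whiskerLeft_proj (coinvEps A) m b)).trans (coinvVal_coinvMu m _)
    refine Eq.trans ?_ (congrArg (ρ_ M).hom.hom.lin h).symm
    refine Eq.trans ?_ (rightUnitor_comodProj (coinvVal M m) (CoinvAlg.val A b)).symm
    exact (congrArg (coinvVal M) (rightUnitor_proj (B := CoinvAlg A) b m)).trans (coinvVal_actR b m)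

end
end

/-! ### Tensor products of L-modules seen over B -/

noncomputable section

section
open AlgBimod Functor.LaxMonoidal
variable {k B L : Type u} [Field k] [Ring B] [Algebra k B] [Ring L] [Algebra k L]

/-- The vector space underlying an `L`-module. -/
abbrev resMod (k : Type u) {L : Type u} [Field k] [Ring L] [Algebra k L] (N : ModuleCat.{u} L) :
    ModuleCat.{u} k :=
  (ModuleCat.restrictScalars (algebraMap k L)).obj N

/-- The `k`-linear map underlying a morphism of `L`-modules. -/
def resHom (k : Type u) {L : Type u} [Field k] [Ring L] [Algebra k L] {N P : ModuleCat.{u} L}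
    (f : N ⟶ P) : resMod k N →ₗ[k] resMod k P :=
  ((ModuleCat.restrictScalars (algebraMap k L)).map f).hom

lemma resHom_smulHom {N P : ModuleCat.{u} L} (f : N ⟶ P) (x : L) (n : resMod k N) :
    resHom k f (smulHom N x n) = smulHom P x (resHom k f n) :=
  f.hom.map_smul x n

/-- The map `x ↦ x n`. -/
def orbitLin {N : ModuleCat.{u} L} (n : resMod k N) : L →ₗ[k] resMod k N :=
  (smulHom N).toLinearMap.flip n

/-- The morphism `x ↦ x n` from the regular module. -/
def orbitHom {N : ModuleCat.{u} L} (n : resMod k N) : ModuleCat.of L L ⟶ N :=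
  ModuleCat.ofHom (LinearMap.toSpanSingleton L N n)

/-- The regular module as a vector space. -/
def regEquiv (k L : Type u) [Field k] [Ring L] [Algebra k L] : L ≃ₗ[k] resMod k (ModuleCat.of L L) where
  toFun x := x
  map_add' _ _ := rfl
  map_smul' c x := Algebra.smul_def c x
  invFun x := x
  left_inv _ := rfl
  right_inv _ := rfl

lemma smulHom_regEquiv (x y : L) : smulHom (ModuleCat.of L L) x (regEquiv k L y) =
    regEquiv k L (x * y) := rfl

variable {s : B →ₐ[k] L} {t : Bᵐᵒᵖ →ₐ[k] L} (h : ∀ b c, Commute (s b) (t c))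

variable [MonoidalCategory (ModuleCat.{u} L)] [(forgetBimod s t h).Monoidal]

lemma bijective_of_isIso {M N : Bimod (monOf k B) (monOf k B)} (f : M ⟶ N) [IsIso f] :
    Function.Bijective f.hom.hom := by
  refine ⟨Function.LeftInverse.injective (g := (inv f).hom.hom) fun x => ?_,
    Function.RightInverse.surjective (g := (inv f).hom.hom) fun x => ?_⟩
  · exact LinearMap.congr_fun (congrArg (fun g => g.hom.hom) (IsIso.hom_inv_id f)) x
  · exact LinearMap.congr_fun (congrArg (fun g => g.hom.hom) (IsIso.inv_hom_id f)) x

lemma forgetMu_surjective (N N' : ModuleCat.{u} L) : Function.Surjective (forgetMu h N N') :=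
  (bijective_of_isIso (μ (forgetBimod s t h) N N')).2.comp (proj_surjective _ _)

/-- The constraint of U is an isomorphism, so only the relations of ⊗_B contribute. -/
lemma ker_forgetMu (N N' : ModuleCat.{u} L) : LinearMap.ker (forgetMu h N N') =
    balRel (fun b => smulHom (k := k) N (t (.op b))) (fun b => smulHom (k := k) N' (s b)) := by
  refine Eq.trans ?_ (ker_proj ((forgetBimod s t h).obj N) ((forgetBimod s t h).obj N'))
  exact LinearMap.ker_comp_of_ker_eq_bot _ (LinearMap.ker_eq_bot.2
    (bijective_of_isIso (μ (forgetBimod s t h) N N')).1)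

variable {N N' P : ModuleCat.{u} L}

lemma forgetMu_balanced (b : B) (n : resMod k N) (n' : resMod k N') :
    forgetMu h N N' (smulHom N (t (.op b)) n ⊗ₜ n') = forgetMu h N N' (n ⊗ₜ smulHom N' (s b) n') :=
  congrArg (μ (forgetBimod s t h) N N').hom.hom
    (proj_balanced (M := (forgetBimod s t h).obj N) (N := (forgetBimod s t h).obj N') b n n')

lemma smulHom_src_forgetMu (b : B) (n : resMod k N) (n' : resMod k N') :
    smulHom (N ⊗ N') (s b) (forgetMu h N N' (n ⊗ₜ n')) =
      forgetMu h N N' (smulHom N (s b) n ⊗ₜ n') :=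
  ((hom_actL (μ (forgetBimod s t h) N N') b _).symm.trans
    (congrArg (μ (forgetBimod s t h) N N').hom.hom (actL_proj (M := (forgetBimod s t h).obj N)
      (N := (forgetBimod s t h).obj N') b n n')))

lemma smulHom_tgt_forgetMu (b : B) (n : resMod k N) (n' : resMod k N') :
    smulHom (N ⊗ N') (t (.op b)) (forgetMu h N N' (n ⊗ₜ n')) =
      forgetMu h N N' (n ⊗ₜ smulHom N' (t (.op b)) n') :=
  ((hom_actR (μ (forgetBimod s t h) N N') b _).symm.trans
    (congrArg (μ (forgetBimod s t h) N N').hom.hom (actR_proj (M := (forgetBimod s t h).obj N)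
      (N := (forgetBimod s t h).obj N') b n n')))

lemma forgetMu_natural_left (f : N ⟶ P) (n : resMod k N) (n' : resMod k N') :
    resHom k (f ▷ N') (forgetMu h N N' (n ⊗ₜ n')) = forgetMu h P N' (resHom k f n ⊗ₜ n') := by
  have h1 := μ_natural_left (forgetBimod s t h) f N'
  have h2 := LinearMap.congr_fun (congrArg (fun g => g.hom.hom) h1)
    (proj ((forgetBimod s t h).obj N) ((forgetBimod s t h).obj N') (n ⊗ₜ n'))
  refine h2.symm.trans ?_
  exact congrArg (μ (forgetBimod s t h) P N').hom.hom
    (whiskerRight_proj (N := (forgetBimod s t h).obj N') ((forgetBimod s t h).map f) n n')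

lemma forgetMu_natural_right (f : N' ⟶ P) (n : resMod k N) (n' : resMod k N') :
    resHom k (N ◁ f) (forgetMu h N N' (n ⊗ₜ n')) = forgetMu h N P (n ⊗ₜ resHom k f n') := by
  have h1 := μ_natural_right (forgetBimod s t h) N f
  have h2 := LinearMap.congr_fun (congrArg (fun g => g.hom.hom) h1)
    (proj ((forgetBimod s t h).obj N) ((forgetBimod s t h).obj N') (n ⊗ₜ n'))
  refine h2.symm.trans ?_
  exact congrArg (μ (forgetBimod s t h) N P).hom.hom
    (whiskerLeft_proj (M := (forgetBimod s t h).obj N) ((forgetBimod s t h).map f) n n')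

lemma forgetMu_associator (n : resMod k N) (n' : resMod k N') (p : resMod k P) :
    resHom k (α_ N N' P).hom (forgetMu h _ _ (forgetMu h N N' (n ⊗ₜ n') ⊗ₜ p)) =
      forgetMu h _ _ (n ⊗ₜ forgetMu h N' P (n' ⊗ₜ p)) := by
  let U := forgetBimod s t h
  have h1 := associativity U N N' P
  have h2 := LinearMap.congr_fun (congrArg (fun g => g.hom.hom) h1)
    (proj _ _ (proj (U.obj N) (U.obj N') (n ⊗ₜ n') ⊗ₜ p))
  have h3 := congrArg (resHom k (α_ N N' P).hom ∘ (μ U (N ⊗ N') P).hom.hom)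
    (whiskerRight_proj (N := U.obj P) (μ U N N') (proj (U.obj N) (U.obj N') (n ⊗ₜ n')) p)
  refine h3.symm.trans (h2.trans ?_)
  have h4 := congrArg ((μ U N (N' ⊗ P)).hom.hom ∘ (U.obj N ◁ μ U N' P).hom.hom)
    (associator_proj (M := U.obj N) (N := U.obj N') (P := U.obj P) n n' p)
  refine h4.trans ?_
  exact congrArg (μ U N (N' ⊗ P)).hom.hom
    (whiskerLeft_proj (M := U.obj N) (μ U N' P) n (proj (U.obj N') (U.obj P) (n' ⊗ₜ p)))

lemma forgetMu_leftUnitor (b : B) (n : resMod k N) :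
    resHom k (λ_ N).hom (forgetMu h _ _ (forgetEps h b ⊗ₜ n)) = smulHom N (s b) n := by
  let U := forgetBimod s t h
  have h2 := LinearMap.congr_fun (congrArg (fun g => g.hom.hom) (left_unitality U N))
    (proj _ (U.obj N) (b ⊗ₜ[k] n))
  have h3 := congrArg (resHom k (λ_ N).hom ∘ (μ U (𝟙_ _) N).hom.hom)
    (whiskerRight_proj (N := U.obj N) (ε U) b n)
  exact h3.symm.trans (h2.symm.trans (leftUnitor_proj (M := U.obj N) b n))

lemma forgetMu_rightUnitor (b : B) (n : resMod k N) :
    resHom k (ρ_ N).hom (forgetMu h _ _ (n ⊗ₜ forgetEps h b)) = smulHom N (t (.op b)) n := by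
  let U := forgetBimod s t h
  have h2 := LinearMap.congr_fun (congrArg (fun g => g.hom.hom) (right_unitality U N))
    (proj (U.obj N) _ (n ⊗ₜ[k] b))
  have h3 := congrArg (resHom k (ρ_ N).hom ∘ (μ U N (𝟙_ _)).hom.hom)
    (whiskerLeft_proj (M := U.obj N) (ε U) n b)
  exact h3.symm.trans (h2.symm.trans (rightUnitor_proj (M := U.obj N) b n))

lemma forgetEps_bijective : Function.Bijective (forgetEps h) :=
  bijective_of_isIso (ε (forgetBimod s t h))

lemma smulHom_src_forgetEps (b c : B) :
    smulHom (𝟙_ (ModuleCat.{u} L)) (s b) (forgetEps h c) = forgetEps h (b * c) :=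
  (hom_actL (ε (forgetBimod s t h)) b c).symm

lemma smulHom_tgt_forgetEps (b c : B) :
    smulHom (𝟙_ (ModuleCat.{u} L)) (t (.op b)) (forgetEps h c) = forgetEps h (c * b) :=
  (hom_actR (ε (forgetBimod s t h)) b c).symm

variable (k L) in
/-- The class of `1 ⊗ 1`. -/
def muOne : resMod k (ModuleCat.of L L ⊗ ModuleCat.of L L) :=
  forgetMu h _ _ (regEquiv k L 1 ⊗ₜ regEquiv k L 1)

/-- The map `x ⊗ y ↦ x ⊗ y` from `L ⊗ L` to the tensor product of regular modules. -/
def regMu : L ⊗[k] L →ₗ[k] resMod k (ModuleCat.of L L ⊗ ModuleCat.of L L) :=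
  forgetMu h _ _ ∘ₗ diagAct _ _ (regEquiv k L 1) (regEquiv k L 1)

lemma regMu_tmul (x y : L) :
    regMu h (x ⊗ₜ y) = forgetMu h _ _ (regEquiv k L x ⊗ₜ regEquiv k L y) := by
  have h1 : regMu h (x ⊗ₜ y) = forgetMu h _ _ (regEquiv k L (x * 1) ⊗ₜ regEquiv k L (y * 1)) := rfl
  rw [h1, mul_one, mul_one]

lemma regMu_eq : regMu h = forgetMu h _ _ ∘ₗ
    (TensorProduct.congr (regEquiv k L) (regEquiv k L)).toLinearMap :=
  TensorProduct.ext' (regMu_tmul h)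

lemma regMu_surjective : Function.Surjective (regMu h) := by
  rw [regMu_eq]
  exact (forgetMu_surjective h _ _).comp (LinearEquiv.surjective _)

/-- For the regular modules the balanced relations are exactly those defining L ⊗_B L, so that the
tensor square of the regular module is a model of L ⊗_B L. -/
lemma ker_regMu : LinearMap.ker (regMu h) = balRel (tgtAct t) (srcAct s) := by
  refine le_antisymm (fun x hx => ?_) (balRel_le_ker_iff.2 fun b x y => ?_)
  · rw [regMu_eq] at hx
    have h1 : TensorProduct.congr (regEquiv k L) (regEquiv k L) x ∈
        LinearMap.ker (forgetMu h _ _) := hx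
    rw [ker_forgetMu] at h1
    have h2 := map_mem_balRel (r' := tgtAct t) (l' := srcAct s)
      (f := (regEquiv k L).symm.toLinearMap) (g := (regEquiv k L).symm.toLinearMap)
      (fun b n => rfl) (fun b n => rfl) h1
    have h3 : TensorProduct.map (regEquiv k L).symm.toLinearMap (regEquiv k L).symm.toLinearMap
        (TensorProduct.congr (regEquiv k L) (regEquiv k L) x) = x :=
      (TensorProduct.congr (regEquiv k L) (regEquiv k L)).symm_apply_apply x
    rwa [h3] at h2
  · rw [regMu_tmul, regMu_tmul]
    exact forgetMu_balanced h b (regEquiv k L x) (regEquiv k L y)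

/-- If `x (1 ⊗ 1)` is the class of `z`, then `x` acts as `z` on all tensor products. -/
lemma smulHom_forgetMu {x : L} {z : L ⊗[k] L}
    (hz : regMu h z = smulHom _ x (muOne k L h)) (n : resMod k N) (n' : resMod k N') :
    smulHom (N ⊗ N') x (forgetMu h N N' (n ⊗ₜ n')) = forgetMu h N N' (diagAct N N' n n' z) := by
  -- F is the L-linear map induced by x ↦ xn and y ↦ yn'. It carries 1 ⊗ 1 to n ⊗ n', and so
  -- transfers the known action of x on 1 ⊗ 1.
  let F := resHom k (N ◁ orbitHom n') ∘ₗ resHom k (orbitHom n ▷ ModuleCat.of L L)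
  have hF : ∀ x y, F (forgetMu h _ _ (regEquiv k L x ⊗ₜ regEquiv k L y)) =
      forgetMu h N N' (smulHom N x n ⊗ₜ smulHom N' y n') := fun x y => by
    refine (congrArg (resHom k (N ◁ orbitHom n')) (forgetMu_natural_left h _ _ _)).trans ?_
    exact forgetMu_natural_right h (orbitHom n') (smulHom N x n) (regEquiv k L y)
  have h1 : F ∘ₗ regMu h = forgetMu h N N' ∘ₗ diagAct N N' n n' := TensorProduct.ext' fun x y => by
    rw [LinearMap.comp_apply, regMu_tmul, hF]; rfl
  have h2 : F (smulHom _ x (muOne k L h)) = smulHom _ x (F (muOne k L h)) := by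
    refine (congrArg (resHom k (N ◁ orbitHom n')) (resHom_smulHom _ _ _)).trans ?_
    exact resHom_smulHom _ _ _
  have h3 : F (muOne k L h) = forgetMu h N N' (n ⊗ₜ n') := by
    refine (hF 1 1).trans ?_
    rw [map_one, map_one]; rfl
  rw [← h3, ← h2, ← hz]
  exact LinearMap.congr_fun h1 z

end
end

/-! ### The bialgebroid structure recovered from the monoidal structure -/

noncomputable section

section
open Functor.LaxMonoidal
variable {k B L : Type u} [Field k] [Ring B] [Algebra k B] [Ring L] [Algebra k L]
  {s : B →ₐ[k] L} {t : Bᵐᵒᵖ →ₐ[k] L} (h : ∀ b c, Commute (s b) (t c))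
  [MonoidalCategory (ModuleCat.{u} L)] [(forgetBimod s t h).Monoidal]

/-- The tensor product `L ⊗_B L` as the tensor product of the regular modules. -/
def regMuEquiv : BTensor (tgtAct (k := k) t) (srcAct s) ≃ₗ[k]
    resMod k (ModuleCat.of L L ⊗ ModuleCat.of L L) :=
  (Submodule.quotEquivOfEq _ _ (ker_regMu h).symm).trans
    ((regMu h).quotKerEquivOfSurjective (regMu_surjective h))

lemma regMuEquiv_mk (z : L ⊗[k] L) : regMuEquiv h ((balRel _ _).mkQ z) = regMu h z := rfl

/-- The comultiplication. -/
def bialgComul : L →ₗ[k] BTensor (tgtAct (k := k) t) (srcAct s) :=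
  (regMuEquiv h).symm.toLinearMap ∘ₗ orbitLin (muOne k L h)

lemma regMuEquiv_comul (x : L) :
    regMuEquiv h (bialgComul h x) = smulHom _ x (muOne k L h) :=
  (regMuEquiv h).apply_symm_apply _

lemma mkQ_eq_comul_iff {x : L} {z : L ⊗[k] L} :
    (balRel (tgtAct t) (srcAct s)).mkQ z = bialgComul h x ↔
      regMu h z = smulHom _ x (muOne k L h) := by
  rw [← regMuEquiv_comul, ← regMuEquiv_mk, (regMuEquiv h).injective.eq_iff]

/-- The unit constraint as an equivalence. -/
def epsEquiv : B ≃ₗ[k] resMod k (𝟙_ (ModuleCat.{u} L)) :=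
  LinearEquiv.ofBijective (forgetEps h) (forgetEps_bijective h)

/-- The counit. -/
def bialgCounit : L →ₐ[k] Module.End k B :=
  ((epsEquiv h).symm.conjAlgEquiv k).toAlgHom.comp (smulHom (𝟙_ (ModuleCat.{u} L)))

lemma forgetEps_counit (x : L) (b : B) :
    forgetEps h (bialgCounit h x b) = smulHom (𝟙_ (ModuleCat.{u} L)) x (forgetEps h b) :=
  (epsEquiv h).apply_symm_apply _

/-- The case of regular modules of `smulHom_forgetMu`: left multiplication by a representative of
Δ(x) is the action of x. Both the Takeuchi condition and multiplicativity of Δ come from this. -/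
lemma mkQ_mul_right {x : L} {z : L ⊗[k] L} (hz : regMu h z = smulHom _ x (muOne k L h))
    (w : L ⊗[k] L) : regMu h (z * w) = smulHom _ x (regMu h w) := by
  refine LinearMap.congr_fun (f := regMu h ∘ₗ LinearMap.mulLeft k z)
    (g := smulHom _ x ∘ₗ regMu h) (TensorProduct.ext' fun u v => ?_) w
  change regMu h (z * (u ⊗ₜ v)) = smulHom _ x (regMu h (u ⊗ₜ v))
  rw [regMu_tmul, smulHom_forgetMu h hz]
  clear hz
  refine LinearMap.congr_fun (f := regMu h ∘ₗ LinearMap.mulRight k (u ⊗ₜ v))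
    (g := forgetMu h _ _ ∘ₗ diagAct _ _ (regEquiv k L u) (regEquiv k L v))
    (TensorProduct.ext' fun x y => ?_) z
  change regMu h ((x ⊗ₜ y) * (u ⊗ₜ v)) = _
  rw [Algebra.TensorProduct.tmul_mul_tmul, regMu_tmul]
  rfl

/-- The map `x ⊗ y ⊗ z ↦ x ⊗ (y ⊗ z)`. -/
def tripleMu : L ⊗[k] (L ⊗[k] L) →ₗ[k]
    resMod k (ModuleCat.of L L ⊗ (ModuleCat.of L L ⊗ ModuleCat.of L L)) :=
  forgetMu h _ _ ∘ₗ TensorProduct.map (regEquiv k L).toLinearMap (regMu h)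

lemma tripleMu_tmul (x : L) (y : L ⊗[k] L) :
    tripleMu h (x ⊗ₜ y) = forgetMu h _ _ (regEquiv k L x ⊗ₜ regMu h y) := rfl

/-- A left inverse modulo the relations is built by descending twice: the relations between the last
two factors let the quotient map factor through L ⊗_B L, and those between the first two let it
factor through the outer tensor product. -/
lemma ker_tripleMu_le : LinearMap.ker (tripleMu h) ≤ tripleRel (k := k) s t := by
  let Q := tripleRel (k := k) s t
  let q : L →ₗ[k] L ⊗[k] L →ₗ[k] (L ⊗[k] (L ⊗[k] L)) ⧸ Q := TensorProduct.curry Q.mkQ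
  obtain ⟨g, hg⟩ := exists_factor (regMu h) (regMu_surjective h) q.flip (by
    rw [ker_regMu]
    refine balRel_le_ker_iff.2 fun b v w => LinearMap.ext fun u => ?_
    exact (Submodule.Quotient.eq _).2 (Submodule.subset_span (Or.inr ⟨b, u, v, w, rfl⟩)))
  obtain ⟨f, hf⟩ := exists_factor (forgetMu h _ _) (forgetMu_surjective h _ _)
    (TensorProduct.lift (g.flip ∘ₗ (regEquiv k L).symm.toLinearMap)) (by
      rw [ker_forgetMu]
      refine balRel_le_ker_iff.2 fun b u y => ?_
      obtain ⟨y, rfl⟩ := regMu_surjective h y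
      obtain ⟨u, rfl⟩ := (regEquiv k L).surjective u
      change g (regMu h y) (t (.op b) * u) = g (smulHom _ (s b) (regMu h y)) u
      refine LinearMap.congr_fun (f := LinearMap.applyₗ (t (.op b) * u) ∘ₗ g ∘ₗ regMu h)
        (g := LinearMap.applyₗ u ∘ₗ g ∘ₗ smulHom _ (s b) ∘ₗ regMu h)
        (TensorProduct.ext' fun v w => ?_) y
      change g (regMu h (v ⊗ₜ w)) (t (.op b) * u) = g (smulHom _ (s b) (regMu h (v ⊗ₜ w))) u
      have h1 : smulHom _ (s b) (regMu h (v ⊗ₜ w)) = regMu h ((s b * v) ⊗ₜ w) := by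
        rw [regMu_tmul, regMu_tmul]
        exact smulHom_src_forgetMu h b _ _
      rw [h1, hg, hg]
      exact (Submodule.Quotient.eq _).2 (Submodule.subset_span (Or.inl ⟨b, u, v, w, rfl⟩)))
  have h2 : f ∘ₗ tripleMu h = Q.mkQ := TensorProduct.ext' fun u y => by
    rw [LinearMap.comp_apply, tripleMu_tmul, hf]
    exact LinearMap.congr_fun (hg y) u
  intro x hx
  have h3 := LinearMap.congr_fun h2 x
  rw [LinearMap.comp_apply, LinearMap.mem_ker.1 hx, map_zero] at h3
  exact (Submodule.Quotient.mk_eq_zero _).1 h3.symm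

/-- Since Δ(v) is v · (1 ⊗ 1), applying Δ to the second leg of a representative of Δ(x) is the
diagonal action of x on 1 ⊗ (1 ⊗ 1). -/
lemma tripleMu_of_lTensor {x : L} {z : L ⊗[k] L} {w : L ⊗[k] (L ⊗[k] L)}
    (hz : regMu h z = smulHom _ x (muOne k L h))
    (hw : (balRel (tgtAct t) (srcAct s)).mkQ.lTensor L w = (bialgComul h).lTensor L z) :
    tripleMu h w = smulHom _ x (forgetMu h _ _ (regEquiv k L 1 ⊗ₜ muOne k L h)) := by
  have h1 := congrArg (forgetMu h _ _ ∘ₗ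
    TensorProduct.map (regEquiv k L).toLinearMap (regMuEquiv h).toLinearMap) hw
  refine Eq.trans ?_ (h1.trans ?_)
  · exact LinearMap.congr_fun (f := tripleMu h) (g := (forgetMu h _ _ ∘ₗ TensorProduct.map
      (regEquiv k L).toLinearMap (regMuEquiv h).toLinearMap) ∘ₗ
        (balRel (tgtAct t) (srcAct s)).mkQ.lTensor L)
      (TensorProduct.ext' fun u y => rfl) w
  · rw [smulHom_forgetMu h hz]
    refine LinearMap.congr_fun (f := (forgetMu h _ _ ∘ₗ TensorProduct.map
      (regEquiv k L).toLinearMap (regMuEquiv h).toLinearMap) ∘ₗ (bialgComul h).lTensor L)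
      (g := forgetMu h _ _ ∘ₗ diagAct _ _ (regEquiv k L 1) (muOne k L h))
      (TensorProduct.ext' fun u v => ?_) z
    change forgetMu h _ _ (regEquiv k L u ⊗ₜ regMuEquiv h (bialgComul h v)) =
      forgetMu h _ _ (regEquiv k L (u * 1) ⊗ₜ smulHom _ v (muOne k L h))
    rw [regMuEquiv_comul, mul_one]

/-- The same for the first leg, with (1 ⊗ 1) ⊗ 1; L-linearity of the associator moves the result to
1 ⊗ (1 ⊗ 1), giving the value already obtained from the other leg. -/
lemma tripleMu_of_rTensor {x : L} {z : L ⊗[k] L} {w : (L ⊗[k] L) ⊗[k] L}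
    (hz : regMu h z = smulHom _ x (muOne k L h))
    (hw : (balRel (tgtAct t) (srcAct s)).mkQ.rTensor L w = (bialgComul h).rTensor L z) :
    tripleMu h (TensorProduct.assoc k L L L w) =
      smulHom _ x (forgetMu h _ _ (regEquiv k L 1 ⊗ₜ muOne k L h)) := by
  let a := resHom k (α_ (ModuleCat.of L L) (ModuleCat.of L L) (ModuleCat.of L L)).hom
  let F := a ∘ₗ forgetMu h _ _ ∘ₗ
    TensorProduct.map (regMuEquiv h).toLinearMap (regEquiv k L).toLinearMap
  refine Eq.trans ?_ ((congrArg F hw).trans ?_)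
  · refine LinearMap.congr_fun (f := tripleMu h ∘ₗ (TensorProduct.assoc k L L L).toLinearMap)
      (g := F ∘ₗ (balRel (tgtAct t) (srcAct s)).mkQ.rTensor L)
      (TensorProduct.ext_threefold fun u v y => ?_) w
    change tripleMu h (u ⊗ₜ (v ⊗ₜ y)) =
      a (forgetMu h _ _ (regMu h (u ⊗ₜ v) ⊗ₜ regEquiv k L y))
    rw [tripleMu_tmul, regMu_tmul, regMu_tmul, forgetMu_associator]
  · have h1 : forgetMu h _ _ (regEquiv k L 1 ⊗ₜ muOne k L h) =
        a (forgetMu h _ _ (muOne k L h ⊗ₜ regEquiv k L 1)) :=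
      (forgetMu_associator h _ _ _).symm
    rw [h1, ← resHom_smulHom, smulHom_forgetMu h hz]
    refine LinearMap.congr_fun (f := F ∘ₗ (bialgComul h).rTensor L)
      (g := a ∘ₗ forgetMu h _ _ ∘ₗ diagAct _ _ (muOne k L h) (regEquiv k L 1))
      (TensorProduct.ext' fun u v => ?_) z
    change a (forgetMu h _ _ (regMuEquiv h (bialgComul h u) ⊗ₜ regEquiv k L v)) =
      a (forgetMu h _ _ (smulHom _ u (muOne k L h) ⊗ₜ regEquiv k L (v * 1)))
    rw [regMuEquiv_comul, mul_one]

/-- A monoidal structure on the modules over an algebra `L` such that the forgetful functor to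
`B`-bimodules is monoidal makes `L` a `×_B`-bialgebra. -/
def takeuchiOfMonoidal : TakeuchiBialgebra s t where
  comul := bialgComul h
  counit := bialgCounit h
  comul_src b := by
    refine ((mkQ_eq_comul_iff h).2 ?_).symm
    rw [regMu_tmul]
    refine Eq.trans ?_ (smulHom_src_forgetMu h b _ _).symm
    rw [smulHom_regEquiv, mul_one]
  comul_tgt b := by
    refine ((mkQ_eq_comul_iff h).2 ?_).symm
    rw [regMu_tmul]
    refine Eq.trans ?_ (smulHom_tgt_forgetMu h b.unop _ _).symm
    rw [smulHom_regEquiv, mul_one]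
    rfl
  takeuchi x z hz b := by
    replace hz := (mkQ_eq_comul_iff h).1 hz
    refine (regMuEquiv h).injective ?_
    -- Both sides are x acting on a class in L ⊗_B L, and t(b) ⊗ 1 and 1 ⊗ s(b) have the same class.
    rw [regMuEquiv_mk, regMuEquiv_mk, mkQ_mul_right h hz, mkQ_mul_right h hz, regMu_tmul,
      regMu_tmul]
    have := forgetMu_balanced h b (regEquiv k L 1) (regEquiv k L 1)
    rw [smulHom_regEquiv, smulHom_regEquiv, mul_one, mul_one] at this
    rw [this]
  comul_mul x y z w hz hw := by
    replace hz := (mkQ_eq_comul_iff h).1 hz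
    replace hw := (mkQ_eq_comul_iff h).1 hw
    refine ((mkQ_eq_comul_iff h).2 ?_).symm
    rw [mkQ_mul_right h hz, hw, map_mul]
    rfl
  coassoc x z w₁ w₂ hz h₁ h₂ := by
    replace hz := (mkQ_eq_comul_iff h).1 hz
    -- Both iterated comultiplications represent x · (1 ⊗ (1 ⊗ 1)).
    refine ker_tripleMu_le h (LinearMap.sub_mem_ker_iff.2 ?_)
    rw [tripleMu_of_rTensor h hz h₁, tripleMu_of_lTensor h hz h₂]
  counit_src b c := (forgetEps_bijective h).1 <| by
    rw [forgetEps_counit, smulHom_src_forgetEps]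
  counit_tgt b c := (forgetEps_bijective h).1 <| by
    rw [forgetEps_counit]
    exact smulHom_tgt_forgetEps h b.unop c
  counit_comul x z hz := by
    replace hz := (mkQ_eq_comul_iff h).1 hz
    let l := resHom k (λ_ (ModuleCat.of L L)).hom
    -- Write x as x acting on the image of ε(1) ⊗ 1 under the left unitor, where ε is the unit
    -- constraint B → U(1). L-linearity of the unitor and the diagonal action turn this into the sum
    -- of s(ε(x₁)(1)) x₂, with ε(x₁) now the counit.
    have h1 : regEquiv k L x =
        smulHom _ x (l (forgetMu h _ _ (forgetEps h 1 ⊗ₜ regEquiv k L 1))) := by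
      refine Eq.trans ?_ (congrArg (smulHom _ x) (forgetMu_leftUnitor h 1 _).symm)
      rw [map_one, map_one, Module.End.one_apply, smulHom_regEquiv, mul_one]
    rw [← resHom_smulHom, smulHom_forgetMu h hz] at h1
    refine (regEquiv k L).injective (Eq.trans ?_ h1.symm)
    refine LinearMap.congr_fun (f := (regEquiv k L).toLinearMap ∘ₗ LinearMap.mul' k L ∘ₗ
      TensorProduct.map (s.toLinearMap ∘ₗ (bialgCounit h).toLinearMap.flip 1) LinearMap.id)
      (g := l ∘ₗ forgetMu h _ _ ∘ₗ diagAct _ _ (forgetEps h 1) (regEquiv k L 1))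
      (TensorProduct.ext' fun u v => ?_) z
    change regEquiv k L (s (bialgCounit h u 1) * v) =
      l (forgetMu h _ _ (smulHom _ u (forgetEps h 1) ⊗ₜ regEquiv k L (v * 1)))
    rw [← forgetEps_counit, mul_one]
    exact (forgetMu_leftUnitor h (bialgCounit h u 1) (regEquiv k L v)).symm
  comul_counit x z hz := by
    replace hz := (mkQ_eq_comul_iff h).1 hz
    let l := resHom k (ρ_ (ModuleCat.of L L)).hom
    have h1 : regEquiv k L x =
        smulHom _ x (l (forgetMu h _ _ (regEquiv k L 1 ⊗ₜ forgetEps h 1))) := by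
      refine Eq.trans ?_ (congrArg (smulHom _ x) (forgetMu_rightUnitor h 1 _).symm)
      rw [MulOpposite.op_one, map_one, map_one, Module.End.one_apply, smulHom_regEquiv, mul_one]
    rw [← resHom_smulHom, smulHom_forgetMu h hz] at h1
    refine (regEquiv k L).injective (Eq.trans ?_ h1.symm)
    refine LinearMap.congr_fun (f := (regEquiv k L).toLinearMap ∘ₗ LinearMap.mul' k L ∘ₗ
      TensorProduct.map (t.toLinearMap ∘ₗ (MulOpposite.opLinearEquiv k).toLinearMap ∘ₗ
        (bialgCounit h).toLinearMap.flip 1) LinearMap.id ∘ₗ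
          (TensorProduct.comm k L L).toLinearMap)
      (g := l ∘ₗ forgetMu h _ _ ∘ₗ diagAct _ _ (regEquiv k L 1) (forgetEps h 1))
      (TensorProduct.ext' fun u v => ?_) z
    change regEquiv k L (t (.op (bialgCounit h v 1)) * u) =
      l (forgetMu h _ _ (regEquiv k L (u * 1) ⊗ₜ smulHom _ v (forgetEps h 1)))
    rw [← forgetEps_counit, mul_one]
    exact (forgetMu_rightUnitor h (bialgCounit h v 1) (regEquiv k L u)).symm

end
end

theorem mainTheorem6 {k H : Type u} [Field k] [AddCommGroup H] [Module k H] [Coalgebra k H]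
    [CoquasiHopfAlgebra k H]
    (hS : Function.Bijective (CoquasiHopfAlgebra.S : H →ₗ[k] H))
    (A : Mon (Comod k H))
    (hff : IsLeftFaithfullyFlat (leftB A))
    (hGal : IsGaloisExt A) :
    (coinvFunctor A).IsEquivalence ∧
    ∃ (_ : MonoidalCategory (ModuleCat.{u} (LAlg A)))
      (_ : (coinvFunctor A).Monoidal)
      (_ : (forgetL A).Monoidal)
      (𝓛 : TakeuchiBialgebra (srcMap A) (tgtMap A)),
      (∀ (M N : Bimod A A) (m : CoinvMod M) (n : CoinvMod N),
        CoinvMod.val (M ⊗ N) ((Functor.LaxMonoidal.μ (coinvFunctor A) M N).hom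
          (forgetMu (srcMap_commute_tgtMap A) ((coinvFunctor A).obj M) ((coinvFunctor A).obj N)
            (m ⊗ₜ n))) =
          (tensorProj M N).lin (CoinvMod.val M m ⊗ₜ[k] CoinvMod.val N n)) ∧
      (∀ b : CoinvAlg A,
        CoinvMod.val (𝟙_ (Bimod A A)) ((Functor.LaxMonoidal.ε (coinvFunctor A)).hom
          (forgetEps (srcMap_commute_tgtMap A) b)) = CoinvAlg.val A b) ∧
      (∀ (N N' : ModuleCat.{u} (LAlg A)) (x : LAlg A) (z : LAlg A ⊗[k] LAlg A),
        (balRel _ _).mkQ z = 𝓛.comul x → ∀ (n : N) (n' : N'),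
          x • (forgetMu (srcMap_commute_tgtMap A) N N' (n ⊗ₜ n') : (N ⊗ N' : ModuleCat _)) =
            forgetMu (srcMap_commute_tgtMap A) N N' (diagAct N N' n n' z)) ∧
      (∀ (x : LAlg A) (b : CoinvAlg A),
        x • (forgetEps (srcMap_commute_tgtMap A) b : (𝟙_ (ModuleCat (LAlg A)) : ModuleCat _)) =
          forgetEps (srcMap_commute_tgtMap A) (𝓛.counit x b)) := by
  have hG : (coinvFunctor A).IsEquivalence := coinvFunctor_isEquivalence hff hGal
  refine ⟨hG, ?_⟩
  -- The compatibilities of this transport say that the constraints of the composite U ∘ G are the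
  -- canonical ones; everything about L is then read off from U alone.
  obtain ⟨i₁, i₂, i₃, hμ, hε⟩ :=
    exists_monoidal_of_comp (coinvFunctor A) (forgetL A) (coinvCoreMonoidal hff hGal)
  let hc := srcMap_commute_tgtMap A
  refine ⟨i₁, i₂, i₃, takeuchiOfMonoidal hc, fun M N m n => ?_, fun b => ?_,
    fun N N' x z hz n n' => ?_, fun x b => ?_⟩
  · have h1 := LinearMap.congr_fun (congrArg (fun g => g.hom.hom) (hμ M N))
      (AlgBimod.proj ((coinvBimod A).obj M) ((coinvBimod A).obj N) (m ⊗ₜ n))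
    exact (congrArg (coinvVal (M ⊗ N)) h1).trans (coinvVal_coinvMu m n)
  · have h1 := LinearMap.congr_fun (congrArg (fun g => g.hom.hom) hε) b
    exact congrArg (coinvVal (𝟙_ (Bimod A A))) h1
  · exact smulHom_forgetMu hc ((mkQ_eq_comul_iff hc).1 hz) n n'
  · exact (forgetEps_counit hc x b).symm
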